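/- **Setting.** Let $\mathfrak g$ be a finite-dimensional real nilpotent Lie algebra, with the group law $X\bullet Y=\log(\exp X\exp Y)=X+Y+\tfrac12[X,Y]+\cdots$ given by the (finite) Baker–Campbell–Hausdorff formula, $\mathfrak g^\sharp$ its dual, $\langle X\mid\xi\rangle=\xi(X)$, and $\Xi=\mathfrak g\times\mathfrak g^\sharp$. Let $dX$ be a Haar (Lebesgue) measure on $\mathfrak g$, $d\xi$ the Haar measure on $\mathfrak g^\sharp$ for which $\mathfrak u\mapsto\int_{\mathfrak g^\sharp} e^{i\langle X\mid\xi\rangle}\mathfrak u(\xi)\,d\xi$ inverts $u\mapsto\int_{\mathfrak g} e^{-i\langle X\mid\xi\rangle}u(X)\,dX$, and $d\mathcal X=dX\,d\xi$ on $\Xi$. Scalar products $\langle\cdot,\cdot\rangle$ are those of $L^2$, linear in the first variable, extended to the pairing of tempered distributions with Schwartz functions; $\mathcal S$ denotes Schwartz spaces of complex-valued functions. For $u,v\in\mathcal S(\mathfrak g)$, $f,g\in\mathcal S(\Xi)$, $\Psi\in\mathcal S(\Xi\times\Xi)$ put - $[\mathsf E(Z,\zeta)u](X)=e^{i\langle X\mid\zeta\rangle}u([-Z]\bullet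 X)$ and $\mathcal E_{u,v}(\mathcal Z)=\langle \mathsf E(\mathcal Z)u,v\rangle$ for $\mathcal Z\in\Xi$; - $[\mathsf{Op}(f)u](X)=\int_{\mathfrak g}\int_{\mathfrak g^\sharp}e^{i\langle X\bullet(-Y)\mid\xi\rangle}f(X,\xi)u(Y)\,d\xi\,dY$ and $[\mathsf{Int}(\Psi)g](\mathcal X)=\int_\Xi\Psi(\mathcal X,\mathcal Y)g(\mathcal Y)\,d\mathcal Y$; - $\mathcal W_{u,v}(X,\xi)=\int_{\mathfrak g}\int_{\mathfrak g^\sharp} e^{-i\langle Y\mid\xi\rangle}e^{i\langle X\mid\eta\rangle}\,\overline{\mathcal E_{u,v}(Y,\eta)}\,d\eta\,dY$, the Wigner transform; - $(f\#g)(X,\xi)=\int_{\mathfrak g}\int_{\mathfrak g}\int_{\mathfrak g^\sharp}\int_{\mathfrak g^\sharp}e^{-i\langle Y\mid\xi\rangle}e^{i\langle X\bullet[-Z]\mid\eta\rangle}e^{i\langle Z\bullet[-X]\bullet Y\mid\zeta\rangle}f(X,\eta)g(Z,\zeta)\,d\zeta\,d\eta\,dZ\,dY$, the symbol of $\mathsf{Op}(f)\mathsf{Op}(g)$,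 and $f^\#(X,\xi)=\int_{\mathfrak g}\int_{\mathfrak g^\sharp}e^{i\langle Y\mid\eta-\xi\rangle}\overline{f([-Y]\bullet X,\eta)}\,d\eta\,dY$, the symbol of $\mathsf{Op}(f)^*$. These laws are extended by duality: $\langle F\#g,h\rangle=\langle F,h\#g^\#\rangle$, $\langle g\#F,h\rangle=\langle F,g^\#\#h\rangle$ and $\langle F^\#,h\rangle=\overline{\langle F,h^\#\rangle}$ for $F\in\mathcal S'(\Xi)$, $g,h\in\mathcal S(\Xi)$; and $\langle M\#F,h\rangle=\langle F,M^\#\#h\rangle$, $\langle F\#M,h\rangle=\langle F,h\#M^\#\rangle$ for $F\in\mathcal S'(\Xi)$ and $M$ in the Moyal algebra, i.e. $M\in\mathcal S'(\Xi)$ with $M\#\mathcal S(\Xi)\subset\mathcal S(\Xi)$ and $\mathcal S(\Xi)\#M\subset\mathcal S(\Xi)$; - $\varepsilon_{(Z,\zeta)}(X,\xi)=e^{i\langle X\mid\zeta\rangle}e^{-i\langle Z\mid\xi\rangle}$ (which belongs to the Moyal algebra) and, for a window $h\in\mathcal S(\Xi)$, $[\mathfrak E_h(f)](\mathcal Y,\mathcal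 Z)=\langle\varepsilon_{\mathcal Y}\#f\#\varepsilon_{\mathcal Z}^\#,h\rangle$. For a norm $\|\cdot\|_{\mathcal B}$ on $\mathcal S(\Xi)$, a norm $\|\cdot\|_{\mathfrak B}$ on $\mathcal S(\Xi\times\Xi)$ and windows $w\in\mathcal S(\mathfrak g)$, $h\in\mathcal S(\Xi)$, the coorbit norms are $\|u\|_{\mathsf{co}_w(\mathcal B)}=\|\mathcal E_{u,w}\|_{\mathcal B}$ for $u\in\mathcal S(\mathfrak g)$ and $\|f\|_{\mathsf{Co}_h(\mathfrak B)}=\|\mathfrak E_h(f)\|_{\mathfrak B}$ for $f\in\mathcal S(\Xi)$. **Theorem.** Let $w_1,w_2\in\mathcal S(\mathfrak g)$ with $\|w_1\|_{L^2(\mathfrak g)}=\|w_2\|_{L^2(\mathfrak g)}=1$, let $\|\cdot\|_{\mathcal B_1},\|\cdot\|_{\mathcal B_2}$ be norms on $\mathcal S(\Xi)$ and $\|\cdot\|_{\mathfrak B}$ a norm on $\mathcal S(\Xi\times\Xi)$. Suppose that there is a constant $C>0$ such that for every $\Psi\in\mathcal S(\Xi\times\Xi)$ the operator $\mathsf{Int}(\Psi)$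 is bounded from $(\mathcal S(\Xi),\|\cdot\|_{\mathcal B_1})$ to $(\mathcal S(\Xi),\|\cdot\|_{\mathcal B_2})$ with operator norm at most $C\|\Psi\|_{\mathfrak B}$. Then $\mathcal W_{w_1,w_2}\in\mathcal S(\Xi)$ and $\langle\mathsf{Op}(f)w_1,w_2\rangle=\langle f,\mathcal W_{w_1,w_2}\rangle$ for all $f\in\mathcal S(\Xi)$; for all $u\in\mathcal S(\mathfrak g)$ and $f\in\mathcal S(\Xi)$ one has $\mathcal E_{u,w_1},\mathcal E_{u,w_2}\in\mathcal S(\Xi)$, $\mathsf{Op}(f)u\in\mathcal S(\mathfrak g)$ and $\mathfrak E_{\mathcal W_{w_1,w_2}}(f)\in\mathcal S(\Xi\times\Xi)$; and for every $f\in\mathcal S(\Xi)$ the operator $\mathsf{Op}(f)$ is bounded from $(\mathcal S(\mathfrak g),\|\cdot\|_{\mathsf{co}_{w_1}(\mathcal B_1)})$ to $(\mathcal S(\mathfrak g),\|\cdot\|_{\mathsf{co}_{w_2}(\mathcal B_2)})$ with operator norm at most $C\|f\|_{\mathsf{Co}_{\mathcal W_{w_1,w_2}}(\mathfrak B)}$.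 -/

import Mathlib

open MeasureTheory
open scoped SchwartzMap ComplexConjugate

/-- A Lie ring whose additive group carries an auxiliary norm. The norm and the bracket need not be
related: on a finite-dimensional real Lie algebra all norms are equivalent, and the norm is only used
to speak of Schwartz functions and of the Borel structure. -/
class NormedLieRing (𝔤 : Type*) extends NormedAddCommGroup 𝔤, LieRing 𝔤

/-- A real Lie algebra with an auxiliary vector space norm (unrelated to the bracket). -/
class NormedLieAlgebra (𝔤 : Type*) [NormedLieRing 𝔤] extends NormedSpace ℝ 𝔤, LieAlgebra ℝ 𝔤

namespace Coorbit

noncomputable section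

/-! ### The Baker-Campbell-Hausdorff product -/

section BCH

variable {𝔤 : Type*} [LieRing 𝔤] [LieAlgebra ℝ 𝔤]

/-- The right-nested bracket `[x₁, [x₂, [⋯, xₙ]]]` of a word `x₁ x₂ ⋯ xₙ` (with `[x] = x`). -/
def nestedBracket : List 𝔤 → 𝔤
  | [] => 0
  | [x] => x
  | x :: y :: l => ⁅x, nestedBracket (y :: l)⁆

/-- The word `X^{r₁} Y^{s₁} ⋯ X^{rₖ} Y^{sₖ}`, where `p i = (rᵢ, sᵢ)`. -/
def dynkinWord (X Y : 𝔤) {k : ℕ} (p : Fin k → ℕ × ℕ) : List 𝔤 :=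
  (List.finRange k).flatMap fun i => List.replicate (p i).1 X ++ List.replicate (p i).2 Y

/-- The coefficient `(-1)^{k-1} / (k · ∑ᵢ (rᵢ + sᵢ) · ∏ᵢ rᵢ! sᵢ!)` of Dynkin's formula. -/
def dynkinCoeff {k : ℕ} (p : Fin k → ℕ × ℕ) : ℝ :=
  (-1) ^ (k - 1) / ((k : ℝ) * ((∑ i, ((p i).1 + (p i).2) : ℕ) : ℝ)
    * ∏ i, (((p i).1.factorial * (p i).2.factorial : ℕ) : ℝ))

/-- The Baker-Campbell-Hausdorff product `X • Y = log (exp X exp Y) = X + Y + ½ [X, Y] + ⋯` of a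
nilpotent Lie algebra, by Dynkin's formula: the sum over all `k ≥ 1` and all
`(r₁, s₁), …, (rₖ, sₖ) ∈ ℕ² ∖ {(0, 0)}` of `dynkinCoeff` times the nested bracket of the word
`X^{r₁} Y^{s₁} ⋯ X^{rₖ} Y^{sₖ}`. Brackets of words longer than the nilpotency length `N` vanish,
so only `k ≤ N` and `rᵢ, sᵢ ≤ N` are needed. -/
def bch (X Y : 𝔤) : 𝔤 :=
  let N := LieModule.nilpotencyLength 𝔤 𝔤
  ∑ k ∈ Finset.Icc 1 N,
    ∑ p ∈ Fintype.piFinset fun _ : Fin k =>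
        (Finset.range (N + 1) ×ˢ Finset.range (N + 1)).erase (0, 0),
      dynkinCoeff p • nestedBracket (dynkinWord X Y p)

end BCH

scoped infixl:70 " ● " => bch

/-! ### Schwartz functions, pairings, bounds -/

section General

variable {E : Type*} [NormedAddCommGroup E] [NormedSpace ℝ E]

/-- The function `F` is a Schwartz function. -/
def IsSchwartz (F : E → ℂ) : Prop := ∃ s : 𝓢(E, ℂ), ⇑s = F

open Classical in
/-- A function that belongs to the Schwartz space, as an element of that space. -/
def toSchwartz (F : E → ℂ) : 𝓢(E, ℂ) :=
  if h : IsSchwartz F then h.choose else 0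

/-- The scalar product `⟨f, g⟩ = ∫ f ḡ dm`, linear in the first variable. -/
def pairing {E : Type*} [MeasurableSpace E] (m : Measure E) (f g : E → ℂ) : ℂ :=
  ∫ x, f x * conj (g x) ∂m

/-- `T : (E, p) → (F, q)` is bounded with operator norm at most `M`. -/
def OpNormLE {E F : Type*} (p : E → ℝ) (q : F → ℝ) (T : E → F) (M : ℝ) : Prop :=
  ∀ x, q (T x) ≤ M * p x

/-- A seminorm that is a norm. -/
def IsNorm {V : Type*} [AddCommGroup V] [Module ℂ V] (p : Seminorm ℂ V) : Prop :=
  ∀ x, p x = 0 → x = 0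

end General

/-! ### Phase space and its measure -/

variable {𝔤 : Type*} [NormedLieRing 𝔤] [NormedLieAlgebra 𝔤]

variable (𝔤) in
/-- The phase space `Ξ = 𝔤 × 𝔤♯`. -/
abbrev Phase := 𝔤 × StrongDual ℝ 𝔤

variable [FiniteDimensional ℝ 𝔤]

variable (𝔤) in
/-- The basis of `𝔤♯` dual to the chosen basis `Module.finBasis ℝ 𝔤` of `𝔤`. -/
def dualFinBasis : Module.Basis (Fin (Module.finrank ℝ 𝔤)) ℝ (StrongDual ℝ 𝔤) :=
  (Module.finBasis ℝ 𝔤).dualBasis.map LinearMap.toContinuousLinearMap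

variable [MeasurableSpace 𝔤] [BorelSpace 𝔤]

/-- The Haar measure `dξ` on `𝔤♯` dual to the Haar measure `dX = μ` on `𝔤`, i.e. the one for which
`(𝓕⁻¹ 𝔲)(X) = ∫ e^{i⟨X|ξ⟩} 𝔲(ξ) dξ` inverts `(𝓕 u)(ξ) = ∫ e^{-i⟨X|ξ⟩} u(X) dX`. If `μ` is `c` times
Lebesgue measure in the coordinates of a basis, it is `(2π)^{-n} c⁻¹` times Lebesgue measure in the
coordinates of the dual basis. -/
def dualHaar (μ : Measure 𝔤) : Measure (StrongDual ℝ 𝔤) :=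
  (ENNReal.ofReal ((2 * Real.pi) ^ Module.finrank ℝ 𝔤)
      * μ (parallelepiped (Module.finBasis ℝ 𝔤)))⁻¹ • (dualFinBasis 𝔤).addHaar

/-- The measure `d𝒳 = dX dξ` on `Ξ`. -/
def phaseMeasure (μ : Measure 𝔤) : Measure (Phase 𝔤) := μ.prod (dualHaar μ)

/-! ### Weyl system, Fourier-Wigner and Wigner transforms, quantization -/

/-- `cexpI t = e^{it}`. -/
def cexpI (t : ℝ) : ℂ := Complex.exp (Complex.I * t)

/-- The exponential function `ε_{(Z,ζ)}(X, ξ) = e^{i⟨X|ζ⟩} e^{-i⟨Z|ξ⟩}` on `Ξ`. -/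
def expFun (𝒵 : Phase 𝔤) : Phase 𝔤 → ℂ :=
  fun 𝒳 => cexpI (𝒵.2 𝒳.1) * cexpI (-(𝒳.2 𝒵.1))

/-- The Weyl system, `[E(Z,ζ) u](X) = e^{i⟨X|ζ⟩} u([-Z] • X)`. -/
def weyl (𝒵 : Phase 𝔤) (u : 𝔤 → ℂ) : 𝔤 → ℂ :=
  fun X => cexpI (𝒵.2 X) * u ((-𝒵.1) ● X)

/-- The Fourier-Wigner transform `ℰ_{u,v}(𝒵) = ⟨E(𝒵) u, v⟩`. -/
def fourierWigner (μ : Measure 𝔤) (u v : 𝔤 → ℂ) : Phase 𝔤 → ℂ :=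
  fun 𝒵 => pairing μ (weyl 𝒵 u) v

/-- The total Fourier transform `f̃(Z,ζ) = ∫∫ e^{-i⟨Y|ζ⟩} e^{i⟨Z|η⟩} f(Y,η) dY dη`. -/
def totalFourier (μ : Measure 𝔤) (f : Phase 𝔤 → ℂ) : Phase 𝔤 → ℂ :=
  fun 𝒵 => ∫ 𝒴, cexpI (-(𝒵.2 𝒴.1)) * cexpI (𝒴.2 𝒵.1) * f 𝒴 ∂(phaseMeasure μ)

/-- The pseudo-differential operator
`[Op(f) u](X) = ∫∫ e^{i⟨X • (-Y)|ξ⟩} f(X,ξ) u(Y) dY dξ`. -/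
def Op (μ : Measure 𝔤) (f : Phase 𝔤 → ℂ) (u : 𝔤 → ℂ) : 𝔤 → ℂ :=
  fun X => ∫ Y, ∫ ξ, cexpI (ξ (X ● (-Y))) * f (X, ξ) * u Y ∂(dualHaar μ) ∂μ

/-- The Wigner transform `𝒲_{u,v}`, the function with `⟨Op(f) u, v⟩ = ⟨f, 𝒲_{u,v}⟩` for all
`f ∈ 𝓢(Ξ)`. Since `⟨Op(f) u, v⟩ = ∫ f̃ ℰ_{u,v}` is the scalar product of `f̃` with the complex
conjugate of `ℰ_{u,v}`, it is by Plancherel the total Fourier transform of that conjugate (the total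
Fourier transform is unitary and its own inverse). -/
def wigner (μ : Measure 𝔤) (u v : 𝔤 → ℂ) : Phase 𝔤 → ℂ :=
  totalFourier μ fun 𝒵 => conj (fourierWigner μ u v 𝒵)

/-- The integral operator with kernel `Ψ` on `Ξ × Ξ`. -/
def intOp (μ : Measure 𝔤) (Ψ : Phase 𝔤 × Phase 𝔤 → ℂ) (g : Phase 𝔤 → ℂ) : Phase 𝔤 → ℂ :=
  fun 𝒳 => ∫ 𝒴, Ψ (𝒳, 𝒴) * g 𝒴 ∂(phaseMeasure μ)

/-! ### The symbol algebra and its extension by duality -/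

/-- The composition of symbols, `Op(f # g) = Op(f) Op(g)`, as an iterated integral:
`(f # g)(X,ξ) = ∫∫∫∫ e^{-i⟨Y|ξ⟩} e^{i⟨X•(-Z)|η⟩} e^{i⟨Z•(-X)•Y|ζ⟩} f(X,η) g(Z,ζ) dY dZ dη dζ`. -/
def sharpFun (μ : Measure 𝔤) (f g : Phase 𝔤 → ℂ) : Phase 𝔤 → ℂ := fun 𝒳 =>
  ∫ Y, ∫ Z, ∫ η : StrongDual ℝ 𝔤, ∫ ζ : StrongDual ℝ 𝔤,
    cexpI (-(𝒳.2 Y)) * cexpI (η (𝒳.1 ● (-Z))) * cexpI (ζ (Z ● (-𝒳.1) ● Y))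
      * f (𝒳.1, η) * g (Z, ζ) ∂(dualHaar μ) ∂(dualHaar μ) ∂μ ∂μ

/-- The adjoint of symbols, `Op(f^#) = Op(f)^*`:
`f^#(X,ξ) = ∫∫ e^{i⟨Y|η-ξ⟩} conj f([-Y]•X, η) dY dη`. -/
def adjFun (μ : Measure 𝔤) (f : Phase 𝔤 → ℂ) : Phase 𝔤 → ℂ := fun 𝒳 =>
  ∫ Y, ∫ η : StrongDual ℝ 𝔤, cexpI ((η - 𝒳.2) Y) * conj (f ((-Y) ● 𝒳.1, η)) ∂(dualHaar μ) ∂μ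

/-- The product `f # g` as an operation on the Schwartz space `𝓢(Ξ)`. -/
def sharp (μ : Measure 𝔤) (f g : 𝓢(Phase 𝔤, ℂ)) : 𝓢(Phase 𝔤, ℂ) := toSchwartz (sharpFun μ f g)

/-- The involution `f ↦ f^#` on the Schwartz space `𝓢(Ξ)`. -/
def adj (μ : Measure 𝔤) (f : 𝓢(Phase 𝔤, ℂ)) : 𝓢(Phase 𝔤, ℂ) := toSchwartz (adjFun μ f)

variable (𝔤) in
/-- Distributions on `Ξ`, given through the sesquilinear pairing `h ↦ ⟨F, h⟩` with Schwartz
functions. -/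
abbrev Dist := 𝓢(Phase 𝔤, ℂ) → ℂ

/-- A function of polynomial growth as a distribution, `⟨F, h⟩ = ∫ F h̄`. -/
def ofFun (μ : Measure 𝔤) (F : Phase 𝔤 → ℂ) : Dist 𝔤 := fun h => pairing (phaseMeasure μ) F h

/-- `F # g` for a distribution `F` and `g ∈ 𝓢(Ξ)`: `⟨F # g, h⟩ = ⟨F, h # g^#⟩`. -/
def distSharp (μ : Measure 𝔤) (F : Dist 𝔤) (g : 𝓢(Phase 𝔤, ℂ)) : Dist 𝔤 :=
  fun h => F (sharp μ h (adj μ g))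

/-- `g # F` for `g ∈ 𝓢(Ξ)` and a distribution `F`: `⟨g # F, h⟩ = ⟨F, g^# # h⟩`. -/
def sharpDist (μ : Measure 𝔤) (g : 𝓢(Phase 𝔤, ℂ)) (F : Dist 𝔤) : Dist 𝔤 :=
  fun h => F (sharp μ (adj μ g) h)

/-- `F^#` for a distribution `F`: `⟨F^#, h⟩ = ⟨h^#, F⟩ = conj ⟨F, h^#⟩`. -/
def distAdj (μ : Measure 𝔤) (F : Dist 𝔤) : Dist 𝔤 := fun h => conj (F (adj μ h))

open Classical in
/-- A distribution that belongs to `𝓢(Ξ)`, as an element of `𝓢(Ξ)`. -/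
def Dist.toSchwartz (μ : Measure 𝔤) (F : Dist 𝔤) : 𝓢(Phase 𝔤, ℂ) :=
  if h : ∃ s : 𝓢(Phase 𝔤, ℂ), F = ofFun μ s then h.choose else 0

/-- `M # F` for `M` in the Moyal algebra (so that `M^# # h ∈ 𝓢(Ξ)` for all `h ∈ 𝓢(Ξ)`) and a
distribution `F`: `⟨M # F, h⟩ = ⟨F, M^# # h⟩`. -/
def moyalSharpDist (μ : Measure 𝔤) (M F : Dist 𝔤) : Dist 𝔤 :=
  fun h => F (Dist.toSchwartz μ (distSharp μ (distAdj μ M) h))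

/-- `F # M` for a distribution `F` and `M` in the Moyal algebra (so that `h # M^# ∈ 𝓢(Ξ)` for all
`h ∈ 𝓢(Ξ)`): `⟨F # M, h⟩ = ⟨F, h # M^#⟩`. -/
def distSharpMoyal (μ : Measure 𝔤) (F M : Dist 𝔤) : Dist 𝔤 :=
  fun h => F (Dist.toSchwartz μ (sharpDist μ h (distAdj μ M)))

/-- The phase-space shift `θ_{𝒴,𝒵}(F) = ε_𝒴 # F # ε_𝒵^#`. -/
def phaseShift (μ : Measure 𝔤) (𝒴 𝒵 : Phase 𝔤) (F : Dist 𝔤) : Dist 𝔤 :=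
  distSharpMoyal μ (moyalSharpDist μ (ofFun μ (expFun 𝒴)) F) (distAdj μ (ofFun μ (expFun 𝒵)))

/-- The transformation `[𝔈_h(F)](𝒴,𝒵) = ⟨θ_{𝒴,𝒵}(F), h⟩` with window `h`. -/
def symbolTransform (μ : Measure 𝔤) (h : 𝓢(Phase 𝔤, ℂ)) (F : Dist 𝔤) :
    Phase 𝔤 × Phase 𝔤 → ℂ :=
  fun q => phaseShift μ q.1 q.2 F h

/-! ### Operators and coorbit norms on Schwartz spaces -/

/-- `Op(f)` as an operator in `𝓢(𝔤)`. -/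
def opS (μ : Measure 𝔤) (f : 𝓢(Phase 𝔤, ℂ)) (u : 𝓢(𝔤, ℂ)) : 𝓢(𝔤, ℂ) := toSchwartz (Op μ f u)

/-- `Int(Ψ)` as an operator in `𝓢(Ξ)`. -/
def intS (μ : Measure 𝔤) (Ψ : 𝓢(Phase 𝔤 × Phase 𝔤, ℂ)) (g : 𝓢(Phase 𝔤, ℂ)) : 𝓢(Phase 𝔤, ℂ) :=
  toSchwartz (intOp μ Ψ g)

/-- The Wigner transform of two Schwartz functions as an element of `𝓢(Ξ)`. -/
def wignerS (μ : Measure 𝔤) (u v : 𝓢(𝔤, ℂ)) : 𝓢(Phase 𝔤, ℂ) := toSchwartz (wigner μ u v)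

/-- The coorbit norm `‖u‖_{co_w(ℬ)} = ‖ℰ_{u,w}‖_ℬ` on `𝓢(𝔤)`. -/
def coNorm (μ : Measure 𝔤) (w : 𝓢(𝔤, ℂ)) (B : Seminorm ℂ 𝓢(Phase 𝔤, ℂ)) (u : 𝓢(𝔤, ℂ)) : ℝ :=
  B (toSchwartz (fourierWigner μ u w))

/-- The coorbit norm `‖f‖_{Co_h(𝔅)} = ‖𝔈_h(f)‖_𝔅` on `𝓢(Ξ)`. -/
def symbolCoNorm (μ : Measure 𝔤) (h : 𝓢(Phase 𝔤, ℂ))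
    (𝔅 : Seminorm ℂ 𝓢(Phase 𝔤 × Phase 𝔤, ℂ)) (f : 𝓢(Phase 𝔤, ℂ)) : ℝ :=
  𝔅 (toSchwartz (symbolTransform μ h (ofFun μ f)))

end

end Coorbit

namespace Coorbit

set_option linter.unusedSectionVars false

/-! Passing from `u` to its Fourier-Wigner transform turns `Op f` into an integral operator on phase
space: `ℰ_{Op(f)u, w₂} = Int(Ψ) ℰ_{u, w₁}` with `Ψ = 𝔈_h(f)`, `h = 𝒲_{w₁,w₂}` (`fourierWigner_op`).
Once `Ψ` and `ℰ_{u, w₁}` are known to be Schwartz functions, the bound is the assumption on `Int`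
applied to them (`coNorm_op_le`).

The identity comes from the orthogonality relations `⟨ℰ_{u,w}, ℰ_{v,w}⟩ = ⟨u, v⟩ ‖w‖²`
(`pairing_fourierWigner`). At a point `𝒴`, the left side is `⟨u, v⟩` with `v = (E(𝒴) Op(f))^* w₂`.
As `‖w₁‖ = 1`, this equals `⟨ℰ_{u,w₁}, ℰ_{v,w₁}⟩`, and the conjugate of `ℰ_{v,w₁}(𝒵)` is `Ψ(𝒴, 𝒵)`.
To recognise `Ψ`, symbols are traded for integral kernels: a partial Fourier transform and a
polynomial change of variables identify the Schwartz functions on `Ξ` with those on `𝔤 × 𝔤`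
(`opKernel_symbol`, `symbol_opKernel`). Under it `#` becomes composition, the involution becomes the
adjoint kernel, `𝒲_{w₁,w₂}` becomes the rank-one kernel `w₂ ⊗ w̄₁`, and multiplication by `ε_𝒵`
becomes composition with the Weyl operator.

All this needs `●` to be a group law with polynomial, measure-preserving translations. Associativity
of Dynkin's series (`dynkinSum_assoc`) is derived from `exp Z = exp X exp Y` in nilpotent
associative algebras (`nilExp_dynkinSum`), where an Euler derivation `d` determines `Z` from `dZ`.
It is transferred to a nilpotent Lie algebra without a faithful representation: the Lie algebra of
polynomial curves acts on its semidirect product with `d/dt`, which detects the derivative of a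
curve. Translations preserve the measure since their derivatives are unipotent for the lower central
series (`hasFDerivAt_bch`, `det_one_add_of_mem_lcsShift`).

Schwartz regularity rests on one criterion: bounded functions whose span is stable under derivatives
and multiplication by linear forms are Schwartz (`isSchwartz_of_stable`). It yields tensor products
and partial Fourier transforms. -/

theorem nestedBracket_cons {L : Type*} [LieRing L] (x : L) {l : List L} (hl : l ≠ []) :
    nestedBracket (x :: l) = ⁅x, nestedBracket l⁆ := by
  cases l with
  | nil => exact absurd rfl hl
  | cons y l => rfl

/-! ### Dynkin's series and its summation over blocks -/

section Dynkin

variable {L : Type*} [LieRing L] [LieAlgebra ℝ L]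

theorem nestedBracket_replicate_append (x : L) (r : ℕ) {l : List L} (hl : l ≠ []) :
    nestedBracket (List.replicate r x ++ l) = ((LieAlgebra.ad ℝ L x) ^ r) (nestedBracket l) := by
  induction r with
  | zero => simp
  | succ r ih =>
    rw [List.replicate_succ, List.cons_append, nestedBracket_cons x (by simp [hl]), ih, pow_succ']
    rfl

theorem nestedBracket_replicate (x : L) {r : ℕ} (hr : 2 ≤ r) :
    nestedBracket (List.replicate r x) = 0 := by
  obtain ⟨r, rfl⟩ := Nat.exists_eq_add_of_le' hr
  have h : List.replicate (r + 2) x = List.replicate (r + 1) x ++ [x] := by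
    rw [← List.replicate_succ']
  rw [h, nestedBracket_replicate_append x _ (by simp), pow_succ]
  simp [nestedBracket]

theorem nestedBracket_map {L' F : Type*} [LieRing L'] [FunLike F L L'] [ZeroHomClass F L L']
    (f : F) (hf : ∀ x y, f ⁅x, y⁆ = ⁅f x, f y⁆) (l : List L) :
    f (nestedBracket l) = nestedBracket (l.map f) := by
  induction l with
  | nil => simp [nestedBracket]
  | cons x l ih =>
    by_cases hl : l = []
    · simp [hl, nestedBracket]
    · rw [nestedBracket_cons x hl, hf, ih, List.map_cons, nestedBracket_cons _ (by simpa using hl)]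

theorem nestedBracket_mem_lcs (l : List L) (k : ℕ) (hl : k < l.length) :
    nestedBracket l ∈ LieModule.lowerCentralSeries ℝ L L k := by
  induction l generalizing k with
  | nil => simp at hl
  | cons x l ih =>
    cases k with
    | zero => simp
    | succ k =>
      have hl' : l ≠ [] := by rintro rfl; simp at hl
      rw [nestedBracket_cons x hl', LieModule.lowerCentralSeries_succ]
      exact LieSubmodule.lie_mem_lie (LieSubmodule.mem_top x) (ih k (by simpa using hl))

theorem dynkinWord_cons (X Y : L) {k : ℕ} (a : ℕ × ℕ) (p : Fin k → ℕ × ℕ) :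
    dynkinWord X Y (Fin.cons a p : Fin (k + 1) → ℕ × ℕ) =
      List.replicate a.1 X ++ (List.replicate a.2 Y ++ dynkinWord X Y p) := by
  simp [dynkinWord, List.finRange_succ, List.flatMap_map]

theorem dynkinWord_zero (X Y : L) (p : Fin 0 → ℕ × ℕ) : dynkinWord X Y p = [] := by
  simp [dynkinWord]

theorem length_dynkinWord (X Y : L) {k : ℕ} (p : Fin k → ℕ × ℕ) :
    (dynkinWord X Y p).length = ∑ i, ((p i).1 + (p i).2) := by
  induction k with
  | zero => simp [dynkinWord_zero]
  | succ k ih =>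
    rw [← Fin.cons_self_tail p, dynkinWord_cons, Fin.sum_univ_succ]
    simp [ih, Fin.tail, add_assoc]

theorem map_dynkinWord {L' : Type*} [LieRing L'] [LieAlgebra ℝ L'] (f : L → L') (X Y : L) {k : ℕ}
    (p : Fin k → ℕ × ℕ) : (dynkinWord X Y p).map f = dynkinWord (f X) (f Y) p := by
  simp [dynkinWord, List.map_flatMap]

/-- The exponents of one block of a Dynkin word, truncated at `N`. -/
def blocks (N : ℕ) : Finset (ℕ × ℕ) := (Finset.range (N + 1) ×ˢ Finset.range (N + 1)).erase (0, 0)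

theorem mem_blocks {N : ℕ} {a : ℕ × ℕ} : a ∈ blocks N ↔ a ≠ 0 ∧ a.1 ≤ N ∧ a.2 ≤ N := by
  simp [blocks, Prod.ext_iff]

/-- Dynkin's series truncated at `N`. -/
noncomputable def dynkinSum (N : ℕ) (X Y : L) : L :=
  ∑ k ∈ Finset.Icc 1 N, ∑ p ∈ Fintype.piFinset fun _ : Fin k => blocks N,
    dynkinCoeff p • nestedBracket (dynkinWord X Y p)

theorem bch_eq_dynkinSum (X Y : L) : bch X Y = dynkinSum (LieModule.nilpotencyLength L L) X Y := rfl

theorem le_sum_of_mem_blocks {k N : ℕ} {p : Fin k → ℕ × ℕ}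
    (hp : p ∈ Fintype.piFinset fun _ : Fin k => blocks N) : k ≤ ∑ i, ((p i).1 + (p i).2) := by
  calc k = ∑ _i : Fin k, 1 := by simp
    _ ≤ _ := Finset.sum_le_sum fun i _ => by
      have := (mem_blocks.1 (Fintype.mem_piFinset.1 hp i)).1
      rw [Nat.one_le_iff_ne_zero]
      intro h
      exact this (Prod.ext (by simp at h ⊢; omega) (by simp at h ⊢; omega))

theorem le_length_dynkinWord (X Y : L) {k N : ℕ} {p : Fin k → ℕ × ℕ}
    (hp : p ∈ Fintype.piFinset fun _ : Fin k => blocks N) : k ≤ (dynkinWord X Y p).length :=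
  (le_sum_of_mem_blocks hp).trans_eq (length_dynkinWord X Y p).symm

theorem nestedBracket_eq_zero {N : ℕ} (hN : LieModule.lowerCentralSeries ℝ L L N = ⊥)
    {l : List L} (hl : N < l.length) : nestedBracket l = 0 := by
  have := nestedBracket_mem_lcs l N hl
  rwa [hN, LieSubmodule.mem_bot] at this

/-- The truncation level is immaterial once long words vanish. Only words in `X` and `Y` are
required to vanish, so the lemma also serves in associative algebras that are not nilpotent as a
whole. -/
theorem dynkinSum_eq_of_le {N M : ℕ} (X Y : L)
    (hN : ∀ l : List L, (∀ x ∈ l, x = X ∨ x = Y) → N < l.length → nestedBracket l = 0)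
    (hNM : N ≤ M) : dynkinSum M X Y = dynkinSum N X Y := by
  have hmem : ∀ (k : ℕ) (p : Fin k → ℕ × ℕ), ∀ x ∈ dynkinWord X Y p, x = X ∨ x = Y := by
    intro k p x hx
    simp only [dynkinWord, List.mem_flatMap, List.mem_append, List.mem_replicate] at hx
    tauto
  unfold dynkinSum
  symm
  rw [← Finset.sum_subset (Finset.Icc_subset_Icc_right hNM)]
  · refine Finset.sum_congr rfl fun k _ => Finset.sum_subset ?_ ?_
    · refine Fintype.piFinset_subset _ _ fun _ a ha => ?_
      rw [mem_blocks] at ha ⊢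
      exact ⟨ha.1, ha.2.1.trans hNM, ha.2.2.trans hNM⟩
    · intro p hp hp'
      -- A term outside the smaller box has an exponent above `N`, hence a word longer than `N`.
      rw [hN _ (hmem _ _), smul_zero]
      rw [length_dynkinWord]
      simp only [Fintype.mem_piFinset, not_forall] at hp'
      obtain ⟨i, hi⟩ := hp'
      have h1 := (mem_blocks.1 (Fintype.mem_piFinset.1 hp i)).1
      have h2 : (p i).1 + (p i).2 ≤ ∑ i, ((p i).1 + (p i).2) :=
        Finset.single_le_sum (f := fun i => (p i).1 + (p i).2) (fun _ _ => Nat.zero_le _)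
          (Finset.mem_univ i)
      rw [mem_blocks] at hi
      by_contra hcon
      exact hi ⟨h1, by omega, by omega⟩
  · intro k hk hk'
    refine Finset.sum_eq_zero fun p hp => ?_
    rw [hN _ (hmem _ _), smul_zero]
    have := le_length_dynkinWord X Y hp
    simp only [Finset.mem_Icc] at hk hk'
    omega

theorem map_dynkinSum {L' : Type*} [LieRing L'] [LieAlgebra ℝ L'] (N : ℕ) (f : L →ₗ[ℝ] L')
    (hf : ∀ x y, f ⁅x, y⁆ = ⁅f x, f y⁆) (X Y : L) :
    f (dynkinSum N X Y) = dynkinSum N (f X) (f Y) := by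
  simp only [dynkinSum, map_sum, map_smul]
  simp only [nestedBracket_map f hf, map_dynkinWord]

/-- The truncated exponential series of `ad x`. -/
noncomputable def expAd (N : ℕ) (x : L) : Module.End ℝ L :=
  ∑ i ∈ Finset.range (N + 1), ((i.factorial : ℝ)⁻¹) • (LieAlgebra.ad ℝ L x) ^ i

/-- The factor `∏ᵢ 1 / (rᵢ! sᵢ!)`. -/
noncomputable def blockCoeff {k : ℕ} (p : Fin k → ℕ × ℕ) : ℝ :=
  (∏ i, (((p i).1.factorial * (p i).2.factorial : ℕ) : ℝ))⁻¹

theorem sum_piFinset_succ {V : Type*} [AddCommMonoid V] (N k : ℕ)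
    (f : (Fin (k + 1) → ℕ × ℕ) → V) :
    ∑ p ∈ Fintype.piFinset (fun _ : Fin (k + 1) => blocks N), f p =
      ∑ a ∈ blocks N, ∑ p ∈ Fintype.piFinset (fun _ : Fin k => blocks N), f (Fin.cons a p) := by
  rw [← Finset.sum_product']
  refine Finset.sum_nbij' (fun p => (p 0, Fin.tail p)) (fun q => Fin.cons q.1 q.2) ?_ ?_ ?_ ?_ ?_
  · intro p hp
    simp only [Fintype.mem_piFinset, Finset.mem_product] at hp ⊢
    exact ⟨hp 0, fun i => hp i.succ⟩
  · intro q hq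
    simp only [Fintype.mem_piFinset, Finset.mem_product] at hq ⊢
    exact Fin.cases hq.1 hq.2
  · intro p _; exact Fin.cons_self_tail p
  · intro q _; simp
  · intro p _; simp

theorem blockCoeff_cons {k : ℕ} (a : ℕ × ℕ) (p : Fin k → ℕ × ℕ) :
    blockCoeff (Fin.cons a p : Fin (k + 1) → ℕ × ℕ) =
      (a.1.factorial : ℝ)⁻¹ * (a.2.factorial : ℝ)⁻¹ * blockCoeff p := by
  simp [blockCoeff, Fin.prod_univ_succ, mul_comm]

/-- Prefixing a block `X^r Y^s` to a nonempty word applies `(ad X)^r (ad Y)^s` to its bracket. The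
full sum is a product of two exponentials; the excluded pair `(0, 0)` accounts for the `- 1`. -/
theorem sum_blocks_ad (N : ℕ) (X Y : L) (u : L) :
    ∑ a ∈ blocks N, ((a.1.factorial : ℝ)⁻¹ * (a.2.factorial : ℝ)⁻¹) •
      ((LieAlgebra.ad ℝ L X) ^ a.1) (((LieAlgebra.ad ℝ L Y) ^ a.2) u) =
      (expAd N X * expAd N Y - 1) u := by
  rw [eq_comm, LinearMap.sub_apply, sub_eq_iff_eq_add, blocks,
    Finset.sum_erase_eq_sub (by simp), Finset.sum_product]
  simp only [expAd, Module.End.mul_apply, LinearMap.sum_apply, LinearMap.smul_apply, map_sum,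
    map_smul, Finset.smul_sum, smul_smul]
  rw [Finset.sum_comm]
  simp [mul_comm]

/-- The last block contains the innermost bracket, so it vanishes if it ends in a repeated letter.
The surviving blocks are `X` alone and `X^r Y`, which sum to `e^{ad X} Y`. -/
theorem sum_blocks_last {N : ℕ} (hN : 1 ≤ N) (X Y : L) :
    ∑ a ∈ blocks N, ((a.1.factorial : ℝ)⁻¹ * (a.2.factorial : ℝ)⁻¹) •
      nestedBracket (List.replicate a.1 X ++ List.replicate a.2 Y) = X + expAd N X Y := by
  have hz : ∀ r s : ℕ, 2 ≤ s →
      nestedBracket (List.replicate r X ++ List.replicate s Y) = 0 := by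
    intro r s hs
    rw [nestedBracket_replicate_append X r (by simp; omega), nestedBracket_replicate Y hs, map_zero]
  rw [blocks, Finset.sum_erase_eq_sub (by simp), Finset.sum_product_right]
  obtain ⟨n, rfl⟩ := Nat.exists_eq_add_of_le' hN
  rw [Finset.sum_range_succ', Finset.sum_range_succ']
  have h0 : ∑ k ∈ Finset.range n, ∑ x ∈ Finset.range (n + 1 + 1),
      ((x.factorial : ℝ)⁻¹ * ((k + 1 + 1).factorial : ℝ)⁻¹) •
      nestedBracket (List.replicate x X ++ List.replicate (k + 1 + 1) Y) = 0 :=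
    Finset.sum_eq_zero fun k _ => Finset.sum_eq_zero fun r _ => by rw [hz _ _ (by omega), smul_zero]
  have h1 : ∑ x ∈ Finset.range (n + 1 + 1),
      ((x.factorial : ℝ)⁻¹ * ((0 : ℕ).factorial : ℝ)⁻¹) •
      nestedBracket (List.replicate x X ++ List.replicate 0 Y) = X := by
    rw [Finset.sum_range_succ', Finset.sum_range_succ', Finset.sum_eq_zero]
    · simp [nestedBracket]
    · intro k _
      rw [List.replicate_zero, List.append_nil, nestedBracket_replicate X (by omega), smul_zero]
  have h2 : ∑ x ∈ Finset.range (n + 1 + 1),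
      ((x.factorial : ℝ)⁻¹ * ((0 + 1 : ℕ).factorial : ℝ)⁻¹) •
      nestedBracket (List.replicate x X ++ List.replicate (0 + 1) Y) = expAd (n + 1) X Y := by
    simp only [expAd, LinearMap.sum_apply, LinearMap.smul_apply]
    refine Finset.sum_congr rfl fun r _ => ?_
    rw [nestedBracket_replicate_append X r (by simp)]
    simp [nestedBracket]
  simp only at h0 h1 h2 ⊢
  rw [h0, h1, h2]
  simp [nestedBracket, add_comm]

theorem dynkin_sum_blocks {N : ℕ} (hN : 1 ≤ N) (X Y : L) (k : ℕ) :
    ∑ p ∈ Fintype.piFinset (fun _ : Fin (k + 1) => blocks N),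
      blockCoeff p • nestedBracket (dynkinWord X Y p) =
    ((expAd N X * expAd N Y - 1) ^ k) (X + expAd N X Y) := by
  induction k with
  | zero =>
    rw [sum_piFinset_succ, pow_zero, Module.End.one_apply, ← sum_blocks_last hN]
    refine Finset.sum_congr rfl fun a _ => ?_
    simp [dynkinWord_cons, dynkinWord_zero, blockCoeff, mul_comm]
  | succ k ih =>
    rw [sum_piFinset_succ, pow_succ', Module.End.mul_apply, ← ih, ← sum_blocks_ad]
    refine Finset.sum_congr rfl fun a _ => ?_
    rw [map_sum, map_sum, Finset.smul_sum]
    refine Finset.sum_congr rfl fun p hp => ?_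
    have hne : dynkinWord X Y p ≠ [] := by
      have := le_length_dynkinWord X Y hp
      rintro h
      rw [h] at this
      simp at this
    rw [blockCoeff_cons, dynkinWord_cons, nestedBracket_replicate_append X _ (by simp [hne]),
      nestedBracket_replicate_append Y _ hne, map_smul, map_smul, smul_smul]

/-- Euler's identity: a derivation fixing the letters multiplies a bracket by its length. -/
theorem derivation_nestedBracket (D : L →ₗ[ℝ] L) (hD : ∀ x y, D ⁅x, y⁆ = ⁅D x, y⁆ + ⁅x, D y⁆)
    (l : List L) (hl : ∀ x ∈ l, D x = x) :
    D (nestedBracket l) = (l.length : ℝ) • nestedBracket l := by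
  induction l with
  | nil => simp [nestedBracket]
  | cons x l ih =>
    by_cases h : l = []
    · simp [h, nestedBracket, hl x]
    · rw [nestedBracket_cons x h, hD, hl x (by simp), ih fun y hy => hl y (by simp [hy]), lie_smul,
        List.length_cons]
      push_cast
      rw [add_smul, one_smul, add_comm]

/-- The derivation cancels the factor `1 / length` in Dynkin's coefficients. What remains factors
over the blocks and becomes the series of `log (1 + z) / z` at `z = e^{ad X} e^{ad Y} - 1`. -/
theorem derivation_dynkinSum {N : ℕ} (hN : 1 ≤ N) (D : L →ₗ[ℝ] L)
    (hD : ∀ x y, D ⁅x, y⁆ = ⁅D x, y⁆ + ⁅x, D y⁆) {X Y : L} (hX : D X = X) (hY : D Y = Y) :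
    D (dynkinSum N X Y) = ∑ k ∈ Finset.range N, ((-1 : ℝ) ^ k / (k + 1)) •
      ((expAd N X * expAd N Y - 1) ^ k) (X + expAd N X Y) := by
  rw [dynkinSum, map_sum, ← Finset.Ico_add_one_right_eq_Icc, Finset.sum_Ico_eq_sum_range]
  refine Finset.sum_congr rfl fun k _ => ?_
  rw [add_comm 1 k, ← dynkin_sum_blocks hN, map_sum, Finset.smul_sum]
  refine Finset.sum_congr rfl fun p hp => ?_
  have hlen := le_length_dynkinWord X Y hp
  have hpos : ((dynkinWord X Y p).length : ℝ) ≠ 0 := by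
    rw [Nat.cast_ne_zero]; omega
  rw [map_smul, derivation_nestedBracket D hD _ fun x hx => ?_, smul_smul, smul_smul]
  · congr 1
    rw [dynkinCoeff, blockCoeff, ← length_dynkinWord X Y p]
    push_cast
    field_simp
  · simp only [dynkinWord, List.mem_flatMap, List.mem_append, List.mem_replicate] at hx
    obtain ⟨i, -, ⟨-, rfl⟩ | ⟨-, rfl⟩⟩ := hx <;> assumption

end Dynkin

/-! ### Truncated exponential and logarithm series -/

section TruncatedSeries

open Polynomial

/-- The exponential series truncated below degree `n`. -/
noncomputable def expPoly (n : ℕ) : ℝ[X] :=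
  ∑ i ∈ Finset.range n, C ((i.factorial : ℝ)⁻¹) * X ^ i

/-- The series of `(eˣ - 1) / x` truncated below degree `n`. -/
noncomputable def phiPoly (n : ℕ) : ℝ[X] :=
  ∑ i ∈ Finset.range n, C (((i + 1).factorial : ℝ)⁻¹) * X ^ i

/-- The series of `log (1 + x) / x` truncated below degree `n`. -/
noncomputable def logPoly (n : ℕ) : ℝ[X] :=
  ∑ i ∈ Finset.range n, C ((-1) ^ i / ((i : ℝ) + 1)) * X ^ i

theorem expPoly_succ (n : ℕ) : expPoly (n + 1) = 1 + X * phiPoly n := by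
  rw [expPoly, phiPoly, Finset.sum_range_succ', Finset.mul_sum, add_comm]
  simp only [Nat.factorial_zero, Nat.cast_one, inv_one, map_one, pow_zero, mul_one, add_right_inj]
  exact Finset.sum_congr rfl fun i _ => by ring

theorem derivative_expPoly (n : ℕ) : derivative (expPoly (n + 1)) = expPoly n := by
  rw [expPoly, expPoly, Finset.sum_range_succ', derivative_add, derivative_sum]
  simp only [derivative_C_mul, derivative_X_pow, Nat.factorial_zero, pow_zero, derivative_one,
    mul_zero, add_zero]
  refine Finset.sum_congr rfl fun i _ => ?_
  rw [Nat.factorial_succ, ← mul_assoc, ← C_mul, Nat.add_sub_cancel]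
  congr 2
  push_cast
  field_simp

theorem derivative_X_mul_logPoly (n : ℕ) :
    derivative (X * logPoly n) = ∑ i ∈ Finset.range n, (-X) ^ i := by
  rw [logPoly, Finset.mul_sum, derivative_sum]
  refine Finset.sum_congr rfl fun i _ => ?_
  have : X * (C ((-1) ^ i / ((i : ℝ) + 1)) * X ^ i) = C ((-1) ^ i / ((i : ℝ) + 1)) * X ^ (i + 1) := by
    ring
  rw [this, derivative_C_mul, derivative_X_pow, ← mul_assoc, ← C_mul, Nat.add_sub_cancel]
  push_cast
  rw [div_mul_cancel₀ _ (by positivity), neg_pow (X : ℝ[X]) i]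
  simp

theorem X_pow_dvd_of_derivative {n : ℕ} {p : ℝ[X]} (h0 : p.coeff 0 = 0)
    (h : X ^ n ∣ derivative p) : X ^ (n + 1) ∣ p := by
  rw [X_pow_dvd_iff] at h ⊢
  intro d hd
  cases d with
  | zero => exact h0
  | succ d =>
    have := h d (by omega)
    rw [coeff_derivative] at this
    exact (mul_eq_zero.1 this).resolve_right (by positivity)

/-- `log (eˣ) = x` for the truncated series. -/
theorem X_pow_dvd_logPoly_comp (n : ℕ) :
    X ^ n ∣ (logPoly n).comp (X * phiPoly n) * phiPoly n - 1 := by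
  -- Compare derivatives. That of the logarithm is a geometric sum; composed with `E - 1` and
  -- multiplied by `E` it gives `1 - (1 - E)^n`, and `X` divides `1 - E`.
  have key : X ^ (n + 1) ∣ (X * logPoly n).comp (X * phiPoly n) - X := by
    refine X_pow_dvd_of_derivative (by simp [coeff_zero_eq_eval_zero]) ?_
    have hE : (X : ℝ[X]) * phiPoly n = expPoly (n + 1) - 1 := by rw [expPoly_succ]; ring
    rw [derivative_sub, derivative_comp, derivative_X_mul_logPoly, hE, derivative_sub,
      derivative_expPoly, derivative_one, derivative_X, sub_zero]
    set E := expPoly (n + 1) with hEdef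
    have hEn : expPoly n = E - C ((n.factorial : ℝ)⁻¹) * X ^ n := by
      rw [hEdef, expPoly, expPoly, Finset.sum_range_succ]; ring
    have hg : (∑ i ∈ Finset.range n, (-X : ℝ[X]) ^ i).comp (E - 1) * E = 1 - (1 - E) ^ n := by
      have := mul_neg_geom_sum (1 - E) n
      rw [sub_sub_cancel] at this
      rw [← this, mul_comm]
      simp only [← coe_compRingHom_apply, map_sum, map_pow, map_neg]
      simp
    have hd : X ^ n ∣ (1 - E) ^ n := by
      refine pow_dvd_pow_of_dvd ⟨-phiPoly n, ?_⟩ n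
      rw [hEdef, expPoly_succ]; ring
    rw [hEn, sub_mul, mul_comm E, hg]
    obtain ⟨q, hq⟩ := hd
    rw [hq]
    refine ⟨-q - C ((n.factorial : ℝ)⁻¹) * (∑ i ∈ Finset.range n, (-X : ℝ[X]) ^ i).comp (E - 1), ?_⟩
    ring
  rw [pow_succ', mul_comp, X_comp] at key
  obtain ⟨q, hq⟩ := key
  refine ⟨q, mul_left_cancel₀ X_ne_zero ?_⟩
  rw [← mul_assoc X, ← hq]
  ring

/-- `exp (log (1 + x)) = 1 + x` for the truncated series. -/
theorem X_pow_dvd_expPoly_comp (n : ℕ) :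
    X ^ (n + 1) ∣ (expPoly (n + 1)).comp (X * logPoly n) - (1 + X) := by
  set ℓ := X * logPoly n with hℓ
  set Q := (expPoly (n + 1)).comp ℓ - (1 + X) with hQ
  have hℓ' : (1 + X) * derivative ℓ = 1 - (-X) ^ n := by
    rw [hℓ, derivative_X_mul_logPoly, ← mul_neg_geom_sum, sub_neg_eq_add]
  have hE : expPoly n = expPoly (n + 1) - C ((n.factorial : ℝ)⁻¹) * X ^ n := by
    rw [expPoly, expPoly, Finset.sum_range_succ]; ring
  -- Modulo `X^n` the error `Q` solves `(1 + X) Q' = Q`. Since `Q(0) = 0`, the resulting recursion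
  -- kills its coefficients up to degree `n`.
  have hdiff : X ^ n ∣ (1 + X) * derivative Q - Q := by
    have h1 : (1 + X) * derivative Q =
        ((expPoly (n + 1)).comp ℓ - C ((n.factorial : ℝ)⁻¹) * ℓ ^ n) * (1 - (-X) ^ n) - (1 + X) := by
      rw [hQ, derivative_sub, derivative_comp, derivative_expPoly, hE, ← hℓ']
      simp
      ring
    rw [h1]
    have h2 : ℓ ^ n = X ^ n * logPoly n ^ n := by rw [hℓ, mul_pow]
    rw [h2, hQ, neg_pow]
    refine ⟨-(C ((n.factorial : ℝ)⁻¹) * logPoly n ^ n) * (1 - (-1) ^ n * X ^ n)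
      - (expPoly (n + 1)).comp ℓ * (-1) ^ n, ?_⟩
    ring
  rw [X_pow_dvd_iff] at hdiff ⊢
  intro d
  induction d with
  | zero =>
    intro _
    simp [hQ, hℓ, coeff_zero_eq_eval_zero, expPoly, Finset.sum_range_succ', eval_finsetSum]
  | succ d ih =>
    intro hd
    have h0 := ih (by omega)
    have h1 := hdiff d (by omega)
    have h2 : (X * derivative Q).coeff d = 0 := by
      cases d with
      | zero => simp
      | succ d => rw [coeff_X_mul, coeff_derivative, h0, zero_mul]
    rw [add_mul, one_mul, coeff_sub, coeff_add, h2, h0, coeff_derivative, add_zero, sub_zero] at h1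
    exact (mul_eq_zero.1 h1).resolve_right (by positivity)

end TruncatedSeries

/-! ### Exponentials of nilpotent elements and the derivative of `exp` -/

section NilpotentExp

attribute [local instance] LieRing.ofAssociativeRing

variable {A : Type*} [Ring A] [Algebra ℝ A]

/-- The exponential of a nilpotent element of a real algebra. -/
noncomputable def nilExp (a : A) : A :=
  letI : Module ℚ A := Module.compHom A (algebraMap ℚ ℝ)
  IsNilpotent.exp a

theorem nilExp_eq_aeval {a : A} {n : ℕ} (h : a ^ n = 0) :
    nilExp a = Polynomial.aeval a (expPoly n) := by
  let _ : Module ℚ A := Module.compHom A (algebraMap ℚ ℝ)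
  have : nilExp a = ∑ i ∈ Finset.range n, ((i.factorial : ℚ)⁻¹) • a ^ i :=
    IsNilpotent.exp_eq_sum h
  rw [this, expPoly, map_sum]
  refine Finset.sum_congr rfl fun i _ => ?_
  rw [map_mul, Polynomial.aeval_C, map_pow, Polynomial.aeval_X, ← Algebra.smul_def]
  change (algebraMap ℚ ℝ ((i.factorial : ℚ)⁻¹)) • a ^ i = _
  simp

theorem nilExp_add_of_commute {a b : A} (h : Commute a b) (ha : IsNilpotent a)
    (hb : IsNilpotent b) : nilExp (a + b) = nilExp a * nilExp b :=
  let _ : Module ℚ A := Module.compHom A (algebraMap ℚ ℝ)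
  IsNilpotent.exp_add_of_commute h ha hb

theorem nilExp_mul_nilExp_neg {a : A} (h : IsNilpotent a) : nilExp a * nilExp (-a) = 1 :=
  let _ : Module ℚ A := Module.compHom A (algebraMap ℚ ℝ)
  IsNilpotent.exp_mul_exp_neg_self h

theorem nilExp_neg_mul_nilExp {a : A} (h : IsNilpotent a) : nilExp (-a) * nilExp a = 1 :=
  let _ : Module ℚ A := Module.compHom A (algebraMap ℚ ℝ)
  IsNilpotent.exp_neg_mul_exp_self h

theorem map_nilExp {B : Type*} [Ring B] [Algebra ℝ B] (f : A →ₐ[ℝ] B) {a : A}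
    (h : IsNilpotent a) : f (nilExp a) = nilExp (f a) := by
  let _ : Module ℚ A := Module.compHom A (algebraMap ℚ ℝ)
  let _ : Module ℚ B := Module.compHom B (algebraMap ℚ ℝ)
  exact IsNilpotent.map_exp h f

theorem nilExp_mulRight {a : A} (h : IsNilpotent a) :
    nilExp (LinearMap.mulRight ℝ a) = LinearMap.mulRight ℝ (nilExp a) := by
  obtain ⟨n, hn⟩ := h
  have hn' : (LinearMap.mulRight ℝ a) ^ n = 0 := by
    rw [LinearMap.pow_mulRight, hn, LinearMap.mulRight_zero_eq_zero]
  rw [nilExp_eq_aeval hn, nilExp_eq_aeval hn']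
  ext y
  simp [expPoly, Finset.mul_sum, LinearMap.pow_mulRight, ← Algebra.smul_def]

theorem nilExp_mulLeft {a : A} (h : IsNilpotent a) :
    nilExp (LinearMap.mulLeft ℝ a) = LinearMap.mulLeft ℝ (nilExp a) :=
  (map_nilExp (Algebra.lmul ℝ A) h).symm

theorem ad_eq_mulLeft_add (a : A) :
    LieAlgebra.ad ℝ A a = LinearMap.mulLeft ℝ a + LinearMap.mulRight ℝ (-a) := by
  ext y
  simp [Ring.lie_def, sub_eq_add_neg]

theorem commute_mulLeft_mulRight (a b : A) :
    Commute (LinearMap.mulLeft ℝ a) (LinearMap.mulRight ℝ b) := by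
  ext y
  simp [mul_assoc]

theorem ad_pow_eq_zero {a : A} {n : ℕ} (h : a ^ n = 0) : (LieAlgebra.ad ℝ A a) ^ (2 * n) = 0 := by
  rw [ad_eq_mulLeft_add]
  refine (commute_mulLeft_mulRight a (-a)).add_pow_eq_zero_of_add_le_succ_of_pow_eq_zero
    (m := n) (n := n) ?_ ?_ (by omega)
  · rw [LinearMap.pow_mulLeft, h, LinearMap.mulLeft_zero_eq_zero]
  · rw [LinearMap.pow_mulRight, neg_pow, h, mul_zero, LinearMap.mulRight_zero_eq_zero]

/-- `ad a` is the sum of the commuting operators of left multiplication by `a` and right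
multiplication by `-a`, so its exponential is the product of theirs. -/
theorem nilExp_ad {a : A} (h : IsNilpotent a) (y : A) :
    nilExp (LieAlgebra.ad ℝ A a) y = nilExp a * y * nilExp (-a) := by
  rw [ad_eq_mulLeft_add, nilExp_add_of_commute (commute_mulLeft_mulRight a (-a)),
    nilExp_mulLeft h, nilExp_mulRight h.neg]
  · simp [mul_assoc]
  · obtain ⟨n, hn⟩ := h
    exact ⟨n, by rw [LinearMap.pow_mulLeft, hn, LinearMap.mulLeft_zero_eq_zero]⟩
  · obtain ⟨n, hn⟩ := h.neg
    exact ⟨n, by rw [LinearMap.pow_mulRight, hn, LinearMap.mulRight_zero_eq_zero]⟩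

/-- Every `a` to the left of `d a` is moved to the right by `a y = (ad a) y + y a`; Pascal's rule
counts the terms. The factorials are distributed so that summation over `k` yields a Cauchy product.
-/
theorem derivation_pow (d : A →ₗ[ℝ] A) (hd : ∀ a b, d (a * b) = d a * b + a * d b) (a : A)
    (k : ℕ) : (((k + 1).factorial : ℝ)⁻¹) • d (a ^ (k + 1)) =
      ∑ p ∈ Finset.HasAntidiagonal.antidiagonal k,
        ((((p.1 + 1).factorial : ℝ)⁻¹) • ((LieAlgebra.ad ℝ A a) ^ p.1) (d a)) *
          (((p.2.factorial : ℝ)⁻¹) • a ^ p.2) := by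
  have key : ∀ k, d (a ^ (k + 1)) = ∑ p ∈ Finset.HasAntidiagonal.antidiagonal k,
      ((k + 1).choose (p.1 + 1) : ℝ) • (((LieAlgebra.ad ℝ A a) ^ p.1) (d a) * a ^ p.2) := by
    intro k
    induction k with
    | zero => simp
    | succ k ih =>
      have hc : ∀ y : A, a * y = LieAlgebra.ad ℝ A a y + y * a := by
        intro y; simp [Ring.lie_def]
      rw [pow_succ' a (k + 1), hd, ih, Finset.mul_sum, Finset.Nat.sum_antidiagonal_succ]
      have h1 : ∀ p ∈ Finset.HasAntidiagonal.antidiagonal k,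
          a * (((k + 1).choose (p.1 + 1) : ℝ) • (((LieAlgebra.ad ℝ A a) ^ p.1) (d a) * a ^ p.2)) =
          ((k + 1).choose (p.1 + 1) : ℝ) • (((LieAlgebra.ad ℝ A a) ^ (p.1 + 1)) (d a) * a ^ p.2)
          + ((k + 1).choose (p.1 + 1) : ℝ) •
            (((LieAlgebra.ad ℝ A a) ^ p.1) (d a) * a ^ (p.2 + 1)) := by
        intro p _
        rw [mul_smul_comm, ← mul_assoc, hc, add_mul, smul_add, pow_succ', pow_succ' a,
          Module.End.mul_apply, mul_assoc _ a]
      rw [Finset.sum_congr rfl h1, Finset.sum_add_distrib]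
      have h2 : ∑ p ∈ Finset.HasAntidiagonal.antidiagonal k, ((k + 1).choose (p.1 + 1) : ℝ) •
            (((LieAlgebra.ad ℝ A a) ^ p.1) (d a) * a ^ (p.2 + 1)) =
          ∑ p ∈ Finset.HasAntidiagonal.antidiagonal (k + 1), ((k + 1).choose (p.1 + 1) : ℝ) •
            (((LieAlgebra.ad ℝ A a) ^ p.1) (d a) * a ^ p.2) := by
        rw [Finset.Nat.sum_antidiagonal_succ']
        simp
      rw [h2, Finset.Nat.sum_antidiagonal_succ]
      have h3 : ∀ p ∈ Finset.HasAntidiagonal.antidiagonal k, ((k + 1 + 1).choose (p.1 + 1 + 1) : ℝ) •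
          (((LieAlgebra.ad ℝ A a) ^ (p.1 + 1)) (d a) * a ^ p.2) =
          ((k + 1).choose (p.1 + 1) : ℝ) • (((LieAlgebra.ad ℝ A a) ^ (p.1 + 1)) (d a) * a ^ p.2) +
          ((k + 1).choose (p.1 + 1 + 1) : ℝ) •
            (((LieAlgebra.ad ℝ A a) ^ (p.1 + 1)) (d a) * a ^ p.2) := by
        intro p _
        rw [Nat.choose_succ_succ, Nat.cast_add, add_smul]
      rw [Finset.sum_congr rfl h3, Finset.sum_add_distrib]
      simp only [zero_add, Nat.choose_one_right, pow_zero, Module.End.one_apply]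
      push_cast
      rw [add_smul ((k : ℝ) + 1) 1, one_smul]
      abel
  rw [key, Finset.smul_sum]
  refine Finset.sum_congr rfl fun p hp => ?_
  rw [Finset.HasAntidiagonal.mem_antidiagonal] at hp
  rw [smul_mul_smul_comm, smul_smul]
  congr 1
  have hle : p.1 + 1 ≤ k + 1 := by omega
  rw [Nat.cast_choose ℝ hle, show k + 1 - (p.1 + 1) = p.2 by omega]
  field_simp

/-- The formula `d(e^a) = ((e^{ad a} - 1) / ad a)(d a) e^a`, obtained by summing `derivation_pow`
over all powers and regrouping the double sum by total degree. -/
theorem derivation_nilExp (d : A →ₗ[ℝ] A) (hd : ∀ a b, d (a * b) = d a * b + a * d b) {a : A}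
    (ha : IsNilpotent a) {n : ℕ} (hn : (LieAlgebra.ad ℝ A a) ^ n = 0) :
    d (nilExp a) = Polynomial.aeval (LieAlgebra.ad ℝ A a) (phiPoly n) (d a) * nilExp a := by
  obtain ⟨m, hm⟩ := ha
  have h1 : d 1 = 0 := by simpa using hd 1 1
  -- This truncation is long enough to contain every pair of degrees below `n` and `m`.
  have hK : a ^ (n + m + 1) = 0 := pow_eq_zero_of_le (by omega) hm
  have hL : d (nilExp a) = ∑ k ∈ Finset.range (n + m),
      (((k + 1).factorial : ℝ)⁻¹) • d (a ^ (k + 1)) := by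
    rw [nilExp_eq_aeval hK, expPoly, map_sum, map_sum, Finset.sum_range_succ']
    simp [← Algebra.smul_def, h1]
  have hR : Polynomial.aeval (LieAlgebra.ad ℝ A a) (phiPoly n) (d a) * nilExp a =
      ∑ p ∈ Finset.range n ×ˢ Finset.range m,
        ((((p.1 + 1).factorial : ℝ)⁻¹) • ((LieAlgebra.ad ℝ A a) ^ p.1) (d a)) *
          (((p.2.factorial : ℝ)⁻¹) • a ^ p.2) := by
    rw [nilExp_eq_aeval hm, expPoly, phiPoly, Finset.sum_product, map_sum, map_sum,
      LinearMap.sum_apply, Finset.sum_mul_sum]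
    simp [← Algebra.smul_def]
  rw [hL, hR, ← Finset.sum_fiberwise_of_maps_to (t := Finset.range (n + m))
    (g := fun p : ℕ × ℕ => p.1 + p.2)]
  · refine Finset.sum_congr rfl fun k _ => ?_
    rw [derivation_pow d hd]
    symm
    refine Finset.sum_subset ?_ ?_
    · intro p hp
      simp only [Finset.mem_filter] at hp
      simpa using hp.2
    · intro p hp hp'
      rw [Finset.HasAntidiagonal.mem_antidiagonal] at hp
      simp only [Finset.mem_filter, Finset.mem_product, Finset.mem_range, hp, and_true,
        not_and_or, not_lt] at hp'
      rcases hp' with h | h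
      · rw [pow_eq_zero_of_le h hn]; simp
      · rw [pow_eq_zero_of_le h hm]; simp
  · intro p hp
    simp only [Finset.mem_product, Finset.mem_range] at hp ⊢
    omega

end NilpotentExp

/-! ### The Baker-Campbell-Hausdorff formula in associative algebras -/

section AssociativeBCH

attribute [local instance] LieRing.ofAssociativeRing

variable {A : Type*} [Ring A] [Algebra ℝ A]

theorem aeval_mem_of_X_dvd {S : Submodule ℝ A} (hS : S * S ≤ S) {a : A} (ha : a ∈ S)
    {p : Polynomial ℝ} (hp : Polynomial.X ∣ p) : Polynomial.aeval a p ∈ S := by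
  obtain ⟨q, rfl⟩ := hp
  have hpow : ∀ i, a * a ^ i ∈ S := by
    intro i
    induction i with
    | zero => simpa using ha
    | succ i ih =>
      rw [pow_succ']
      exact hS (Submodule.mul_mem_mul ha ih)
  rw [map_mul, Polynomial.aeval_X, Polynomial.aeval_eq_sum_range, Finset.mul_sum]
  refine Submodule.sum_mem _ fun i _ => ?_
  rw [mul_smul_comm]
  exact S.smul_mem _ (hpow i)

theorem nestedBracket_mem_pow {S : Submodule ℝ A} {l : List A} (hl : ∀ x ∈ l, x ∈ S)
    (hne : l ≠ []) : nestedBracket l ∈ S ^ l.length := by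
  induction l with
  | nil => exact absurd rfl hne
  | cons x l ih =>
    by_cases h : l = []
    · subst h
      simpa [nestedBracket] using hl x
    · have hm := ih (fun y hy => hl y (by simp [hy])) h
      have hx := hl x (by simp)
      rw [nestedBracket_cons x h, Ring.lie_def, List.length_cons]
      refine Submodule.sub_mem _ ?_ ?_
      · rw [pow_succ']; exact Submodule.mul_mem_mul hx hm
      · rw [pow_succ]; exact Submodule.mul_mem_mul hm hx

theorem pow_le_of_mul_le {S : Submodule ℝ A} (hS : S * S ≤ S) {k : ℕ} (hk : k ≠ 0) : S ^ k ≤ S := by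
  obtain ⟨k, rfl⟩ := Nat.exists_eq_succ_of_ne_zero hk
  induction k with
  | zero => simp
  | succ k ih =>
    rw [pow_succ]
    exact (mul_le_mul' (ih (by simp)) le_rfl).trans hS

theorem dynkinSum_mem {S : Submodule ℝ A} (hS : S * S ≤ S) {X Y : A} (hX : X ∈ S) (hY : Y ∈ S)
    (N : ℕ) : dynkinSum N X Y ∈ S := by
  refine Submodule.sum_mem _ fun k _ => Submodule.sum_mem _ fun p _ => S.smul_mem _ ?_
  by_cases h : dynkinWord X Y p = []
  · rw [h]; exact S.zero_mem
  · refine pow_le_of_mul_le hS (by simpa using h) (nestedBracket_mem_pow (fun x hx => ?_) h)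
    simp only [dynkinWord, List.mem_flatMap, List.mem_append, List.mem_replicate] at hx
    obtain ⟨i, -, ⟨-, rfl⟩ | ⟨-, rfl⟩⟩ := hx <;> assumption

theorem expAd_eq_aeval (N : ℕ) (a : A) :
    expAd N a = Polynomial.aeval (LieAlgebra.ad ℝ A a) (expPoly (N + 1)) := by
  simp [expAd, expPoly, ← Algebra.smul_def]

theorem aeval_eq_of_dvd_sub {a : A} {n : ℕ} (ha : a ^ n = 0) {p q : Polynomial ℝ}
    (h : Polynomial.X ^ n ∣ p - q) : Polynomial.aeval a p = Polynomial.aeval a q := by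
  obtain ⟨r, hr⟩ := h
  rw [← sub_eq_zero, ← map_sub, hr, map_mul, map_pow, Polynomial.aeval_X, ha, zero_mul]

/-- The Baker-Campbell-Hausdorff formula in a nilpotent subalgebra `S` of an associative algebra
with a derivation that is injective on `S` and fixes the two elements. -/
theorem nilExp_dynkinSum_of_derivation {S : Submodule ℝ A} (hS : S * S ≤ S) {N : ℕ}
    (hN : S ^ (N + 1) = ⊥) (d : A →ₗ[ℝ] A) (hd : ∀ a b, d (a * b) = d a * b + a * d b)
    (hinj : ∀ a ∈ S, d a = 0 → a = 0) {X Y : A} (hX : X ∈ S) (hY : Y ∈ S) (hdX : d X = X)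
    (hdY : d Y = Y) : nilExp (dynkinSum N X Y) = nilExp X * nilExp Y := by
  have hnil : ∀ a ∈ S, a ^ (N + 1) = 0 := fun a ha => by
    have := Submodule.pow_mem_pow S ha (N + 1)
    rwa [hN, Submodule.mem_bot] at this
  have hnil' : ∀ a ∈ S, IsNilpotent a := fun a ha => ⟨_, hnil a ha⟩
  -- If `a^(N+1) = 0`, then `ad a` is only known to vanish to the power `2(N + 1)`. Series in `ad`
  -- are therefore truncated at `M`, and the Dynkin sum is brought back to `N` at the end.
  set M := 2 * (N + 1) with hM
  have hM1 : 1 ≤ M := by omega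
  have had : ∀ a ∈ S, (LieAlgebra.ad ℝ A a) ^ M = 0 := fun a ha => ad_pow_eq_zero (hnil a ha)
  have hexp : ∀ a ∈ S, ∃ b ∈ S, nilExp a = 1 + b := fun a ha => by
    refine ⟨_, aeval_mem_of_X_dvd hS ha (Dvd.intro (phiPoly N) rfl), ?_⟩
    rw [nilExp_eq_aeval (hnil a ha), expPoly_succ, map_add, map_one]
  have hexpAd : ∀ a ∈ S, expAd M a = nilExp (LieAlgebra.ad ℝ A a) := fun a ha => by
    rw [expAd_eq_aeval, nilExp_eq_aeval (pow_eq_zero_of_le (Nat.le_succ M) (had a ha))]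
  obtain ⟨n₀, hn₀, hg⟩ : ∃ b ∈ S, nilExp X * nilExp Y = 1 + b := by
    obtain ⟨b, hb, hb'⟩ := hexp X hX
    obtain ⟨c, hc, hc'⟩ := hexp Y hY
    refine ⟨b + c + b * c, S.add_mem (S.add_mem hb hc) (hS (Submodule.mul_mem_mul hb hc)), ?_⟩
    rw [hb', hc']; noncomm_ring
  -- `W` is the logarithm of `exp X exp Y`; the aim is to show that it is the Dynkin sum.
  set W := Polynomial.aeval n₀ (Polynomial.X * logPoly N) with hWdef
  have hW : W ∈ S := aeval_mem_of_X_dvd hS hn₀ (Dvd.intro _ rfl)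
  have hWexp : nilExp W = nilExp X * nilExp Y := by
    rw [nilExp_eq_aeval (hnil W hW), hWdef, ← Polynomial.aeval_comp,
      aeval_eq_of_dvd_sub (hnil n₀ hn₀) (X_pow_dvd_expPoly_comp N), hg]
    simp
  have hself : ∀ a : A, Polynomial.aeval (LieAlgebra.ad ℝ A a) (phiPoly M) a = a := fun a => by
    obtain ⟨m, hm⟩ := Nat.exists_eq_add_of_le' hM1
    rw [hm, phiPoly, map_sum, LinearMap.sum_apply, Finset.sum_range_succ', Finset.sum_eq_zero]
    · simp
    · intro i _
      simp [pow_succ]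
  have hdexp : ∀ a ∈ S, d a = a → d (nilExp a) = a * nilExp a := fun a ha h => by
    rw [derivation_nilExp d hd (hnil' a ha) (had a ha), h, hself]
  -- Apply `d` to `e^W = e^X e^Y` and cancel `e^W` on the right.
  have hφ : Polynomial.aeval (LieAlgebra.ad ℝ A W) (phiPoly M) (d W) = X + expAd M X Y := by
    have h1 := derivation_nilExp d hd (hnil' W hW) (had W hW)
    rw [hWexp, hd, hdexp X hX hdX, hdexp Y hY hdY] at h1
    have h2 : X * nilExp X * nilExp Y + nilExp X * (Y * nilExp Y) =
        (X + expAd M X Y) * (nilExp X * nilExp Y) := by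
      rw [hexpAd X hX, nilExp_ad (hnil' X hX), add_mul, mul_assoc X, mul_assoc (nilExp X * Y),
        ← mul_assoc (nilExp (-X)), nilExp_neg_mul_nilExp (hnil' X hX), one_mul, mul_assoc]
    rw [h2, ← hWexp] at h1
    have h3 := congrArg (· * nilExp (-W)) h1
    simp only [mul_assoc, nilExp_mul_nilExp_neg (hnil' W hW), mul_one] at h3
    exact h3.symm
  -- Both sides are conjugation by `e^W = e^X e^Y`.
  have hw : expAd M X * expAd M Y = expAd M W := by
    have hinv : nilExp (-W) = nilExp (-Y) * nilExp (-X) := by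
      have h1 : nilExp W * (nilExp (-Y) * nilExp (-X)) = 1 := by
        rw [hWexp, mul_assoc, ← mul_assoc (nilExp Y), nilExp_mul_nilExp_neg (hnil' Y hY), one_mul,
          nilExp_mul_nilExp_neg (hnil' X hX)]
      rw [← one_mul (nilExp (-Y) * _), ← nilExp_neg_mul_nilExp (hnil' W hW), mul_assoc, h1, mul_one]
    ext y
    rw [Module.End.mul_apply, hexpAd X hX, hexpAd Y hY, hexpAd W hW, nilExp_ad (hnil' X hX),
      nilExp_ad (hnil' Y hY), nilExp_ad (hnil' W hW), hWexp, hinv]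
    simp only [mul_assoc]
  have hw1 : expAd M W - 1 = Polynomial.aeval (LieAlgebra.ad ℝ A W) (Polynomial.X * phiPoly M) := by
    rw [expAd_eq_aeval, expPoly_succ, map_add, map_one, add_sub_cancel_left]
  have hlie : ∀ x y, d ⁅x, y⁆ = ⁅d x, y⁆ + ⁅x, d y⁆ := fun x y => by
    simp only [Ring.lie_def, map_sub, hd]; abel
  -- With `z = e^{ad W} - 1`, the series of `log (1 + z) / z` inverts that of `(e^{ad W} - 1) / ad
  -- W`. So `d` takes the same value on the Dynkin sum and on `W`, and `hinj` applies.
  have hdZ : d (dynkinSum M X Y) = d W := by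
    rw [derivation_dynkinSum hM1 d hlie hdX hdY, hw, hw1, ← hφ]
    have h4 := aeval_eq_of_dvd_sub (had W hW) (X_pow_dvd_logPoly_comp M)
    rw [map_mul, map_one, Polynomial.aeval_comp] at h4
    have h5 := congrArg (fun T : Module.End ℝ A => T (d W)) h4
    simp only [Module.End.mul_apply, Module.End.one_apply] at h5
    refine Eq.trans ?_ h5
    simp [logPoly, ← Algebra.smul_def]
  have hwords : ∀ l : List A, (∀ x ∈ l, x = X ∨ x = Y) → N < l.length → nestedBracket l = 0 := by
    intro l hl hlen
    have hm : nestedBracket l ∈ S ^ l.length :=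
      nestedBracket_mem_pow (fun x hx => by rcases hl x hx with rfl | rfl <;> assumption)
        (by rintro rfl; simp at hlen)
    obtain ⟨k, hk⟩ := Nat.exists_eq_add_of_lt hlen
    rw [hk, show N + k + 1 = (N + 1) + k by ring, pow_add, hN, Submodule.bot_mul] at hm
    simpa using hm
  rw [dynkinSum_eq_of_le X Y hwords (by omega)] at hdZ
  have := hinj (dynkinSum N X Y - W) (S.sub_mem (dynkinSum_mem hS hX hY N) hW)
    (by rw [map_sub, hdZ, sub_self])
  rw [sub_eq_zero.1 this, hWexp]

end AssociativeBCH

section AssociativeBCH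

attribute [local instance] LieRing.ofAssociativeRing

variable {A : Type*} [Ring A] [Algebra ℝ A]

/-- The polynomials with coefficients in a subspace. -/
def coeffsIn (V : Submodule ℝ A) : Submodule ℝ (Polynomial A) where
  carrier := {p | ∀ n, p.coeff n ∈ V}
  add_mem' hp hq n := by rw [Polynomial.coeff_add]; exact V.add_mem (hp n) (hq n)
  zero_mem' n := by simp
  smul_mem' c p hp n := by rw [Polynomial.coeff_smul]; exact V.smul_mem c (hp n)

theorem coeffsIn_mul_le (V W : Submodule ℝ A) : coeffsIn V * coeffsIn W ≤ coeffsIn (V * W) := by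
  rw [Submodule.mul_le]
  intro p hp q hq n
  rw [Polynomial.coeff_mul]
  exact Submodule.sum_mem _ fun x _ => Submodule.mul_mem_mul (hp _) (hq _)

theorem coeffsIn_pow_le (V : Submodule ℝ A) (k : ℕ) : coeffsIn V ^ (k + 1) ≤ coeffsIn (V ^ (k + 1)) := by
  induction k with
  | zero => simp
  | succ k ih =>
    rw [pow_succ, pow_succ V]
    exact (mul_le_mul' ih le_rfl).trans (coeffsIn_mul_le _ _)

/-- The polynomials without constant term with coefficients in a subspace. -/
def positiveCoeffsIn (V : Submodule ℝ A) : Submodule ℝ (Polynomial A) where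
  carrier := {p | p ∈ coeffsIn V ∧ p.coeff 0 = 0}
  add_mem' hp hq := ⟨Submodule.add_mem _ hp.1 hq.1, by simp [hp.2, hq.2]⟩
  zero_mem' := ⟨Submodule.zero_mem _, by simp⟩
  smul_mem' c p hp := ⟨Submodule.smul_mem _ c hp.1, by simp [hp.2]⟩

/-- The Baker-Campbell-Hausdorff formula in a nilpotent subalgebra `S` of an associative algebra. -/
theorem nilExp_dynkinSum {S : Submodule ℝ A} (hS : S * S ≤ S) {N : ℕ}
    (hN : S ^ (N + 1) = ⊥) {x y : A} (hx : x ∈ S) (hy : y ∈ S) :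
    nilExp (dynkinSum N x y) = nilExp x * nilExp y := by
  -- A grading is created by replacing `x, y` with `x t, y t` in `A[t]`. The Euler derivation `t
  -- d/dt` fixes both and is injective on polynomials without constant term.
  set S' := positiveCoeffsIn S with hS'
  have hS'S' : S' * S' ≤ S' := by
    rw [Submodule.mul_le]
    intro p hp q hq
    refine ⟨fun n => hS (coeffsIn_mul_le S S (Submodule.mul_mem_mul hp.1 hq.1) n), ?_⟩
    rw [Polynomial.mul_coeff_zero, hp.2, zero_mul]
  have hS'N : S' ^ (N + 1) = ⊥ := by
    rw [eq_bot_iff]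
    have h1 : S' ≤ coeffsIn S := fun p hp => hp.1
    refine (pow_le_pow_left' h1 _).trans ((coeffsIn_pow_le S N).trans ?_)
    rw [hN]
    intro p hp
    rw [Submodule.mem_bot]
    ext n
    simpa using hp n
  set d : Polynomial A →ₗ[ℝ] Polynomial A := LinearMap.mulLeft ℝ (Polynomial.X : Polynomial A) ∘ₗ
    (Polynomial.derivative (R := A)).restrictScalars ℝ with hd
  have hdapp : ∀ p, d p = Polynomial.X * Polynomial.derivative p := fun p => rfl
  have hleib : ∀ p q, d (p * q) = d p * q + p * d q := fun p q => by
    rw [hdapp, hdapp, hdapp, Polynomial.derivative_mul, mul_add, mul_assoc, ← mul_assoc p,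
      ← Polynomial.X_mul (p := p), mul_assoc]
  have hmem : ∀ a ∈ S, Polynomial.C a * Polynomial.X ∈ S' := fun a ha =>
    ⟨fun n => by
      rw [Polynomial.coeff_C_mul_X]
      split_ifs
      · exact ha
      · exact S.zero_mem, by simp⟩
  have hfix : ∀ a : A, d (Polynomial.C a * Polynomial.X) = Polynomial.C a * Polynomial.X :=
    fun a => by simp [hdapp, Polynomial.X_mul]
  have hinj : ∀ p ∈ S', d p = 0 → p = 0 := by
    intro p hp h
    ext n
    cases n with
    | zero => simpa using hp.2
    | succ n =>
      have := congrArg (Polynomial.coeff · (n + 1)) h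
      simp only [hdapp, Polynomial.coeff_X_mul, Polynomial.coeff_derivative,
        Polynomial.coeff_zero] at this
      have h2 : ((n + 1 : ℕ) : ℝ) • p.coeff (n + 1) = 0 := by
        rw [Algebra.smul_def, map_natCast, (Nat.cast_commute _ _).eq]
        exact_mod_cast this
      rw [Polynomial.coeff_zero]
      exact (smul_eq_zero.1 h2).resolve_left (by positivity)
  have key := nilExp_dynkinSum_of_derivation hS'S' hS'N d hleib hinj (hmem x hx) (hmem y hy)
    (hfix x) (hfix y)
  have hnil : ∀ p ∈ S', IsNilpotent p := fun p hp => ⟨N + 1, by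
    have := Submodule.pow_mem_pow S' hp (N + 1)
    rwa [hS'N, Submodule.mem_bot] at this⟩
  -- Evaluation at `t = 1` is an algebra homomorphism because `1` is central; it returns to `A`.
  set ev : Polynomial A →ₐ[ℝ] A :=
    { Polynomial.eval₂RingHom' (RingHom.id A) 1 fun a => Commute.one_right _ with
      commutes' := fun r => by simp [Polynomial.algebraMap_apply] } with hev
  have hevX : ∀ a : A, ev (Polynomial.C a * Polynomial.X) = a := fun a => by
    simp [hev]
  have := congrArg ev key
  rwa [map_mul, map_nilExp ev (hnil _ (hmem x hx)), map_nilExp ev (hnil _ (hmem y hy)),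
    map_nilExp ev (hnil _ (dynkinSum_mem hS'S' (hmem x hx) (hmem y hy) N)),
    show ev (dynkinSum N (Polynomial.C x * Polynomial.X) (Polynomial.C y * Polynomial.X)) =
      dynkinSum N (ev (Polynomial.C x * Polynomial.X)) (ev (Polynomial.C y * Polynomial.X)) from
      map_dynkinSum N ev.toLinearMap (fun p q => by simp [Ring.lie_def]) _ _,
    hevX, hevX] at this

/-- The truncated logarithm recovers a nilpotent element from its exponential. -/
theorem nilExp_injOn {a b : A} (ha : IsNilpotent a) (hb : IsNilpotent b)
    (h : nilExp a = nilExp b) : a = b := by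
  obtain ⟨n, hn⟩ := ha
  obtain ⟨m, hm⟩ := hb
  have key : ∀ c : A, c ^ (n + m) = 0 →
      Polynomial.aeval (nilExp c - 1) (Polynomial.X * logPoly (n + m)) = c := by
    intro c hc
    have hc' : c ^ (n + m + 1) = 0 := pow_eq_zero_of_le (Nat.le_succ _) hc
    rw [nilExp_eq_aeval hc', expPoly_succ, map_add, map_one, add_sub_cancel_left,
      ← Polynomial.aeval_comp]
    obtain ⟨q, hq⟩ := X_pow_dvd_logPoly_comp (n + m)
    have : Polynomial.X ^ (n + m + 1) ∣ (Polynomial.X * logPoly (n + m)).comp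
        (Polynomial.X * phiPoly (n + m)) - Polynomial.X := by
      refine ⟨q, ?_⟩
      rw [pow_succ', mul_assoc, ← hq, Polynomial.mul_comp, Polynomial.X_comp]
      ring
    rw [aeval_eq_of_dvd_sub hc' this, Polynomial.aeval_X]
  rw [← key a (pow_eq_zero_of_le (by omega) hn), h, key b (pow_eq_zero_of_le (by omega) hm)]

end AssociativeBCH

/-! ### Associativity of Dynkin's product on a nilpotent Lie algebra -/

section Associativity

variable {L : Type*} [LieRing L] [LieAlgebra ℝ L]

attribute [local instance] LieRing.ofAssociativeRing

/-- The representation of a Lie algebra with a derivation `δ` on `L × ℝ` that is the adjoint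
representation of the semidirect product of `L` with `ℝ δ`. -/
noncomputable def derivRep (δ : L →ₗ[ℝ] L) : L →ₗ[ℝ] Module.End ℝ (L × ℝ) :=
  LinearMap.mk₂ ℝ (fun a (m : L × ℝ) => ((⁅a, m.1⁆ - m.2 • δ a, 0) : L × ℝ))
    (fun a b m => by ext <;> simp [add_sub_add_comm])
    (fun c a m => by ext <;> simp [smul_sub, smul_comm c])
    (fun a m m' => by ext <;> simp [add_smul, add_sub_add_comm])
    (fun c a m => by ext <;> simp [smul_sub, mul_smul])

theorem derivRep_apply (δ : L →ₗ[ℝ] L) (a : L) (m : L × ℝ) :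
    derivRep δ a m = (⁅a, m.1⁆ - m.2 • δ a, 0) := rfl

theorem derivRep_lie {δ : L →ₗ[ℝ] L} (hδ : ∀ x y, δ ⁅x, y⁆ = ⁅δ x, y⁆ + ⁅x, δ y⁆) (a b : L) :
    derivRep δ ⁅a, b⁆ = ⁅derivRep δ a, derivRep δ b⁆ := by
  refine LinearMap.ext fun m => ?_
  rw [Ring.lie_def, LinearMap.sub_apply, Module.End.mul_apply, Module.End.mul_apply]
  simp only [derivRep_apply, hδ, lie_lie, lie_sub, lie_smul, zero_smul, sub_zero, Prod.mk_sub_mk,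
    sub_self, smul_add, Prod.mk.injEq, and_true]
  rw [← lie_skew b (δ a), smul_neg]
  abel

variable (L) in
/-- The filtration of `L × ℝ` induced by the lower central series of `L`. -/
def repFiltration : ℕ → Submodule ℝ (L × ℝ)
  | 0 => ⊤
  | i + 1 => (LieModule.lowerCentralSeries ℝ L L i).toSubmodule.prod ⊥

variable (L) in
/-- The endomorphisms of `L × ℝ` that raise the filtration degree. -/
def raisingEnd : Submodule ℝ (Module.End ℝ (L × ℝ)) where
  carrier := {T | ∀ i, ∀ m ∈ repFiltration L i, T m ∈ repFiltration L (i + 1)}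
  add_mem' hT hT' i m hm := Submodule.add_mem _ (hT i m hm) (hT' i m hm)
  zero_mem' _ _ _ := Submodule.zero_mem _
  smul_mem' c _ hT i m hm := Submodule.smul_mem _ c (hT i m hm)

theorem repFiltration_succ_le (i : ℕ) : repFiltration L (i + 1) ≤ repFiltration L i := by
  cases i with
  | zero => exact le_top
  | succ i =>
    exact Submodule.prod_mono (LieModule.antitone_lowerCentralSeries ℝ L L (Nat.le_succ i)) le_rfl

theorem raisingEnd_mul_le : raisingEnd L * raisingEnd L ≤ raisingEnd L := by
  rw [Submodule.mul_le]
  intro T hT T' hT' i m hm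
  exact repFiltration_succ_le _ (hT _ _ (hT' i m hm))

theorem raisingEnd_pow_apply {k : ℕ} {T : Module.End ℝ (L × ℝ)} (hT : T ∈ raisingEnd L ^ (k + 1))
    {i : ℕ} {m : L × ℝ} (hm : m ∈ repFiltration L i) : T m ∈ repFiltration L (i + k + 1) := by
  induction k generalizing T i m with
  | zero => exact (pow_one (raisingEnd L)).le hT i m hm
  | succ k ih =>
    replace hT : T ∈ raisingEnd L ^ (k + 1) * raisingEnd L :=
      (pow_succ (raisingEnd L) (k + 1)).le hT
    induction hT using Submodule.mul_induction_on' with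
    | mem_mul_mem T hT T' hT' =>
      have := ih hT (hT' i m hm)
      rwa [show i + (k + 1) + 1 = i + 1 + k + 1 by ring]
    | add T _ T' _ h h' => exact Submodule.add_mem _ h h'

/-- The filtration has one step more than the lower central series, namely from `L × ℝ` to `L × 0`;
hence the exponent `N + 1`. -/
theorem raisingEnd_pow_eq_bot {N : ℕ} (hN : LieModule.lowerCentralSeries ℝ L L N = ⊥) :
    raisingEnd L ^ (N + 1) = ⊥ := by
  rw [eq_bot_iff]
  intro T hT
  rw [Submodule.mem_bot]
  refine LinearMap.ext fun m => ?_
  have := raisingEnd_pow_apply hT (i := 0) (m := m) Submodule.mem_top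
  rw [zero_add] at this
  simpa [repFiltration, hN, Prod.ext_iff] using this

theorem derivRep_mem (δ : L →ₗ[ℝ] L) (a : L) : derivRep δ a ∈ raisingEnd L := by
  intro i m hm
  rw [derivRep_apply]
  cases i with
  | zero => simp [repFiltration]
  | succ i =>
    have h2 : m.2 = 0 := by simpa using (Submodule.mem_prod.1 hm).2
    refine Submodule.mem_prod.2 ⟨?_, by simp⟩
    rw [h2, zero_smul, sub_zero]
    have h1 : m.1 ∈ LieModule.lowerCentralSeries ℝ L L i := (Submodule.mem_prod.1 hm).1
    rw [LieModule.lowerCentralSeries_succ]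
    exact LieSubmodule.lie_mem_lie (LieSubmodule.mem_top a) h1

/-- Both products have the same image under `derivRep δ`, since exponentiation turns them into the
same associative product of endomorphisms. The representation need not be faithful, but it sends
`(0, 1)` to `(-δ a, 0)` and so determines `δ a`. -/
theorem derivation_dynkinSum_assoc {N : ℕ} (hN : LieModule.lowerCentralSeries ℝ L L N = ⊥)
    {δ : L →ₗ[ℝ] L} (hδ : ∀ x y, δ ⁅x, y⁆ = ⁅δ x, y⁆ + ⁅x, δ y⁆) (x y z : L) :
    δ (dynkinSum N (dynkinSum N x y) z) = δ (dynkinSum N x (dynkinSum N y z)) := by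
  have hS := raisingEnd_mul_le (L := L)
  have hSN := raisingEnd_pow_eq_bot hN
  have hnil : ∀ a, IsNilpotent (derivRep δ a) := fun a => ⟨N + 1, by
    have := Submodule.pow_mem_pow _ (derivRep_mem δ a) (N + 1)
    rwa [hSN, Submodule.mem_bot] at this⟩
  have hexp : ∀ a b, nilExp (derivRep δ (dynkinSum N a b)) =
      nilExp (derivRep δ a) * nilExp (derivRep δ b) := fun a b => by
    rw [map_dynkinSum N (derivRep δ) (derivRep_lie hδ),
      nilExp_dynkinSum hS hSN (derivRep_mem δ a) (derivRep_mem δ b)]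
  have := nilExp_injOn (hnil (dynkinSum N (dynkinSum N x y) z))
    (hnil (dynkinSum N x (dynkinSum N y z))) (by simp only [hexp, mul_assoc])
  have := congrArg (fun T : Module.End ℝ (L × ℝ) => (T (0, 1)).1) this
  simpa [derivRep_apply] using this

open TensorProduct

variable (L) in
/-- The Lie algebra of polynomial curves in a Lie algebra. -/
def Curve : Type _ := Polynomial ℝ ⊗[ℝ] L

noncomputable instance : LieRing (Curve L) :=
  LieAlgebra.ExtendScalars.instLieRing ℝ (Polynomial ℝ) L

noncomputable instance : LieAlgebra ℝ (Curve L) :=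
  LieAlgebra.ExtendScalars.instBaseLieAlgebra ℝ (Polynomial ℝ) L

/-- The curve `t ↦ p(t) x`. -/
noncomputable def Curve.mk (p : Polynomial ℝ) (x : L) : Curve L := p ⊗ₜ[ℝ] x

theorem Curve.lie_mk (p q : Polynomial ℝ) (x y : L) :
    ⁅Curve.mk p x, Curve.mk q y⁆ = Curve.mk (p * q) ⁅x, y⁆ := rfl

theorem Curve.induction {P : Curve L → Prop} (u : Curve L) (zero : P 0)
    (add : ∀ u v, P u → P v → P (u + v)) (mk : ∀ p x, P (Curve.mk p x)) : P u :=
  TensorProduct.induction_on (motive := P) u zero mk add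

/-- Evaluation of a polynomial curve in a Lie algebra. -/
noncomputable def evalCurve (c : ℝ) : Curve L →ₗ[ℝ] L :=
  ((TensorProduct.lid ℝ L).toLinearMap ∘ₗ (Polynomial.aeval c).toLinearMap.rTensor L :
    (Polynomial ℝ ⊗[ℝ] L) →ₗ[ℝ] L)

theorem evalCurve_mk (c : ℝ) (p : Polynomial ℝ) (x : L) :
    evalCurve c (Curve.mk p x) = p.eval c • x := by
  have : evalCurve c (Curve.mk p x) = (Polynomial.aeval c p) • x := rfl
  rw [this, Polynomial.aeval_def, Algebra.algebraMap_self, Polynomial.eval₂_id]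

theorem evalCurve_lie (c : ℝ) (u v : Curve L) :
    evalCurve c ⁅u, v⁆ = ⁅evalCurve c u, evalCurve c v⁆ := by
  induction u using Curve.induction with
  | zero => simp
  | add u u' h h' => rw [add_lie, map_add, map_add, add_lie, h, h']
  | mk p x =>
    induction v using Curve.induction with
    | zero => simp
    | add v v' h h' => rw [lie_add, map_add, map_add, lie_add, h, h']
    | mk q y =>
      rw [Curve.lie_mk, evalCurve_mk, evalCurve_mk, evalCurve_mk, smul_lie, lie_smul, smul_smul,
        Polynomial.eval_mul]

/-- The derivative of a polynomial curve in a Lie algebra. -/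
noncomputable def derivCurve : Curve L →ₗ[ℝ] Curve L :=
  ((Polynomial.derivative (R := ℝ)).rTensor L :
    (Polynomial ℝ ⊗[ℝ] L) →ₗ[ℝ] (Polynomial ℝ ⊗[ℝ] L))

theorem derivCurve_mk (p : Polynomial ℝ) (x : L) :
    derivCurve (Curve.mk p x) = Curve.mk (Polynomial.derivative p) x := rfl

theorem Curve.mk_add (p q : Polynomial ℝ) (x : L) :
    Curve.mk (p + q) x = Curve.mk p x + Curve.mk q x := TensorProduct.add_tmul p q x

theorem derivCurve_lie (u v : Curve L) :
    derivCurve ⁅u, v⁆ = ⁅derivCurve u, v⁆ + ⁅u, derivCurve v⁆ := by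
  induction u using Curve.induction with
  | zero => simp
  | add u u' h h' =>
    rw [add_lie, map_add, map_add, add_lie, h, h', add_lie]
    abel
  | mk p x =>
    induction v using Curve.induction with
    | zero => simp
    | add v v' h h' =>
      rw [lie_add, map_add, map_add, lie_add, h, h', lie_add]
      abel
    | mk q y =>
      simp only [Curve.lie_mk, derivCurve_mk, Polynomial.derivative_mul, Curve.mk_add]

/-- Base change to `ℝ[t]` carries the lower central series along, and as a set this series does not
depend on the ring of scalars. -/
theorem lowerCentralSeries_curve {N : ℕ} (hN : LieModule.lowerCentralSeries ℝ L L N = ⊥) :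
    LieModule.lowerCentralSeries ℝ (Curve L) (Curve L) N = ⊥ := by
  let _ : LieAlgebra (Polynomial ℝ) (Curve L) :=
    LieAlgebra.ExtendScalars.instLieAlgebra ℝ (Polynomial ℝ) L
  have h : LieModule.lowerCentralSeries (Polynomial ℝ) (Curve L) (Curve L) N = ⊥ :=
    (LieSubmodule.lowerCentralSeries_tensor_eq_baseChange ℝ (Polynomial ℝ) L L N).trans
      ((congrArg (LieSubmodule.baseChange (Polynomial ℝ)) hN).trans
        (LieSubmodule.baseChange_bot ℝ (Polynomial ℝ) L L))
  have h1 := LieModule.coe_lowerCentralSeries_eq_int ℝ (Curve L) (Curve L) N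
  have h2 := LieModule.coe_lowerCentralSeries_eq_int (Polynomial ℝ) (Curve L) (Curve L) N
  rw [h] at h2
  rw [← h2] at h1
  exact SetLike.coe_injective h1

/-- The map `p ↦ X p' + p(0)` on real polynomials is injective, and stays so after tensoring with
the flat module `L`. -/
theorem eq_zero_of_rTensor_derivative {u : Polynomial ℝ ⊗[ℝ] L}
    (h : (Polynomial.derivative (R := ℝ)).rTensor L u = 0)
    (h0 : (Polynomial.aeval (0 : ℝ)).toLinearMap.rTensor L u = 0) : u = 0 := by
  let f : Polynomial ℝ →ₗ[ℝ] Polynomial ℝ :=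
    LinearMap.mulLeft ℝ Polynomial.X ∘ₗ Polynomial.derivative +
      Algebra.linearMap ℝ (Polynomial ℝ) ∘ₗ (Polynomial.aeval (0 : ℝ)).toLinearMap
  have hf : Function.Injective f := by
    rw [injective_iff_map_eq_zero]
    intro p hp
    ext n
    have hn := congrArg (Polynomial.coeff · n) hp
    cases n with
    | zero =>
      simpa [f, Polynomial.aeval_def, Polynomial.eval₂_id, ← Polynomial.coeff_zero_eq_eval_zero]
        using hn
    | succ n =>
      have : p.coeff (n + 1) * ((n : ℝ) + 1) = 0 := by
        simpa [f, Polynomial.coeff_X_mul, Polynomial.coeff_derivative,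
          Polynomial.coeff_C] using hn
      simpa using (mul_eq_zero.1 this).resolve_right (by positivity)
  have hfL := Module.Flat.rTensor_preserves_injective_linearMap (M := L) f hf
  refine hfL ?_
  rw [map_zero]
  simp only [f, LinearMap.rTensor_add, LinearMap.rTensor_comp]
  rw [LinearMap.add_apply, LinearMap.comp_apply, LinearMap.comp_apply, h, h0, map_zero, map_zero,
    add_zero]

theorem eq_zero_of_derivCurve {u : Curve L} (h : derivCurve u = 0)
    (h0 : evalCurve 0 u = 0) : u = 0 :=
  eq_zero_of_rTensor_derivative h
    ((TensorProduct.lid ℝ L).injective (h0.trans (map_zero (TensorProduct.lid ℝ L)).symm))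

/-- Dynkin's series defines an associative product on a nilpotent Lie algebra. -/
theorem dynkinSum_assoc {N : ℕ} (hN : LieModule.lowerCentralSeries ℝ L L N = ⊥) (x y z : L) :
    dynkinSum N (dynkinSum N x y) z = dynkinSum N x (dynkinSum N y z) := by
  have hN' := lowerCentralSeries_curve hN
  set c : L → Curve L := Curve.mk Polynomial.X
  have hev : ∀ t : ℝ, ∀ u v : Curve L,
      evalCurve t (dynkinSum N u v) = dynkinSum N (evalCurve t u) (evalCurve t v) := fun t u v =>
    map_dynkinSum N (evalCurve t) (evalCurve_lie t) u v
  have h0 : dynkinSum N (0 : L) 0 = 0 := by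
    have := map_dynkinSum N (0 : L →ₗ[ℝ] L) (by simp) 0 0
    simpa using this.symm
  have hc0 : ∀ x : L, evalCurve 0 (c x) = 0 := fun x => by simp [c, evalCurve_mk]
  have hc1 : ∀ x : L, evalCurve 1 (c x) = x := fun x => by simp [c, evalCurve_mk]
  -- For the curves `t x, t y, t z` the associator has zero derivative and vanishes at `t = 0`.
  -- Hence it is zero, and `t = 1` gives the claim.
  have key : dynkinSum N (dynkinSum N (c x) (c y)) (c z) -
      dynkinSum N (c x) (dynkinSum N (c y) (c z)) = 0 := by
    refine eq_zero_of_derivCurve ?_ ?_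
    · rw [map_sub, derivation_dynkinSum_assoc hN' derivCurve_lie, sub_self]
    · simp only [map_sub, hev, hc0, h0, sub_self]
  have := congrArg (evalCurve 1) (sub_eq_zero.1 key)
  simpa only [hev, hc1] using this

end Associativity

/-! ### The group law -/

section GroupLaw

variable {L : Type*} [LieRing L] [LieAlgebra ℝ L]

theorem sum_blocks_length_one {V : Type*} [AddCommMonoid V] {N : ℕ} (hN : 1 ≤ N)
    (f : ∀ k : ℕ, (Fin k → ℕ × ℕ) → V)
    (hf : ∀ k, ∀ p : Fin k → ℕ × ℕ, ∑ i, ((p i).1 + (p i).2) ≠ 1 → f k p = 0) :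
    ∑ k ∈ Finset.Icc 1 N, ∑ p ∈ Fintype.piFinset fun _ : Fin k => blocks N, f k p =
      f 1 (fun _ => (1, 0)) + f 1 (fun _ => (0, 1)) := by
  rw [Finset.sum_eq_single_of_mem 1 (Finset.mem_Icc.2 ⟨le_rfl, hN⟩)]
  · have hc : ∀ a : ℕ × ℕ, (Fin.cons a (fun i => i.elim0) : Fin 1 → ℕ × ℕ) = fun _ => a := by
      intro a; ext i : 1; obtain rfl : i = 0 := Subsingleton.elim (α := Fin 1) i 0; rfl
    have h2 : ∑ p ∈ Fintype.piFinset (fun _ : Fin 1 => blocks N), f 1 p =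
        ∑ a ∈ blocks N, f 1 (fun _ => a) := by
      rw [sum_piFinset_succ]
      refine Finset.sum_congr rfl fun a _ => ?_
      rw [Fintype.piFinset_of_isEmpty, ← hc]
      simp
      exact congrArg (fun q => f 1 (Fin.cons a q)) (Subsingleton.elim _ _)
    rw [h2, ← Finset.sum_pair (f := fun a => f 1 (fun _ => a)) (by simp : ((1, 0) : ℕ × ℕ) ≠ (0, 1))]
    symm
    refine Finset.sum_subset ?_ ?_
    · intro a ha
      simp only [Finset.mem_insert, Finset.mem_singleton] at ha
      rw [mem_blocks]
      rcases ha with rfl | rfl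
      · exact ⟨by simp, hN, by simp⟩
      · exact ⟨by simp, by simp, hN⟩
    · intro a _ ha
      refine hf _ _ ?_
      intro h
      apply ha
      simp only [Finset.univ_unique, Finset.sum_singleton] at h
      simp only [Finset.mem_insert, Finset.mem_singleton, Prod.ext_iff]
      omega
  · intro k hk hk1
    refine Finset.sum_eq_zero fun p hp => hf _ _ ?_
    have := le_sum_of_mem_blocks hp
    rw [Finset.mem_Icc] at hk
    omega

/-- Splits off the linear part. The remaining brackets have length at least two, so they vanish for
commuting arguments and descend in the lower central series. -/
theorem dynkinSum_eq_add {N : ℕ} (hN : 1 ≤ N) (X Y : L) :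
    dynkinSum N X Y = X + Y + ∑ k ∈ Finset.Icc 1 N,
      ∑ p ∈ Fintype.piFinset fun _ : Fin k => blocks N,
        if 2 ≤ (dynkinWord X Y p).length then
          dynkinCoeff p • nestedBracket (dynkinWord X Y p) else 0 := by
  have h := sum_blocks_length_one hN (fun k p => if (dynkinWord X Y p).length = 1 then
    dynkinCoeff p • nestedBracket (dynkinWord X Y p) else 0)
    (fun k p hp => if_neg (by rwa [length_dynkinWord]))
  have h1 : X + Y = ∑ k ∈ Finset.Icc 1 N,
      ∑ p ∈ Fintype.piFinset fun _ : Fin k => blocks N,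
        if (dynkinWord X Y p).length = 1 then
          dynkinCoeff p • nestedBracket (dynkinWord X Y p) else 0 := by
    rw [h]
    simp [dynkinWord, nestedBracket, dynkinCoeff, List.finRange_succ]
  rw [h1, ← Finset.sum_add_distrib, dynkinSum]
  refine Finset.sum_congr rfl fun k hk => ?_
  rw [← Finset.sum_add_distrib]
  refine Finset.sum_congr rfl fun p hp => ?_
  have := le_length_dynkinWord X Y hp
  rw [Finset.mem_Icc] at hk
  split_ifs
  · omega
  · simp
  · simp
  · omega

theorem nestedBracket_eq_zero_of_commute {X Y : L} (h : ⁅X, Y⁆ = 0) {l : List L}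
    (hl : ∀ x ∈ l, x = X ∨ x = Y) (hlen : 2 ≤ l.length) : nestedBracket l = 0 := by
  induction l with
  | nil => rfl
  | cons x l ih =>
    have hne : l ≠ [] := by rintro rfl; simp at hlen
    rw [nestedBracket_cons x hne]
    by_cases h2 : 2 ≤ l.length
    · rw [ih (fun y hy => hl y (by simp [hy])) h2, lie_zero]
    · obtain ⟨y, rfl⟩ := List.length_eq_one_iff.1
        (show l.length = 1 by have := List.length_pos_iff.2 hne; omega)
      have h' : ⁅Y, X⁆ = 0 := by rw [← lie_skew, h, neg_zero]
      rcases hl x (by simp) with rfl | rfl <;> rcases hl y (by simp) with rfl | rfl <;>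
        simp [nestedBracket, h, h']

theorem mem_dynkinWord {X Y : L} {k : ℕ} {p : Fin k → ℕ × ℕ} {x : L}
    (hx : x ∈ dynkinWord X Y p) : x = X ∨ x = Y := by
  simp only [dynkinWord, List.mem_flatMap, List.mem_append, List.mem_replicate] at hx
  tauto

/-- The nilpotency length is defined through the series over `ℤ`, which has the same underlying sets
as the series over `ℝ`. -/
theorem lcs_nilpotencyLength [LieRing.IsNilpotent L] :
    LieModule.lowerCentralSeries ℝ L L (LieModule.nilpotencyLength L L) = ⊥ := by
  have h : LieModule.lowerCentralSeries ℤ L L (LieModule.nilpotencyLength L L) = ⊥ :=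
    Nat.sInf_mem (LieModule.IsNilpotent.nilpotent ℤ L L)
  have h1 := LieModule.coe_lowerCentralSeries_eq_int ℝ L L (LieModule.nilpotencyLength L L)
  rw [h] at h1
  exact SetLike.coe_injective h1

variable [LieRing.IsNilpotent L]

theorem bch_eq_dynkinSum_of_le {N : ℕ} (hN : LieModule.nilpotencyLength L L ≤ N) (X Y : L) :
    bch X Y = dynkinSum N X Y :=
  (dynkinSum_eq_of_le X Y (fun _ _ hl => nestedBracket_eq_zero lcs_nilpotencyLength hl) hN).symm

theorem bch_of_lie_eq_zero {X Y : L} (h : ⁅X, Y⁆ = 0) : X ● Y = X + Y := by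
  -- Truncating one step later makes the level at least `1`, even when `L` is trivial and its
  -- nilpotency length is `0`.
  rw [bch_eq_dynkinSum_of_le (Nat.le_succ _), dynkinSum_eq_add (by omega), add_eq_left]
  refine Finset.sum_eq_zero fun k _ => Finset.sum_eq_zero fun p _ => ?_
  split_ifs with h2
  · rw [nestedBracket_eq_zero_of_commute h (fun x hx => mem_dynkinWord hx) h2, smul_zero]
  · rfl

theorem bch_assoc (X Y Z : L) : X ● Y ● Z = X ● (Y ● Z) := by
  simp only [bch_eq_dynkinSum]
  exact dynkinSum_assoc lcs_nilpotencyLength X Y Z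

theorem bch_zero (X : L) : X ● 0 = X := by rw [bch_of_lie_eq_zero (by simp), add_zero]

theorem zero_bch (X : L) : 0 ● X = X := by rw [bch_of_lie_eq_zero (by simp), zero_add]

theorem bch_neg_self (X : L) : X ● (-X) = 0 := by rw [bch_of_lie_eq_zero (by simp), add_neg_cancel]

theorem neg_bch_self (X : L) : (-X) ● X = 0 := by rw [bch_of_lie_eq_zero (by simp), neg_add_cancel]

theorem bch_neg_cancel_left (X Y : L) : X ● ((-X) ● Y) = Y := by
  rw [← bch_assoc, bch_neg_self, zero_bch]

theorem neg_bch_cancel_left (X Y : L) : (-X) ● (X ● Y) = Y := by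
  rw [← bch_assoc, neg_bch_self, zero_bch]

theorem bch_neg_cancel_right (X Y : L) : X ● Y ● (-Y) = X := by
  rw [bch_assoc, bch_neg_self, bch_zero]

theorem neg_bch_cancel_right (X Y : L) : X ● (-Y) ● Y = X := by
  rw [bch_assoc, neg_bch_self, bch_zero]

theorem neg_bch (X Y : L) : -(X ● Y) = (-Y) ● (-X) := by
  have h : X ● Y ● ((-Y) ● (-X)) = 0 := by
    rw [← bch_assoc, bch_neg_cancel_right, bch_neg_self]
  have := neg_bch_cancel_left (X ● Y) ((-Y) ● (-X))
  rw [h, bch_zero] at this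
  exact this

end GroupLaw

/-! ### Polynomial growth of the product and invariance of Haar measure -/

section Analysis

variable {𝔤 : Type*} [NormedLieRing 𝔤] [NormedLieAlgebra 𝔤] [FiniteDimensional ℝ 𝔤]

/-- The Lie bracket as a continuous bilinear map. -/
noncomputable def lieCLM : 𝔤 →L[ℝ] 𝔤 →L[ℝ] 𝔤 :=
  (LieModule.toEnd ℝ 𝔤 𝔤 : 𝔤 →ₗ[ℝ] Module.End ℝ 𝔤).toContinuousBilinearMap

theorem lieCLM_apply (X Y : 𝔤) : lieCLM X Y = ⁅X, Y⁆ := rfl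

variable {E : Type*} [NormedAddCommGroup E] [NormedSpace ℝ E]

theorem hasTemperateGrowth_nestedBracket (l : List (E → 𝔤)) (hl : ∀ f ∈ l, f.HasTemperateGrowth) :
    (fun x => nestedBracket (l.map fun f => f x)).HasTemperateGrowth := by
  induction l with
  | nil => exact Function.HasTemperateGrowth.const 0
  | cons f l ih =>
    by_cases h : l = []
    · subst h; exact hl f (by simp)
    · have h1 := lieCLM.bilinear_hasTemperateGrowth (hl f (by simp)) (ih fun g hg => hl g (by simp [hg]))
      refine (congrArg Function.HasTemperateGrowth (funext fun x => ?_)).mp h1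
      rw [lieCLM_apply, List.map_cons, nestedBracket_cons _ (by simpa using h)]

theorem dynkinWord_apply {X Y : E → 𝔤} (x : E) {k : ℕ} (p : Fin k → ℕ × ℕ) :
    dynkinWord (X x) (Y x) p = (dynkinWord X Y p).map fun f => f x := by
  simp [dynkinWord, List.map_flatMap]

/-- The product is a finite sum of iterated bilinear brackets. This is what makes group translations
admissible substitutions in Schwartz functions. -/
theorem hasTemperateGrowth_bch {X Y : E → 𝔤} (hX : X.HasTemperateGrowth)
    (hY : Y.HasTemperateGrowth) : (fun x => X x ● Y x).HasTemperateGrowth := by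
  refine Function.HasTemperateGrowth.sum fun k _ => Function.HasTemperateGrowth.sum fun p _ => ?_
  have h := hasTemperateGrowth_nestedBracket (dynkinWord X Y p) (fun f hf => by
    simp only [dynkinWord, List.mem_flatMap, List.mem_append, List.mem_replicate] at hf
    obtain ⟨i, -, ⟨-, rfl⟩ | ⟨-, rfl⟩⟩ := hf <;> assumption)
  simp only [dynkinWord_apply]
  exact (Function.HasTemperateGrowth.const (dynkinCoeff p)).smul h

/-- The linear maps that raise the degree in the lower central series by at least `j`. -/
def lcsShift (j : ℕ) : Submodule ℝ (𝔤 →L[ℝ] 𝔤) where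
  carrier := {T | ∀ k, ∀ v ∈ LieModule.lowerCentralSeries ℝ 𝔤 𝔤 k,
    T v ∈ LieModule.lowerCentralSeries ℝ 𝔤 𝔤 (k + j)}
  add_mem' hT hT' k v hv := add_mem (hT k v hv) (hT' k v hv)
  zero_mem' _ _ _ := zero_mem _
  smul_mem' c _ hT k v hv := (LieModule.lowerCentralSeries ℝ 𝔤 𝔤 _).smul_mem c (hT k v hv)

theorem id_mem_lcsShift : ContinuousLinearMap.id ℝ 𝔤 ∈ lcsShift (𝔤 := 𝔤) 0 := fun _ _ hv => hv

theorem lie_mem_lcs (a : 𝔤) {k : ℕ} {v : 𝔤} (hv : v ∈ LieModule.lowerCentralSeries ℝ 𝔤 𝔤 k) :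
    ⁅a, v⁆ ∈ LieModule.lowerCentralSeries ℝ 𝔤 𝔤 (k + 1) := by
  rw [LieModule.lowerCentralSeries_succ]
  exact LieSubmodule.lie_mem_lie (LieSubmodule.mem_top a) hv

theorem lcsShift_one_le : lcsShift (𝔤 := 𝔤) 1 ≤ lcsShift 0 := fun _ hT k v hv =>
  LieModule.antitone_lowerCentralSeries ℝ 𝔤 𝔤 (Nat.le_succ k) (hT k v hv)

/-- By the product rule, each term of the derivative of a bracket contains one more bracket with a
fixed vector, which descends one step in the lower central series. A single letter gives no such
gain, hence the length condition. -/
theorem hasFDerivAt_nestedBracket (y : 𝔤) (l : List (𝔤 → 𝔤))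
    (hl : ∀ f ∈ l, ∃ T ∈ lcsShift (𝔤 := 𝔤) 0, HasFDerivAt f T y) :
    ∃ T ∈ lcsShift (𝔤 := 𝔤) 0, (2 ≤ l.length → T ∈ lcsShift 1) ∧
      HasFDerivAt (fun x => nestedBracket (l.map fun f => f x)) T y := by
  induction l with
  | nil => exact ⟨0, zero_mem _, fun _ => zero_mem _, hasFDerivAt_const _ _⟩
  | cons f l ih =>
    obtain ⟨S, hS, hfS⟩ := hl f (by simp)
    by_cases h : l = []
    · subst h
      exact ⟨S, hS, fun h => by simp at h, hfS⟩
    · obtain ⟨T, hT, -, hlT⟩ := ih fun g hg => hl g (by simp [hg])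
      have h1 := lieCLM.hasFDerivAt_of_bilinear hfS hlT
      have h2 : (fun x => nestedBracket ((f :: l).map fun f => f x)) =
          fun x => lieCLM (f x) (nestedBracket (l.map fun f => f x)) := by
        funext x
        rw [lieCLM_apply, List.map_cons, nestedBracket_cons _ (by simpa using h)]
      rw [h2]
      refine ⟨_, lcsShift_one_le ?_, fun _ => ?_, h1⟩ <;>
      · intro k v hv
        have ha := lie_mem_lcs (f y) (hT k v hv)
        have hb := lie_mem_lcs (nestedBracket (l.map fun f => f y)) (hS k v hv)
        have hb' := neg_mem hb
        rw [lie_skew] at hb'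
        exact add_mem ha hb'

theorem exists_hasFDerivAt_sum {ι : Type*} (S : Submodule ℝ (𝔤 →L[ℝ] 𝔤)) (s : Finset ι)
    {F : ι → 𝔤 → 𝔤} {y : 𝔤} (h : ∀ i ∈ s, ∃ T ∈ S, HasFDerivAt (F i) T y) :
    ∃ T ∈ S, HasFDerivAt (fun x => ∑ i ∈ s, F i x) T y := by
  choose! T hT hF using h
  exact ⟨∑ i ∈ s, T i, S.sum_mem hT, HasFDerivAt.fun_sum hF⟩

theorem hasFDerivAt_bch [LieRing.IsNilpotent 𝔤] {f g : 𝔤 → 𝔤} {f' g' : 𝔤 →L[ℝ] 𝔤} {y : 𝔤}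
    (hf : HasFDerivAt f f' y) (hg : HasFDerivAt g g' y) (hf' : f' ∈ lcsShift (𝔤 := 𝔤) 0)
    (hg' : g' ∈ lcsShift (𝔤 := 𝔤) 0) :
    ∃ T ∈ lcsShift (𝔤 := 𝔤) 1, HasFDerivAt (fun x => f x ● g x) (f' + g' + T) y := by
  simp only [bch_eq_dynkinSum_of_le (Nat.le_succ _), dynkinSum_eq_add (Nat.le_add_left 1 _)]
  obtain ⟨T, hT, hd⟩ : ∃ T ∈ lcsShift (𝔤 := 𝔤) 1, HasFDerivAt (fun x =>
      ∑ k ∈ Finset.Icc 1 (LieModule.nilpotencyLength 𝔤 𝔤 + 1),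
      ∑ p ∈ Fintype.piFinset fun _ : Fin k => blocks (LieModule.nilpotencyLength 𝔤 𝔤 + 1),
        if 2 ≤ (dynkinWord (f x) (g x) p).length then
          dynkinCoeff p • nestedBracket (dynkinWord (f x) (g x) p) else 0) T y := by
    refine exists_hasFDerivAt_sum _ _ fun k _ => exists_hasFDerivAt_sum _ _ fun p _ => ?_
    simp only [dynkinWord_apply, List.length_map]
    split_ifs with h2
    · obtain ⟨T, -, hT, hd⟩ := hasFDerivAt_nestedBracket y (dynkinWord f g p) (fun u hu => by
        simp only [dynkinWord, List.mem_flatMap, List.mem_append, List.mem_replicate] at hu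
        obtain ⟨i, -, ⟨-, rfl⟩ | ⟨-, rfl⟩⟩ := hu
        · exact ⟨_, hf', hf⟩
        · exact ⟨_, hg', hg⟩)
      exact ⟨dynkinCoeff p • T, Submodule.smul_mem _ _ (hT h2), hd.const_smul _⟩
    · exact ⟨0, zero_mem _, hasFDerivAt_const _ _⟩
  exact ⟨T, hT, (hf.add hg).add hd⟩

/-- `T` is nilpotent, so the characteristic polynomial of `-T` is a power of `X`; its value at `1`
is `det (1 + T)`. -/
theorem det_one_add_of_mem_lcsShift [LieRing.IsNilpotent 𝔤] {T : 𝔤 →L[ℝ] 𝔤}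
    (hT : T ∈ lcsShift (𝔤 := 𝔤) 1) : (ContinuousLinearMap.id ℝ 𝔤 + T).det = 1 := by
  have hpow : ∀ j v, ((-T : 𝔤 →ₗ[ℝ] 𝔤) ^ j) v ∈ LieModule.lowerCentralSeries ℝ 𝔤 𝔤 j := by
    intro j
    induction j with
    | zero => intro v; simp
    | succ j ih =>
      intro v
      rw [pow_succ', Module.End.mul_apply, LinearMap.neg_apply]
      exact neg_mem (hT j _ (ih v))
  have hnil : IsNilpotent (-T : 𝔤 →ₗ[ℝ] 𝔤) := by
    refine ⟨LieModule.nilpotencyLength 𝔤 𝔤, LinearMap.ext fun v => ?_⟩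
    have := hpow (LieModule.nilpotencyLength 𝔤 𝔤) v
    rwa [lcs_nilpotencyLength, LieSubmodule.mem_bot] at this
  have h1 := LinearMap.eval_charpoly (-T : 𝔤 →ₗ[ℝ] 𝔤) 1
  rw [hnil.charpoly_eq_X_pow_finrank, Polynomial.eval_pow, Polynomial.eval_X, one_pow, map_one,
    sub_neg_eq_add] at h1
  exact h1.symm

variable [MeasurableSpace 𝔤] [BorelSpace 𝔤] (μ : Measure 𝔤) [μ.IsAddHaarMeasure]

theorem measurePreserving_of_abs_det_eq_one {F : 𝔤 → 𝔤} {F' : 𝔤 → 𝔤 →L[ℝ] 𝔤}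
    (hF : ∀ x, HasFDerivAt F (F' x) x) (hdet : ∀ x, |(F' x).det| = 1)
    (hbij : Function.Bijective F) : MeasurePreserving F μ μ := by
  have hmeas : Measurable F :=
    (continuous_iff_continuousAt.2 fun x => (hF x).continuousAt).measurable
  refine ⟨hmeas, Measure.ext fun s hs => ?_⟩
  rw [Measure.map_apply hmeas hs]
  have := lintegral_abs_det_fderiv_eq_addHaar_image μ (hmeas hs)
    (fun x _ => (hF x).hasFDerivWithinAt) (hbij.injective.injOn)
  simpa [hdet, Set.image_preimage_eq _ hbij.surjective] using this

variable [LieRing.IsNilpotent 𝔤]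

theorem measurePreserving_bch_left (X : 𝔤) : MeasurePreserving (fun Y => X ● Y) μ μ := by
  have h : ∀ Y, ∃ T ∈ lcsShift (𝔤 := 𝔤) 1,
      HasFDerivAt (fun Y => X ● Y) (0 + ContinuousLinearMap.id ℝ 𝔤 + T) Y := fun Y =>
    hasFDerivAt_bch (hasFDerivAt_const X Y) (hasFDerivAt_id Y) (zero_mem _) id_mem_lcsShift
  choose T hT hd using h
  refine measurePreserving_of_abs_det_eq_one μ hd (fun Y => ?_) ?_
  · rw [zero_add, det_one_add_of_mem_lcsShift (hT Y), abs_one]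
  · exact Function.bijective_iff_has_inverse.2
      ⟨fun Y => (-X) ● Y, neg_bch_cancel_left X, bch_neg_cancel_left X⟩

theorem measurePreserving_bch_right (X : 𝔤) : MeasurePreserving (fun Y => Y ● X) μ μ := by
  have h : ∀ Y, ∃ T ∈ lcsShift (𝔤 := 𝔤) 1,
      HasFDerivAt (fun Y => Y ● X) (ContinuousLinearMap.id ℝ 𝔤 + 0 + T) Y := fun Y =>
    hasFDerivAt_bch (hasFDerivAt_id Y) (hasFDerivAt_const X Y) id_mem_lcsShift (zero_mem _)
  choose T hT hd using h
  refine measurePreserving_of_abs_det_eq_one μ hd (fun Y => ?_) ?_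
  · rw [add_zero, det_one_add_of_mem_lcsShift (hT Y), abs_one]
  · exact Function.bijective_iff_has_inverse.2
      ⟨fun Y => Y ● (-X), fun Y => bch_neg_cancel_right Y X, fun Y => neg_bch_cancel_right Y X⟩

end Analysis

/-! ### A criterion for Schwartz functions -/

section Criterion

variable {E : Type*} [NormedAddCommGroup E] [NormedSpace ℝ E] [FiniteDimensional ℝ E]

theorem norm_le_sum_coord (x : E) :
    ‖x‖ ≤ ∑ i, ‖Module.finBasis ℝ E i‖ * |(Module.finBasis ℝ E).coord i x| := by
  conv_lhs => rw [← (Module.finBasis ℝ E).sum_repr x]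
  refine (norm_sum_le _ _).trans_eq (Finset.sum_congr rfl fun i _ => ?_)
  rw [norm_smul, mul_comm, Real.norm_eq_abs, Module.Basis.coord_apply]

theorem fderiv_eq_sum_coord (F : E → ℂ) :
    fderiv ℝ F = fun x => ∑ i, ContinuousLinearMap.smulRightL ℝ E ℂ
      (LinearMap.toContinuousLinearMap ((Module.finBasis ℝ E).coord i))
        (fderiv ℝ F x (Module.finBasis ℝ E i)) := by
  ext x v
  conv_lhs => rw [← (Module.finBasis ℝ E).sum_repr v, map_sum]
  simp

/-- A family of bounded functions, stable up to linear combinations under derivatives and under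
multiplication by linear forms, consists of Schwartz functions. -/
theorem isSchwartz_of_stable (𝒢 : Set (E → ℂ)) (hb : ∀ F ∈ 𝒢, ∃ C, ∀ x, ‖F x‖ ≤ C)
    (hd : ∀ F ∈ 𝒢, ∃ F' : E → E →L[ℝ] ℂ, (∀ x, HasFDerivAt F (F' x) x) ∧
      ∀ v, (fun x => F' x v) ∈ Submodule.span ℂ 𝒢)
    (hm : ∀ F ∈ 𝒢, ∀ l : E →L[ℝ] ℝ, (fun x => (l x : ℂ) * F x) ∈ Submodule.span ℂ 𝒢)
    (F : E → ℂ) (hF : F ∈ 𝒢) : IsSchwartz F := by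
  -- Boundedness and the two stability properties pass to the span, on which all inductions are run.
  set W := Submodule.span ℂ 𝒢 with hW
  have hbW : ∀ F ∈ W, ∃ C, ∀ x, ‖F x‖ ≤ C := by
    intro F hF
    induction hF using Submodule.span_induction with
    | mem F h => exact hb F h
    | zero => exact ⟨0, by simp⟩
    | add F G _ _ hF hG =>
      obtain ⟨C, hC⟩ := hF
      obtain ⟨D, hD⟩ := hG
      exact ⟨C + D, fun x => (norm_add_le _ _).trans (add_le_add (hC x) (hD x))⟩
    | smul c F _ hF =>
      obtain ⟨C, hC⟩ := hF
      refine ⟨‖c‖ * C, fun x => ?_⟩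
      rw [Pi.smul_apply, norm_smul]
      exact mul_le_mul_of_nonneg_left (hC x) (norm_nonneg c)
  have hdW : ∀ F ∈ W, Differentiable ℝ F ∧ ∀ v, (fun x => fderiv ℝ F x v) ∈ W := by
    intro F hF
    induction hF using Submodule.span_induction with
    | mem F h =>
      obtain ⟨F', h1, h2⟩ := hd F h
      refine ⟨fun x => (h1 x).differentiableAt, fun v => ?_⟩
      simpa only [(h1 _).fderiv] using h2 v
    | zero => exact ⟨differentiable_const 0, fun v => by
      convert W.zero_mem using 1
      ext x
      simp⟩
    | add F G _ _ hF hG =>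
      refine ⟨hF.1.add hG.1, fun v => ?_⟩
      convert add_mem (hF.2 v) (hG.2 v) using 1
      ext x
      rw [fderiv_add (hF.1 x) (hG.1 x)]
      rfl
    | smul c F _ hF =>
      refine ⟨hF.1.const_smul c, fun v => ?_⟩
      convert W.smul_mem c (hF.2 v) using 1
      ext x
      rw [fderiv_const_smul (hF.1 x)]
      rfl
  have hmW : ∀ F ∈ W, ∀ l : E →L[ℝ] ℝ, (fun x => (l x : ℂ) * F x) ∈ W := by
    intro F hF l
    induction hF using Submodule.span_induction with
    | mem F h => exact hm F h l
    | zero => simp [← Pi.zero_def]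
    | add F G _ _ hF hG =>
      convert add_mem hF hG using 1
      ext x
      simp [mul_add]
    | smul c F _ hF =>
      convert W.smul_mem c hF using 1
      ext x
      simp [mul_left_comm]
  have hsm : ∀ n : ℕ, ∀ F ∈ W, ContDiff ℝ n F := by
    intro n
    induction n with
    | zero => exact fun F hF => contDiff_zero.2 (hdW F hF).1.continuous
    | succ n ih =>
      intro F hF
      rw [Nat.cast_succ, contDiff_succ_iff_fderiv_apply]
      exact ⟨(hdW F hF).1, by simp, fun v => ih _ ((hdW F hF).2 v)⟩
  -- A factor `‖x‖` is dominated by coordinates, and each coordinate times `F` is again in `W`.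
  have hk : ∀ k : ℕ, ∀ F ∈ W, ∃ C, ∀ x, ‖x‖ ^ k * ‖F x‖ ≤ C := by
    intro k
    induction k with
    | zero => simpa using hbW
    | succ k ih =>
      intro F hF
      choose C hC using fun i => ih _ (hmW F hF
        (LinearMap.toContinuousLinearMap ((Module.finBasis ℝ E).coord i)))
      refine ⟨∑ i, ‖Module.finBasis ℝ E i‖ * C i, fun x => ?_⟩
      calc ‖x‖ ^ (k + 1) * ‖F x‖ = ‖x‖ * (‖x‖ ^ k * ‖F x‖) := by ring
        _ ≤ (∑ i, ‖Module.finBasis ℝ E i‖ * |(Module.finBasis ℝ E).coord i x|)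
            * (‖x‖ ^ k * ‖F x‖) := by gcongr; exact norm_le_sum_coord x
        _ = ∑ i, ‖Module.finBasis ℝ E i‖ *
            (‖x‖ ^ k * (|(Module.finBasis ℝ E).coord i x| * ‖F x‖)) := by
          rw [Finset.sum_mul]
          exact Finset.sum_congr rfl fun i _ => by ring
        _ ≤ _ := by
          refine Finset.sum_le_sum fun i _ => mul_le_mul_of_nonneg_left ?_ (norm_nonneg _)
          simpa using hC i x
  -- One derivative is written through the directional derivatives along a basis, which lie in `W`.
  have hn : ∀ n k : ℕ, ∀ F ∈ W, ∃ C, ∀ x, ‖x‖ ^ k * ‖iteratedFDeriv ℝ n F x‖ ≤ C := by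
    intro n
    induction n with
    | zero => simpa using hk
    | succ n ih =>
      intro k F hF
      choose C hC using fun i => ih k _ ((hdW F hF).2 (Module.finBasis ℝ E i))
      set L : Fin (Module.finrank ℝ E) → ℂ →L[ℝ] E →L[ℝ] ℂ := fun i =>
        ContinuousLinearMap.smulRightL ℝ E ℂ
          (LinearMap.toContinuousLinearMap ((Module.finBasis ℝ E).coord i)) with hL
      refine ⟨∑ i, ‖L i‖ * C i, fun x => ?_⟩
      have hc : ∀ i, ContDiff ℝ n (fun x => fderiv ℝ F x (Module.finBasis ℝ E i)) := fun i =>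
        hsm n _ ((hdW F hF).2 _)
      have hs : fderiv ℝ F = fun x => ∑ i, (L i ∘ fun x =>
          fderiv ℝ F x (Module.finBasis ℝ E i)) x := fderiv_eq_sum_coord F
      rw [← norm_iteratedFDeriv_fderiv, hs,
        iteratedFDeriv_fun_sum_apply fun i _ => ((L i).contDiff.comp (hc i)).contDiffAt,
        mul_comm]
      calc _ ≤ (∑ i, ‖L i‖ * ‖iteratedFDeriv ℝ n
            (fun x => fderiv ℝ F x (Module.finBasis ℝ E i)) x‖) * ‖x‖ ^ k := by
            gcongr
            refine (norm_sum_le _ _).trans (Finset.sum_le_sum fun i _ => ?_)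
            exact (L i).norm_iteratedFDeriv_comp_left (hc i).contDiffAt le_rfl
        _ = ∑ i, ‖L i‖ * (‖x‖ ^ k * ‖iteratedFDeriv ℝ n
            (fun x => fderiv ℝ F x (Module.finBasis ℝ E i)) x‖) := by
          rw [Finset.sum_mul]
          exact Finset.sum_congr rfl fun i _ => by ring
        _ ≤ _ := Finset.sum_le_sum fun i _ => mul_le_mul_of_nonneg_left (hC i x) (norm_nonneg (L i))
  have hFW : F ∈ W := Submodule.subset_span hF
  exact ⟨⟨F, contDiff_infty.2 fun n => hsm n F hFW, fun k n => hn n k F hFW⟩, rfl⟩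

end Criterion

/-! ### Operations on Schwartz functions and tensor products -/

section API

variable {E : Type*} [NormedAddCommGroup E] [NormedSpace ℝ E]
variable {D : Type*} [NormedAddCommGroup D] [NormedSpace ℝ D]

theorem _root_.SchwartzMap.isSchwartz (f : 𝓢(E, ℂ)) : IsSchwartz (f : E → ℂ) := ⟨f, rfl⟩

theorem IsSchwartz.coe_toSchwartz {F : E → ℂ} (h : IsSchwartz F) : ⇑(toSchwartz F) = F := by
  rw [toSchwartz, dif_pos h]
  exact h.choose_spec

theorem IsSchwartz.conj {F : E → ℂ} (hF : IsSchwartz F) : IsSchwartz fun x => conj (F x) := by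
  obtain ⟨f, rfl⟩ := hF
  exact ⟨f.postcompCLM (𝕜 := ℝ) (Complex.conjCLE : ℂ →L[ℝ] ℂ), rfl⟩

theorem IsSchwartz.temperate_mul {F G : E → ℂ} (hG : G.HasTemperateGrowth) (hF : IsSchwartz F) :
    IsSchwartz fun x => G x * F x := by
  obtain ⟨f, rfl⟩ := hF
  refine ⟨SchwartzMap.smulLeftCLM ℂ G f, ?_⟩
  ext x
  rw [SchwartzMap.smulLeftCLM_apply_apply hG, smul_eq_mul]

/-- The temperate left inverse bounds `‖x‖` by a power of `1 + ‖g x‖`, so decay in `g x` gives decay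
in `x`. Surjectivity of `g` is not needed, so restriction to subspaces is covered. -/
theorem IsSchwartz.comp {F : E → ℂ} (hF : IsSchwartz F) {g : D → E} {h : E → D}
    (hg : g.HasTemperateGrowth) (hh : h.HasTemperateGrowth) (hgh : ∀ x, h (g x) = x) :
    IsSchwartz fun x => F (g x) := by
  obtain ⟨f, rfl⟩ := hF
  refine ⟨SchwartzMap.compCLM ℂ hg ?_ f, rfl⟩
  obtain ⟨k, C, hC⟩ := hh.2 0
  refine ⟨k, C, fun x => ?_⟩
  simpa [hgh] using hC (g x)

theorem IsSchwartz.comp_equiv {F : E → ℂ} (hF : IsSchwartz F) (g : D ≃L[ℝ] E) :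
    IsSchwartz fun x => F (g x) :=
  hF.comp g.hasTemperateGrowth g.symm.hasTemperateGrowth g.symm_apply_apply

theorem IsSchwartz.integrable [FiniteDimensional ℝ E] [MeasurableSpace E] [BorelSpace E]
    {F : E → ℂ} (hF : IsSchwartz F) (m : Measure E) [m.IsAddHaarMeasure] : Integrable F m := by
  obtain ⟨f, rfl⟩ := hF
  exact f.integrable

end API

section Product

variable {E F : Type*} [NormedAddCommGroup E] [NormedSpace ℝ E] [FiniteDimensional ℝ E]
  [NormedAddCommGroup F] [NormedSpace ℝ F] [FiniteDimensional ℝ F]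

-- The criterion applies to all products at once: derivatives obey the product rule, and a linear
-- form on `E × F` is a sum of forms on the factors.
open scoped LineDeriv in
theorem IsSchwartz.prod {f : E → ℂ} {g : F → ℂ} (hf : IsSchwartz f) (hg : IsSchwartz g) :
    IsSchwartz fun p : E × F => f p.1 * g p.2 := by
  set 𝒢 : Set (E × F → ℂ) :=
    {h | ∃ (f : 𝓢(E, ℂ)) (g : 𝓢(F, ℂ)), h = fun p => f p.1 * g p.2} with h𝒢
  have hmem : ∀ (f : 𝓢(E, ℂ)) (g : 𝓢(F, ℂ)), (fun p : E × F => f p.1 * g p.2) ∈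
      Submodule.span ℂ 𝒢 := fun f g => Submodule.subset_span ⟨f, g, rfl⟩
  refine isSchwartz_of_stable 𝒢 ?_ ?_ ?_ _ ?_
  · rintro _ ⟨f, g, rfl⟩
    refine ⟨SchwartzMap.seminorm ℝ 0 0 f * SchwartzMap.seminorm ℝ 0 0 g, fun p => ?_⟩
    rw [norm_mul]
    exact mul_le_mul (f.norm_le_seminorm ℝ _) (g.norm_le_seminorm ℝ _) (norm_nonneg _)
      (apply_nonneg _ _)
  · rintro _ ⟨f, g, rfl⟩
    refine ⟨_, fun p => ((f.hasFDerivAt p.1).comp p (hasFDerivAt_fst (𝕜 := ℝ))).mul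
      ((g.hasFDerivAt p.2).comp p (hasFDerivAt_snd (𝕜 := ℝ))), fun v => ?_⟩
    convert add_mem (hmem f (∂_{v.2} g)) (hmem (∂_{v.1} f) g) using 1
    ext p
    simp [SchwartzMap.lineDerivOp_apply_eq_fderiv, mul_comm]
  · rintro _ ⟨f, g, rfl⟩ l
    have h1 : Function.HasTemperateGrowth fun x : E => ((l (x, 0) : ℝ) : ℂ) :=
      (Complex.ofRealCLM.comp (l.comp (ContinuousLinearMap.inl ℝ E F))).hasTemperateGrowth
    have h2 : Function.HasTemperateGrowth fun x : F => ((l (0, x) : ℝ) : ℂ) :=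
      (Complex.ofRealCLM.comp (l.comp (ContinuousLinearMap.inr ℝ E F))).hasTemperateGrowth
    obtain ⟨f', hf'⟩ := IsSchwartz.temperate_mul h1 ⟨f, rfl⟩
    obtain ⟨g', hg'⟩ := IsSchwartz.temperate_mul h2 ⟨g, rfl⟩
    convert add_mem (hmem f' g) (hmem f g') using 1
    ext p
    have : l p = l (p.1, 0) + l (0, p.2) := by rw [← map_add]; simp
    simp only [Pi.add_apply, hf', hg', this]
    push_cast
    ring
  · obtain ⟨f, rfl⟩ := hf
    obtain ⟨g, rfl⟩ := hg
    exact ⟨f, g, rfl⟩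

/-- The product of `f (x, y)` and `g (y, z)`. -/
theorem IsSchwartz.chain {G : Type*} [NormedAddCommGroup G] [NormedSpace ℝ G]
    [FiniteDimensional ℝ G] {f : E × F → ℂ} {g : F × G → ℂ} (hf : IsSchwartz f)
    (hg : IsSchwartz g) : IsSchwartz fun p : E × F × G => f (p.1, p.2.1) * g p.2 :=
  (hf.prod hg).comp (g := fun p : E × F × G => ((p.1, p.2.1), p.2))
    (h := fun q : (E × F) × F × G => (q.1.1, q.2))
    (((ContinuousLinearMap.fst ℝ E (F × G)).prod
      ((ContinuousLinearMap.fst ℝ F G).comp (ContinuousLinearMap.snd ℝ E (F × G)))).prod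
        (ContinuousLinearMap.snd ℝ E (F × G))).hasTemperateGrowth
    (((ContinuousLinearMap.fst ℝ E F).comp (ContinuousLinearMap.fst ℝ (E × F) (F × G))).prod
      (ContinuousLinearMap.snd ℝ (E × F) (F × G))).hasTemperateGrowth (fun _ => rfl)

end Product

/-! ### Characters and partial Fourier transforms -/

section Character

theorem norm_cexpI (t : ℝ) : ‖cexpI t‖ = 1 := by
  rw [cexpI, mul_comm, Complex.norm_exp_ofReal_mul_I]

theorem cexpI_add (s t : ℝ) : cexpI (s + t) = cexpI s * cexpI t := by
  simp [cexpI, mul_add, Complex.exp_add]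

theorem cexpI_zero : cexpI 0 = 1 := by simp [cexpI]

theorem conj_cexpI (t : ℝ) : conj (cexpI t) = cexpI (-t) := by
  simp [cexpI, ← Complex.exp_conj]

theorem hasDerivAt_cexpI (t : ℝ) : HasDerivAt cexpI (Complex.I * cexpI t) t := by
  have := (((hasDerivAt_id (t : ℂ)).const_mul Complex.I).cexp).comp_ofReal
  exact this.congr_deriv (by simp [cexpI, mul_comm])

theorem continuous_cexpI : Continuous cexpI :=
  continuous_iff_continuousAt.2 fun t => (hasDerivAt_cexpI t).continuousAt

theorem iteratedDeriv_cexpI (n : ℕ) :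
    iteratedDeriv n cexpI = fun t => Complex.I ^ n * cexpI t := by
  induction n with
  | zero => ext; simp
  | succ n ih =>
    ext t
    rw [iteratedDeriv_succ, ih, ((hasDerivAt_cexpI t).const_mul (Complex.I ^ n)).deriv]
    ring

theorem hasTemperateGrowth_cexpI : cexpI.HasTemperateGrowth := by
  refine ⟨?_, fun n => ⟨0, 1, fun t => ?_⟩⟩
  · exact Complex.contDiff_exp.comp (contDiff_const.mul Complex.ofRealCLM.contDiff)
  · rw [norm_iteratedFDeriv_eq_norm_iteratedDeriv, iteratedDeriv_cexpI]
    simp [norm_cexpI]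

theorem hasTemperateGrowth_cexpI_comp {E : Type*} [NormedAddCommGroup E] [NormedSpace ℝ E]
    {t : E → ℝ} (ht : t.HasTemperateGrowth) : (fun x => cexpI (t x)).HasTemperateGrowth :=
  hasTemperateGrowth_cexpI.comp ht

end Character

section PartialFourier

variable {E F G : Type*} [NormedAddCommGroup E] [NormedSpace ℝ E] [FiniteDimensional ℝ E]
  [NormedAddCommGroup F] [NormedSpace ℝ F] [FiniteDimensional ℝ F]
  [NormedAddCommGroup G] [NormedSpace ℝ G] [FiniteDimensional ℝ G]
  [MeasurableSpace F] [BorelSpace F] (m : Measure F) [m.IsAddHaarMeasure]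

/-- The majorant is uniform in `x`, as needed for differentiation under the integral. -/
theorem _root_.SchwartzMap.exists_integrable_bound {V : Type*} [NormedAddCommGroup V] [NormedSpace ℝ V]
    (h : 𝓢(E × F, V)) (j : ℕ) :
    ∃ g : F → ℝ, Integrable g m ∧ ∀ x y, ‖y‖ ^ j * ‖h (x, y)‖ ≤ g y := by
  set r := m.integrablePower
  refine ⟨_, (Measure.integrable_pow_neg_integrablePower m).const_mul
    (2 ^ r * (SchwartzMap.seminorm ℝ 0 0 h + SchwartzMap.seminorm ℝ (j + r) 0 h)), fun x y => ?_⟩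
  refine pow_mul_le_of_le_of_pow_mul_le (norm_nonneg y) (norm_nonneg _)
    (h.norm_le_seminorm ℝ _) (le_trans ?_ (h.norm_pow_mul_le_seminorm ℝ (j + r) (x, y)))
  gcongr
  exact norm_snd_le (x, y)

variable (b : F →L[ℝ] G →L[ℝ] ℝ)

/-- The partial Fourier transform `∫ e^{i b(y, ζ)} f(x, y) dy`. -/
noncomputable def partialFourier (f : E × F → ℂ) (p : E × G) : ℂ :=
  ∫ y, cexpI (b y p.2) * f (p.1, y) ∂m

theorem _root_.SchwartzMap.integrable_cexpI_mul (f : 𝓢(E × F, ℂ)) (p : E × G) :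
    Integrable (fun y => cexpI (b y p.2) * f (p.1, y)) m := by
  obtain ⟨g, hg, hgb⟩ := f.exists_integrable_bound m 0
  refine hg.mono' ?_ (Filter.Eventually.of_forall fun y => ?_)
  · have h1 := continuous_cexpI
    have h2 := f.continuous
    exact (by fun_prop : Continuous _).aestronglyMeasurable
  · simpa [norm_cexpI] using hgb p.1 y

/-- A finite-dimensional space is reflexive. -/
theorem exists_apply_eq (l : StrongDual ℝ F →L[ℝ] ℝ) :
    ∃ y, ∀ ξ : StrongDual ℝ F, ξ y = l ξ := by
  refine ⟨(Module.evalEquiv ℝ F).symm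
    (l.toLinearMap ∘ₗ LinearMap.toContinuousLinearMap.toLinearMap), fun ξ => ?_⟩
  exact Module.apply_evalEquiv_symm_apply (R := ℝ) (M := F) (f := ξ.toLinearMap)
    (g := l.toLinearMap ∘ₗ LinearMap.toContinuousLinearMap.toLinearMap)

theorem partialFourier_add (f g : 𝓢(E × F, ℂ)) (p : E × G) :
    partialFourier m b f p + partialFourier m b g p =
      partialFourier m b (f + g : 𝓢(E × F, ℂ)) p := by
  simp only [partialFourier, add_apply, mul_add]
  exact (integral_add (f.integrable_cexpI_mul m b p) (g.integrable_cexpI_mul m b p)).symm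

theorem hasFDerivAt_cexpI_mul (f : 𝓢(E × F, ℂ)) (y : F) (p : E × G) :
    HasFDerivAt (fun p : E × G => cexpI (b y p.2) * f (p.1, y))
      (cexpI (b y p.2) • (fderiv ℝ f (p.1, y)).comp
          ((ContinuousLinearMap.inl ℝ E F).comp (ContinuousLinearMap.fst ℝ E G))
        + f (p.1, y) • (Complex.I * cexpI (b y p.2)) •
          (Complex.ofRealCLM.comp ((b y).comp (ContinuousLinearMap.snd ℝ E G)))) p := by
  have h1 : HasFDerivAt (fun p : E × G => cexpI (b y p.2)) ((Complex.I * cexpI (b y p.2)) •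
      (Complex.ofRealCLM.comp ((b y).comp (ContinuousLinearMap.snd ℝ E G)))) p := by
    have := (hasDerivAt_cexpI (b y p.2)).hasFDerivAt.comp p
      (((b y).comp (ContinuousLinearMap.snd ℝ E G)).hasFDerivAt (x := p))
    exact this.congr_fderiv (by ext v <;> simp [mul_comm])
  have h2 : HasFDerivAt (fun p : E × G => f (p.1, y)) ((fderiv ℝ f (p.1, y)).comp
      ((ContinuousLinearMap.inl ℝ E F).comp (ContinuousLinearMap.fst ℝ E G))) p := by
    refine (f.hasFDerivAt (p.1, y)).comp p ?_
    exact ((hasFDerivAt_fst (𝕜 := ℝ) (p := p)).prodMk (hasFDerivAt_const y p)).congr_fderiv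
      (by ext v <;> simp)
  exact h1.mul h2

open scoped LineDeriv

/-- Differentiating under the integral in direction `v` gives the transform of the Schwartz function
`∂_{(v.1, 0)} f + i b(y, v.2) f`. -/
theorem exists_hasFDerivAt_partialFourier (f : 𝓢(E × F, ℂ)) :
    ∃ P' : E × G → E × G →L[ℝ] ℂ, (∀ p, HasFDerivAt (partialFourier m b f) (P' p) p) ∧
      ∀ v, ∃ g : 𝓢(E × F, ℂ), (fun p => P' p v) = partialFourier m b g := by
  obtain ⟨g1, hg1, hb1⟩ := (SchwartzMap.fderivCLM ℝ (E × F) ℂ f).exists_integrable_bound m 0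
  obtain ⟨g2, hg2, hb2⟩ := f.exists_integrable_bound m 1
  set Q : E × G → F → E × G →L[ℝ] ℂ := fun p y =>
    cexpI (b y p.2) • (fderiv ℝ f (p.1, y)).comp
          ((ContinuousLinearMap.inl ℝ E F).comp (ContinuousLinearMap.fst ℝ E G))
        + f (p.1, y) • (Complex.I * cexpI (b y p.2)) •
          (Complex.ofRealCLM.comp ((b y).comp (ContinuousLinearMap.snd ℝ E G))) with hQ
  have hbound : ∀ p y, ‖Q p y‖ ≤ g1 y + ‖b‖ * g2 y := by
    intro p y
    refine (norm_add_le _ _).trans (add_le_add ?_ ?_)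
    · rw [norm_smul, norm_cexpI, one_mul]
      refine le_trans (ContinuousLinearMap.opNorm_le_bound _ (norm_nonneg (fderiv ℝ f (p.1, y)))
        fun v => ?_) (by simpa using hb1 p.1 y)
      refine ((fderiv ℝ f (p.1, y)).le_opNorm _).trans ?_
      gcongr
      simpa using norm_fst_le v
    · rw [norm_smul, norm_smul, norm_mul, Complex.norm_I, norm_cexpI, one_mul, one_mul]
      have h3 : ‖Complex.ofRealCLM.comp ((b y).comp (ContinuousLinearMap.snd ℝ E G))‖
          ≤ ‖b‖ * ‖y‖ := by
        refine ContinuousLinearMap.opNorm_le_bound _ (by positivity) fun v => ?_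
        simp only [ContinuousLinearMap.comp_apply, Complex.ofRealCLM_apply, Complex.norm_real,
          ContinuousLinearMap.coe_snd']
        refine (b.le_opNorm₂ y v.2).trans ?_
        gcongr
        exact norm_snd_le v
      calc _ ≤ ‖f (p.1, y)‖ * (‖b‖ * ‖y‖) := by gcongr
        _ = ‖b‖ * (‖y‖ ^ 1 * ‖f (p.1, y)‖) := by ring
        _ ≤ _ := by gcongr; exact hb2 p.1 y
  have hQc : ∀ p, Continuous (Q p) := by
    intro p
    have h1 := continuous_cexpI
    have h2 := f.continuous
    have h3 : Continuous (fderiv ℝ f) := (SchwartzMap.fderivCLM ℝ (E × F) ℂ f).continuous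
    simp only [hQ]
    fun_prop
  have hgi : Integrable (fun y => g1 y + ‖b‖ * g2 y) m := hg1.add (hg2.const_mul _)
  have hQi : ∀ p, Integrable (Q p) m := fun p =>
    hgi.mono' (hQc p).aestronglyMeasurable (Filter.Eventually.of_forall (hbound p))
  refine ⟨fun p => ∫ y, Q p y ∂m, fun p => ?_, fun v => ?_⟩
  · exact hasFDerivAt_integral_of_dominated_of_fderiv_le Filter.univ_mem
      (Filter.Eventually.of_forall fun q => (f.integrable_cexpI_mul m b q).aestronglyMeasurable)
      (f.integrable_cexpI_mul m b p) (hQc p).aestronglyMeasurable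
      (Filter.Eventually.of_forall fun y q _ => hbound q y) hgi
      (Filter.Eventually.of_forall fun y q _ => hasFDerivAt_cexpI_mul b f y q)
  · have ht : Function.HasTemperateGrowth fun q : E × F => Complex.I * ((b q.2 v.2 : ℝ) : ℂ) :=
      (Function.HasTemperateGrowth.const _).mul
        (Complex.ofRealCLM.comp ((b.flip v.2).comp
          (ContinuousLinearMap.snd ℝ E F))).hasTemperateGrowth
    obtain ⟨g, hg⟩ := IsSchwartz.temperate_mul ht ⟨f, rfl⟩
    refine ⟨∂_{(v.1, (0 : F))} f + g, ?_⟩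
    ext p
    rw [ContinuousLinearMap.integral_apply (hQi p)]
    refine integral_congr_ae (Filter.Eventually.of_forall fun y => ?_)
    simp only [hQ, add_apply, hg, SchwartzMap.lineDerivOp_apply_eq_fderiv]
    simp
    ring

/-- Integration by parts in `y`: a frequency factor becomes a derivative of `f`. -/
theorem mul_partialFourier (f : 𝓢(E × F, ℂ)) (y₀ : F) (p : E × G) :
    ((b y₀ p.2 : ℝ) : ℂ) * partialFourier m b f p =
      partialFourier m b (Complex.I • ∂_{((0 : E), y₀)} f : 𝓢(E × F, ℂ)) p := by
  have hc : ∀ y, HasFDerivAt (fun y => cexpI (b y p.2))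
      ((Complex.I * cexpI (b y p.2)) • (Complex.ofRealCLM.comp (b.flip p.2))) y := by
    intro y
    have := (hasDerivAt_cexpI (b y p.2)).hasFDerivAt.comp y ((b.flip p.2).hasFDerivAt (x := y))
    exact this.congr_fderiv (by ext v; simp [mul_comm])
  have hf : ∀ y, HasFDerivAt (fun y => f (p.1, y)) ((fderiv ℝ f (p.1, y)).comp
      (ContinuousLinearMap.inr ℝ E F)) y := by
    intro y
    refine (f.hasFDerivAt (p.1, y)).comp y ?_
    exact ((hasFDerivAt_const p.1 y).prodMk (hasFDerivAt_id (𝕜 := ℝ) y)).congr_fderiv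
      (by ext v <;> simp)
  have key := integral_bilinear_hasFDerivAt_right_eq_neg_left_of_integrable (μ := m)
    (f := fun y => cexpI (b y p.2)) (g := fun y => f (p.1, y)) (v := y₀)
    (B := ContinuousLinearMap.mul ℝ ℂ) ?_ ?_ ?_ (fun y _ => hc y) (fun y _ => hf y)
  · simp only [ContinuousLinearMap.mul_apply', ContinuousLinearMap.comp_apply,
      ContinuousLinearMap.inr_apply, smul_apply, Complex.ofRealCLM_apply,
      ContinuousLinearMap.flip_apply, smul_eq_mul] at key
    simp only [partialFourier, smul_apply, smul_eq_mul,
      SchwartzMap.lineDerivOp_apply_eq_fderiv, mul_left_comm _ Complex.I]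
    rw [integral_const_mul, key, ← integral_const_mul, ← integral_neg, ← integral_const_mul]
    refine integral_congr_ae (Filter.Eventually.of_forall fun y => ?_)
    linear_combination ((b y₀ p.2 : ℂ) * cexpI (b y p.2) * f (p.1, y)) * Complex.I_sq
  · have := (f.integrable_cexpI_mul m b p).const_mul (Complex.I * (b y₀ p.2 : ℂ))
    refine this.congr (Filter.Eventually.of_forall fun y => ?_)
    simp
    ring
  · have := (∂_{((0 : E), y₀)} f).integrable_cexpI_mul m b p
    refine this.congr (Filter.Eventually.of_forall fun y => ?_)
    simp [SchwartzMap.lineDerivOp_apply_eq_fderiv]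
  · simpa using f.integrable_cexpI_mul m b p

/-- Partial Fourier transforms preserve Schwartz spaces. -/
theorem IsSchwartz.partialFourier (hb : ∀ l : G →L[ℝ] ℝ, ∃ y, b y = l) {f : E × F → ℂ}
    (hf : IsSchwartz f) : IsSchwartz (partialFourier m b f : E × G → ℂ) := by
  refine isSchwartz_of_stable {P | ∃ f : 𝓢(E × F, ℂ), P = Coorbit.partialFourier m b f}
    ?_ ?_ ?_ _ ?_
  · rintro _ ⟨f, rfl⟩
    obtain ⟨g, hg, hgb⟩ := f.exists_integrable_bound m 0
    refine ⟨∫ y, g y ∂m, fun p => norm_integral_le_of_norm_le hg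
      (Filter.Eventually.of_forall fun y => ?_)⟩
    simpa [norm_cexpI] using hgb p.1 y
  · rintro _ ⟨f, rfl⟩
    obtain ⟨P', h1, h2⟩ := exists_hasFDerivAt_partialFourier m b f
    exact ⟨P', h1, fun v => Submodule.subset_span (h2 v)⟩
  · rintro _ ⟨f, rfl⟩ l
    -- By `hb` the part of `l` on frequencies has the form `b y₀`, so integration by parts absorbs
    -- it; the part on `E` is absorbed into `f`.
    obtain ⟨y₀, hy₀⟩ := hb (l.comp (ContinuousLinearMap.inr ℝ E G))
    have h1 : Function.HasTemperateGrowth fun x : E × F => ((l (x.1, 0) : ℝ) : ℂ) :=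
      (Complex.ofRealCLM.comp ((l.comp (ContinuousLinearMap.inl ℝ E G)).comp
        (ContinuousLinearMap.fst ℝ E F))).hasTemperateGrowth
    obtain ⟨f', hf'⟩ := IsSchwartz.temperate_mul h1 ⟨f, rfl⟩
    refine Submodule.subset_span ⟨f' + Complex.I • ∂_{((0 : E), y₀)} f, ?_⟩
    ext p
    have h2 : l p = l (p.1, 0) + b y₀ p.2 := by
      rw [hy₀, ContinuousLinearMap.comp_apply, ← map_add]
      simp
    have h3 : ((l (p.1, 0) : ℝ) : ℂ) * Coorbit.partialFourier m b f p =
        Coorbit.partialFourier m b f' p := by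
      simp only [Coorbit.partialFourier, hf']
      rw [← integral_const_mul]
      exact integral_congr_ae (Filter.Eventually.of_forall fun y => mul_left_comm _ _ _)
    have h4 := partialFourier_add m b f' (Complex.I • ∂_{((0 : E), y₀)} f) p
    rw [h2, Complex.ofReal_add, add_mul, h3, mul_partialFourier, h4]
  · obtain ⟨f, rfl⟩ := hf
    exact ⟨f, rfl⟩

/-- Integration over a variable preserves Schwartz spaces. -/
theorem IsSchwartz.integral_snd {f : E × F → ℂ} (hf : IsSchwartz f) :
    IsSchwartz fun x => ∫ y, f (x, y) ∂m := by
  -- The integral is the partial Fourier transform at frequency zero.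
  have h := (hf.partialFourier (G := StrongDual ℝ F) m
    (ContinuousLinearMap.apply ℝ ℝ : F →L[ℝ] StrongDual ℝ F →L[ℝ] ℝ) ?_).comp
    (g := fun x : E => (x, (0 : StrongDual ℝ F))) (h := Prod.fst)
    (ContinuousLinearMap.inl ℝ E (StrongDual ℝ F)).hasTemperateGrowth
    (ContinuousLinearMap.fst ℝ E (StrongDual ℝ F)).hasTemperateGrowth (fun _ => rfl)
  · simpa [Coorbit.partialFourier, cexpI_zero] using h
  · intro l
    obtain ⟨y, hy⟩ := exists_apply_eq l
    exact ⟨y, ContinuousLinearMap.ext hy⟩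

end PartialFourier

section Fourier

variable {F G : Type*} [NormedAddCommGroup F] [NormedSpace ℝ F] [FiniteDimensional ℝ F]
  [NormedAddCommGroup G] [NormedSpace ℝ G] [FiniteDimensional ℝ G]
  [MeasurableSpace F] [BorelSpace F] (m : Measure F) [m.IsAddHaarMeasure]
  (b : F →L[ℝ] G →L[ℝ] ℝ)

theorem IsSchwartz.fourier (hb : ∀ l : G →L[ℝ] ℝ, ∃ y, b y = l) {f : F → ℂ}
    (hf : IsSchwartz f) : IsSchwartz fun ζ : G => ∫ y, cexpI (b y ζ) * f y ∂m := by
  -- A zero-dimensional parameter space reduces the full transform to the partial one.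
  have h1 : IsSchwartz fun p : (Fin 0 → ℝ) × F => f p.2 :=
    hf.comp (ContinuousLinearMap.snd ℝ (Fin 0 → ℝ) F).hasTemperateGrowth
      (ContinuousLinearMap.inr ℝ (Fin 0 → ℝ) F).hasTemperateGrowth
      fun p => Prod.ext (Subsingleton.elim _ _) rfl
  exact (h1.partialFourier m b hb).comp
    (ContinuousLinearMap.inr ℝ (Fin 0 → ℝ) G).hasTemperateGrowth
    (ContinuousLinearMap.snd ℝ (Fin 0 → ℝ) G).hasTemperateGrowth fun _ => rfl

end Fourier

/-! ### Fourier inversion and Plancherel for dual Haar measures -/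

section Euclidean

open scoped FourierTransform RealInnerProductSpace

variable {V : Type*} [NormedAddCommGroup V] [InnerProductSpace ℝ V] [FiniteDimensional ℝ V]
  [MeasurableSpace V] [BorelSpace V]

theorem fourier_inversion_inner {P : V → ℂ} (hP : IsSchwartz P) (x : V) :
    ∫ w, cexpI ⟪w, x⟫ * ∫ v, cexpI (-⟪w, v⟫) * P v =
      ((2 * Real.pi) ^ Module.finrank ℝ V : ℝ) * P x := by
  obtain ⟨f, rfl⟩ := hP
  have h1 : ∫ w : V, cexpI ⟪(2 * Real.pi) • w, x⟫ *
      ∫ v, cexpI (-⟪(2 * Real.pi) • w, v⟫) * f v = f x := by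
    have h := congrFun (f.continuous.fourierInv_fourier_eq f.integrable
      (by rw [← SchwartzMap.fourier_coe]; exact (𝓕 f).integrable)) x
    rw [Real.fourierInv_eq'] at h
    simp only [Real.fourier_eq'] at h
    rw [← h]
    congr 1
    ext w
    rw [smul_eq_mul]
    congr 1
    · simp only [cexpI, inner_smul_left]
      simp [mul_comm Complex.I, mul_assoc]
    · congr 1
      ext v
      simp only [cexpI, inner_smul_left, smul_eq_mul, real_inner_comm w v]
      simp [mul_comm Complex.I, mul_assoc]
  -- Rescaling frequencies by `2π` removes it from the exponent and produces the factor `(2π)^n`.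
  have h2 := Measure.integral_comp_smul volume
    (fun w : V => cexpI ⟪w, x⟫ * ∫ v, cexpI (-⟪w, v⟫) * f v) (2 * Real.pi)
  rw [h1] at h2
  have h3 : (0 : ℝ) < (2 * Real.pi) ^ Module.finrank ℝ V := by positivity
  rw [h2, abs_of_pos (inv_pos.2 h3), Complex.real_smul, ← mul_assoc, ← Complex.ofReal_mul,
    mul_inv_cancel₀ h3.ne', Complex.ofReal_one, one_mul]

theorem fourier_inversion_inner_neg {P : V → ℂ} (hP : IsSchwartz P) (x : V) :
    ∫ w, cexpI (-⟪x, w⟫) * ∫ v, cexpI ⟪v, w⟫ * P v =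
      ((2 * Real.pi) ^ Module.finrank ℝ V : ℝ) * P x := by
  have h := fourier_inversion_inner (hP.comp_equiv (ContinuousLinearEquiv.neg ℝ)) (-x)
  simp only [ContinuousLinearEquiv.neg_apply, neg_neg, inner_neg_right, real_inner_comm x] at h
  rw [← h]
  congr 1
  ext w
  congr 1
  rw [← integral_neg_eq_self]
  simp [real_inner_comm w]

end Euclidean

section Inversion

variable {𝔤 : Type*} [NormedLieRing 𝔤] [NormedLieAlgebra 𝔤] [FiniteDimensional ℝ 𝔤]
  [MeasurableSpace 𝔤] [BorelSpace 𝔤]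

variable (𝔤) in
/-- Linear coordinates on `𝔤`. -/
noncomputable def coordEquiv : EuclideanSpace ℝ (Fin (Module.finrank ℝ 𝔤)) ≃L[ℝ] 𝔤 :=
  ((EuclideanSpace.basisFun (Fin (Module.finrank ℝ 𝔤)) ℝ).toBasis.equiv
    (Module.finBasis ℝ 𝔤) (Equiv.refl _)).toContinuousLinearEquiv

variable (𝔤) in
/-- The dual linear coordinates on `𝔤♯`. -/
noncomputable def dualCoordEquiv :
    EuclideanSpace ℝ (Fin (Module.finrank ℝ 𝔤)) ≃L[ℝ] StrongDual ℝ 𝔤 :=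
  ((EuclideanSpace.basisFun (Fin (Module.finrank ℝ 𝔤)) ℝ).toBasis.equiv
    (dualFinBasis 𝔤) (Equiv.refl _)).toContinuousLinearEquiv

theorem coordEquiv_apply (v : EuclideanSpace ℝ (Fin (Module.finrank ℝ 𝔤))) :
    coordEquiv 𝔤 v = ∑ i, v i • Module.finBasis ℝ 𝔤 i := by
  conv_lhs => rw [← (EuclideanSpace.basisFun _ ℝ).toBasis.sum_repr v, map_sum]
  simp only [map_smul, coordEquiv, LinearEquiv.coe_toContinuousLinearEquiv', Module.Basis.equiv_apply]
  simp

theorem dualCoordEquiv_apply (v : EuclideanSpace ℝ (Fin (Module.finrank ℝ 𝔤))) :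
    dualCoordEquiv 𝔤 v = ∑ i, v i • dualFinBasis 𝔤 i := by
  conv_lhs => rw [← (EuclideanSpace.basisFun _ ℝ).toBasis.sum_repr v, map_sum]
  simp only [map_smul, dualCoordEquiv, LinearEquiv.coe_toContinuousLinearEquiv', Module.Basis.equiv_apply]
  simp

theorem dualCoordEquiv_apply_coordEquiv
    (w v : EuclideanSpace ℝ (Fin (Module.finrank ℝ 𝔤))) :
    dualCoordEquiv 𝔤 w (coordEquiv 𝔤 v) = inner ℝ w v := by
  rw [coordEquiv_apply, dualCoordEquiv_apply, PiLp.inner_apply]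
  simp [dualFinBasis, Finsupp.single_apply]

theorem map_coordEquiv : Measure.map (coordEquiv 𝔤) volume = (Module.finBasis ℝ 𝔤).addHaar := by
  rw [← (EuclideanSpace.basisFun (Fin (Module.finrank ℝ 𝔤)) ℝ).addHaar_eq_volume,
    Module.Basis.map_addHaar]
  congr 1
  ext i
  simp [coordEquiv_apply]

theorem map_dualCoordEquiv :
    Measure.map (dualCoordEquiv 𝔤) volume = (dualFinBasis 𝔤).addHaar := by
  rw [← (EuclideanSpace.basisFun (Fin (Module.finrank ℝ 𝔤)) ℝ).addHaar_eq_volume,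
    Module.Basis.map_addHaar]
  congr 1
  ext i
  simp [dualCoordEquiv_apply]

variable (μ : Measure 𝔤) [μ.IsAddHaarMeasure]

theorem measure_parallelepiped_ne_zero : μ (parallelepiped (Module.finBasis ℝ 𝔤)) ≠ 0 := by
  rw [← Module.Basis.coe_parallelepiped]
  exact (Measure.measure_pos_of_nonempty_interior μ
    (Module.finBasis ℝ 𝔤).parallelepiped.interior_nonempty).ne'

theorem measure_parallelepiped_ne_top : μ (parallelepiped (Module.finBasis ℝ 𝔤)) ≠ ⊤ := by
  rw [← Module.Basis.coe_parallelepiped]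
  exact (Module.finBasis ℝ 𝔤).parallelepiped.isCompact.measure_lt_top.ne

theorem eq_smul_addHaar :
    μ = μ (parallelepiped (Module.finBasis ℝ 𝔤)) • (Module.finBasis ℝ 𝔤).addHaar := by
  have := Measure.addHaarMeasure_unique μ (Module.finBasis ℝ 𝔤).parallelepiped
  rwa [Module.Basis.coe_parallelepiped, ← Module.Basis.addHaar_def] at this

instance : (dualHaar μ).IsAddHaarMeasure := by
  refine Measure.IsAddHaarMeasure.smul _ ?_ ?_
  · rw [ENNReal.inv_ne_zero]
    exact ENNReal.mul_ne_top ENNReal.ofReal_ne_top (measure_parallelepiped_ne_top μ)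
  · rw [ENNReal.inv_ne_top]
    exact mul_ne_zero (by simp; positivity) (measure_parallelepiped_ne_zero μ)

theorem integral_eq_coord (φ : 𝔤 → ℂ) :
    ∫ x, φ x ∂μ = (μ.real (parallelepiped (Module.finBasis ℝ 𝔤)) : ℂ) *
      ∫ v, φ (coordEquiv 𝔤 v) := by
  have h : MeasurableEmbedding (coordEquiv 𝔤) := (coordEquiv 𝔤).toHomeomorph.measurableEmbedding
  conv_lhs => rw [eq_smul_addHaar μ]
  rw [integral_smul_measure, ← map_coordEquiv,
    h.integral_map, Complex.real_smul]
  rfl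

theorem integral_dualHaar_eq_coord (φ : StrongDual ℝ 𝔤 → ℂ) :
    ∫ ξ, φ ξ ∂(dualHaar μ) = ((((2 * Real.pi) ^ Module.finrank ℝ 𝔤 : ℝ) : ℂ)
      * (μ.real (parallelepiped (Module.finBasis ℝ 𝔤)) : ℂ))⁻¹ *
      ∫ v, φ (dualCoordEquiv 𝔤 v) := by
  have h : MeasurableEmbedding (dualCoordEquiv 𝔤) :=
    (dualCoordEquiv 𝔤).toHomeomorph.measurableEmbedding
  rw [dualHaar, integral_smul_measure, ← map_dualCoordEquiv,
    h.integral_map, Complex.real_smul,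
    ENNReal.toReal_inv, ENNReal.toReal_mul, ENNReal.toReal_ofReal (by positivity)]
  push_cast
  rfl

/-- In dual coordinates, `μ` contributes a constant `c` and `dualHaar μ` contributes `((2π)^n c)⁻¹`,
which cancels `c` and the Euclidean factor `(2π)^n`. -/
theorem fourier_inversion {u : 𝔤 → ℂ} (hu : IsSchwartz u) (z : 𝔤) :
    ∫ ξ, cexpI (ξ z) * ∫ y, cexpI (-(ξ y)) * u y ∂μ ∂(dualHaar μ) = u z := by
  obtain ⟨x, rfl⟩ := (coordEquiv 𝔤).surjective z
  have h := fourier_inversion_inner (hu.comp_equiv (coordEquiv 𝔤)) x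
  have hc : (μ.real (parallelepiped (Module.finBasis ℝ 𝔤)) : ℂ) ≠ 0 := by
    rw [Complex.ofReal_ne_zero, measureReal_ne_zero_iff (measure_parallelepiped_ne_top μ)]
    exact measure_parallelepiped_ne_zero μ
  have h2 : (((2 * Real.pi) ^ Module.finrank ℝ 𝔤 : ℝ) : ℂ) ≠ 0 := by
    rw [Complex.ofReal_ne_zero]
    positivity
  rw [finrank_euclideanSpace_fin] at h
  simp only [integral_eq_coord μ, integral_dualHaar_eq_coord, dualCoordEquiv_apply_coordEquiv]
  simp only [mul_left_comm _ (μ.real (parallelepiped (Module.finBasis ℝ 𝔤)) : ℂ)]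
  rw [integral_const_mul, h]
  field_simp

theorem fourier_inversion_dual {f : StrongDual ℝ 𝔤 → ℂ} (hf : IsSchwartz f)
    (ζ : StrongDual ℝ 𝔤) :
    ∫ y, cexpI (-(ζ y)) * ∫ ξ, cexpI (ξ y) * f ξ ∂(dualHaar μ) ∂μ = f ζ := by
  obtain ⟨x, rfl⟩ := (dualCoordEquiv 𝔤).surjective ζ
  have h := fourier_inversion_inner_neg (hf.comp_equiv (dualCoordEquiv 𝔤)) x
  have hc : (μ.real (parallelepiped (Module.finBasis ℝ 𝔤)) : ℂ) ≠ 0 := by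
    rw [Complex.ofReal_ne_zero, measureReal_ne_zero_iff (measure_parallelepiped_ne_top μ)]
    exact measure_parallelepiped_ne_zero μ
  have h2 : (((2 * Real.pi) ^ Module.finrank ℝ 𝔤 : ℝ) : ℂ) ≠ 0 := by
    rw [Complex.ofReal_ne_zero]
    positivity
  rw [finrank_euclideanSpace_fin] at h
  simp only [integral_eq_coord μ, integral_dualHaar_eq_coord, dualCoordEquiv_apply_coordEquiv]
  simp only [mul_left_comm (cexpI _) (((((2 * Real.pi) ^ Module.finrank ℝ 𝔤 : ℝ) : ℂ)
      * (μ.real (parallelepiped (Module.finBasis ℝ 𝔤)) : ℂ))⁻¹)]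
  rw [integral_const_mul, h]
  field_simp

/-- Write `f` by the inversion formula and exchange the integrals; up to a character the integrand
is a product of Schwartz functions of `ξ` and `y`. -/
theorem plancherel_dual {f g : StrongDual ℝ 𝔤 → ℂ} (hf : IsSchwartz f) (hg : IsSchwartz g) :
    ∫ ξ, f ξ * conj (g ξ) ∂(dualHaar μ) =
      ∫ y, (∫ ξ, cexpI (ξ y) * f ξ ∂(dualHaar μ)) *
        conj (∫ ξ, cexpI (ξ y) * g ξ ∂(dualHaar μ)) ∂μ := by
  set F : 𝔤 → ℂ := fun y => ∫ ξ, cexpI (ξ y) * f ξ ∂(dualHaar μ) with hF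
  have hFs : IsSchwartz F := hf.fourier (dualHaar μ)
    (ContinuousLinearMap.id ℝ (StrongDual ℝ 𝔤)) fun l => ⟨l, rfl⟩
  have hint : Integrable (Function.uncurry fun (ξ : StrongDual ℝ 𝔤) y =>
      cexpI (-(ξ y)) * (conj (g ξ) * F y)) ((dualHaar μ).prod μ) := by
    refine ((hg.conj.prod hFs).integrable _).bdd_mul (c := 1) ?_
      (Filter.Eventually.of_forall fun p => (norm_cexpI _).le)
    have := continuous_cexpI
    exact (by fun_prop : Continuous fun p : StrongDual ℝ 𝔤 × 𝔤 =>
      cexpI (-(p.1 p.2))).aestronglyMeasurable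
  have h := integral_integral_swap hint
  calc ∫ ξ, f ξ * conj (g ξ) ∂(dualHaar μ)
      = ∫ ξ, ∫ y, cexpI (-(ξ y)) * (conj (g ξ) * F y) ∂μ ∂(dualHaar μ) := by
        congr 1
        ext ξ
        rw [← fourier_inversion_dual μ hf ξ, ← integral_mul_const]
        congr 1
        ext y
        ring
    _ = _ := by
        rw [h]
        congr 1
        ext y
        rw [← integral_conj, ← integral_const_mul]
        congr 1
        ext ξ
        rw [map_mul, conj_cexpI]
        ring

end Inversion

/-! ### Temperate maps on products and scalar products -/

section Temperate

variable {D E F : Type*} [NormedAddCommGroup D] [NormedSpace ℝ D] [NormedAddCommGroup E]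
  [NormedSpace ℝ E] [NormedAddCommGroup F] [NormedSpace ℝ F]

@[fun_prop]
theorem hasTemperateGrowth_fst {f : D → E × F} (hf : f.HasTemperateGrowth) :
    (fun x => (f x).1).HasTemperateGrowth :=
  (ContinuousLinearMap.fst ℝ E F).hasTemperateGrowth.comp hf

@[fun_prop]
theorem hasTemperateGrowth_snd {f : D → E × F} (hf : f.HasTemperateGrowth) :
    (fun x => (f x).2).HasTemperateGrowth :=
  (ContinuousLinearMap.snd ℝ E F).hasTemperateGrowth.comp hf

@[fun_prop]
theorem hasTemperateGrowth_prodMk {f : D → E} {g : D → F} (hf : f.HasTemperateGrowth)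
    (hg : g.HasTemperateGrowth) : (fun x => (f x, g x)).HasTemperateGrowth := by
  convert ((ContinuousLinearMap.inl ℝ E F).hasTemperateGrowth.comp hf).add
    ((ContinuousLinearMap.inr ℝ E F).hasTemperateGrowth.comp hg) using 1
  ext x <;> simp

@[fun_prop]
theorem hasTemperateGrowth_fun_neg {f : D → E} (hf : f.HasTemperateGrowth) :
    (fun x => -f x).HasTemperateGrowth := hf.neg

theorem hasTemperateGrowth_clm_comp (l : E →L[ℝ] F) {f : D → E} (hf : f.HasTemperateGrowth) :
    (fun x => l (f x)).HasTemperateGrowth := l.hasTemperateGrowth.comp hf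

theorem IsSchwartz.hasTemperateGrowth {F : E → ℂ} (hF : IsSchwartz F) : F.HasTemperateGrowth := by
  obtain ⟨f, rfl⟩ := hF
  exact f.hasTemperateGrowth

theorem IsSchwartz.mul {F G : E → ℂ} (hF : IsSchwartz F) (hG : IsSchwartz G) :
    IsSchwartz fun x => F x * G x := hG.temperate_mul hF.hasTemperateGrowth

theorem IsSchwartz.slice {f : E × F → ℂ} (hf : IsSchwartz f) (x : E) :
    IsSchwartz fun y => f (x, y) :=
  hf.comp (h := Prod.snd) (by fun_prop) (by fun_prop) fun _ => rfl

theorem IsSchwartz.swap {f : E × F → ℂ} (hf : IsSchwartz f) :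
    IsSchwartz fun p : F × E => f (p.2, p.1) :=
  hf.comp (g := fun p : F × E => (p.2, p.1)) (h := fun p => (p.2, p.1)) (by fun_prop)
    (by fun_prop) fun _ => rfl

end Temperate

section Pairing

variable {E F : Type*} [NormedAddCommGroup E] [NormedSpace ℝ E] [FiniteDimensional ℝ E]
  [MeasurableSpace E] [BorelSpace E] [NormedAddCommGroup F] [NormedSpace ℝ F]
  [FiniteDimensional ℝ F] [MeasurableSpace F] [BorelSpace F]
  (m : Measure E) [m.IsAddHaarMeasure] (n : Measure F) [n.IsAddHaarMeasure]

theorem IsSchwartz.integral_prod {f : E × F → ℂ} (hf : IsSchwartz f) :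
    ∫ p, f p ∂(m.prod n) = ∫ x, ∫ y, f (x, y) ∂n ∂m :=
  MeasureTheory.integral_prod _ (hf.integrable _)

theorem IsSchwartz.integral_swap {f : E × F → ℂ} (hf : IsSchwartz f) :
    ∫ x, ∫ y, f (x, y) ∂n ∂m = ∫ y, ∫ x, f (x, y) ∂m ∂n :=
  integral_integral_swap (f := fun x y => f (x, y)) (hf.integrable _)

theorem pairing_prod {f g : E × F → ℂ} (hf : IsSchwartz f) (hg : IsSchwartz g) :
    pairing (m.prod n) f g = ∫ x, ∫ y, f (x, y) * conj (g (x, y)) ∂n ∂m :=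
  (hf.mul hg.conj).integral_prod m n

/-- The scalar product on the Schwartz space is definite. -/
theorem eq_of_forall_pairing_eq {f g : 𝓢(E, ℂ)}
    (h : ∀ k : 𝓢(E, ℂ), pairing m f k = pairing m g k) : f = g := by
  have hfg : IsSchwartz fun x => (f - g) x * conj ((f - g) x) :=
    (f - g).isSchwartz.mul (f - g).isSchwartz.conj
  have h0 : ∫ x, (f - g) x * conj ((f - g) x) ∂m = 0 := by
    have h1 := h (f - g)
    rw [pairing, pairing, ← sub_eq_zero, ← integral_sub
      ((f.isSchwartz.mul (f - g).isSchwartz.conj).integrable m)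
      ((g.isSchwartz.mul (f - g).isSchwartz.conj).integrable m)] at h1
    rw [← h1]
    congr 1
    ext x
    simp only [sub_apply]
    ring
  have h2 : ∫ x, ‖(f - g) x‖ ^ 2 ∂m = 0 := by
    have : ∫ x, ((‖(f - g) x‖ ^ 2 : ℝ) : ℂ) ∂m = 0 := by
      rw [← h0]
      congr 1
      ext x
      rw [Complex.mul_conj']
      push_cast
      rfl
    rw [integral_complex_ofReal] at this
    exact_mod_cast this
  have hc : Continuous fun x => ‖(f - g) x‖ ^ 2 := ((f - g).continuous.norm).pow 2
  have hi : Integrable (fun x => ‖(f - g) x‖ ^ 2) m := by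
    refine (hfg.integrable m).norm.congr (Filter.Eventually.of_forall fun x => ?_)
    simp only [norm_mul, RCLike.norm_conj, sq]
  rw [integral_eq_zero_iff_of_nonneg (fun x => by positivity) hi,
    hc.ae_eq_iff_eq m continuous_zero] at h2
  ext x
  have := congrFun h2 x
  simpa [sub_eq_zero] using this

end Pairing

variable {𝔤 : Type*} [NormedLieRing 𝔤] [NormedLieAlgebra 𝔤] [FiniteDimensional ℝ 𝔤]
  [LieRing.IsNilpotent 𝔤] [MeasurableSpace 𝔤] [BorelSpace 𝔤]

attribute [fun_prop] hasTemperateGrowth_bch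

/-! ### Invariant integration on the group -/

section Substitution

variable (μ : Measure 𝔤) [μ.IsAddHaarMeasure]

theorem continuous_bch_left (X : 𝔤) : Continuous fun Y => X ● Y :=
  (by fun_prop : (fun Y => X ● Y).HasTemperateGrowth).1.continuous

theorem continuous_bch_right (X : 𝔤) : Continuous fun Y => Y ● X :=
  (by fun_prop : (fun Y => Y ● X).HasTemperateGrowth).1.continuous

theorem integral_bch_left (X : 𝔤) (φ : 𝔤 → ℂ) : ∫ Y, φ (X ● Y) ∂μ = ∫ Y, φ Y ∂μ :=
  (measurePreserving_bch_left μ X).integral_comp (Homeomorph.measurableEmbedding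
    ⟨⟨_, fun Y => (-X) ● Y, neg_bch_cancel_left X, bch_neg_cancel_left X⟩,
      continuous_bch_left X, continuous_bch_left (-X)⟩) φ

theorem integral_bch_right (X : 𝔤) (φ : 𝔤 → ℂ) : ∫ Y, φ (Y ● X) ∂μ = ∫ Y, φ Y ∂μ :=
  (measurePreserving_bch_right μ X).integral_comp (Homeomorph.measurableEmbedding
    ⟨⟨_, fun Y => Y ● (-X), fun Y => bch_neg_cancel_right Y X, fun Y => neg_bch_cancel_right Y X⟩,
      continuous_bch_right X, continuous_bch_right (-X)⟩) φ

theorem integral_bch_neg (X : 𝔤) (φ : 𝔤 → ℂ) : ∫ Y, φ (X ● (-Y)) ∂μ = ∫ Y, φ Y ∂μ :=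
  (integral_neg_eq_self (fun Y => φ (X ● Y)) μ).trans (integral_bch_left μ X φ)

theorem integral_neg_bch (X : 𝔤) (φ : 𝔤 → ℂ) : ∫ Y, φ ((-Y) ● X) ∂μ = ∫ Y, φ Y ∂μ :=
  (integral_neg_eq_self (fun Y => φ (Y ● X)) μ).trans (integral_bch_right μ X φ)

end Substitution

/-! ### Symbols and integral kernels -/

section Kernel

variable (μ : Measure 𝔤)

/-- The integral kernel of `Op f`. -/
noncomputable def opKernel (f : Phase 𝔤 → ℂ) (p : 𝔤 × 𝔤) : ℂ :=
  ∫ ξ : StrongDual ℝ 𝔤, cexpI (ξ (p.1 ● (-p.2))) * f (p.1, ξ) ∂(dualHaar μ)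

/-- The symbol of the operator with integral kernel `k`. -/
noncomputable def symbol (k : 𝔤 × 𝔤 → ℂ) (p : Phase 𝔤) : ℂ :=
  ∫ Z, cexpI (-(p.2 Z)) * k (p.1, (-Z) ● p.1) ∂μ

theorem Op_eq (f : Phase 𝔤 → ℂ) (u : 𝔤 → ℂ) (X : 𝔤) :
    Op μ f u X = ∫ Y, opKernel μ f (X, Y) * u Y ∂μ := by
  simp only [Op, opKernel, ← integral_mul_const]

theorem sharpFun_eq (f g : Phase 𝔤 → ℂ) : sharpFun μ f g =
    symbol μ fun p => ∫ Z, opKernel μ f (p.1, Z) * opKernel μ g (Z, p.2) ∂μ := by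
  ext ⟨X, ξ⟩
  simp only [sharpFun, symbol, opKernel]
  congr 1
  ext Y
  rw [← integral_const_mul]
  congr 1
  ext Z
  rw [← integral_mul_const, ← integral_const_mul]
  congr 1
  ext η
  rw [← integral_const_mul, ← integral_const_mul]
  congr 1
  ext ζ
  rw [neg_bch, neg_neg, bch_assoc]
  ring

theorem adjFun_eq (f : Phase 𝔤 → ℂ) :
    adjFun μ f = symbol μ fun p => conj (opKernel μ f (p.2, p.1)) := by
  ext ⟨X, ξ⟩
  simp only [adjFun, symbol, opKernel]
  congr 1
  ext Y
  rw [← integral_conj, ← integral_const_mul]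
  congr 1
  ext η
  rw [map_mul, conj_cexpI, bch_neg_cancel_right, ← mul_assoc, ← cexpI_add]
  congr 2
  simp
  ring

variable [μ.IsAddHaarMeasure]

theorem isSchwartz_partialFourier_dual {E : Type*} [NormedAddCommGroup E] [NormedSpace ℝ E]
    [FiniteDimensional ℝ E] {f : E × StrongDual ℝ 𝔤 → ℂ} (hf : IsSchwartz f) :
    IsSchwartz fun p : E × 𝔤 => ∫ ξ, cexpI (ξ p.2) * f (p.1, ξ) ∂(dualHaar μ) :=
  hf.partialFourier (dualHaar μ) (ContinuousLinearMap.id ℝ (StrongDual ℝ 𝔤)) fun l => ⟨l, rfl⟩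

theorem isSchwartz_partialFourier_neg {E : Type*} [NormedAddCommGroup E] [NormedSpace ℝ E]
    [FiniteDimensional ℝ E] {f : E × 𝔤 → ℂ} (hf : IsSchwartz f) :
    IsSchwartz fun p : E × StrongDual ℝ 𝔤 => ∫ Z, cexpI (-(p.2 Z)) * f (p.1, Z) ∂μ :=
  hf.partialFourier μ (-ContinuousLinearMap.apply ℝ ℝ : 𝔤 →L[ℝ] StrongDual ℝ 𝔤 →L[ℝ] ℝ)
    fun l => by
      obtain ⟨y, hy⟩ := exists_apply_eq (-l)
      exact ⟨y, ContinuousLinearMap.ext fun ξ => by simp [hy]⟩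

variable {μ}

/-- A partial Fourier transform followed by `(X, Y) ↦ (X, X ● (-Y))`, a polynomial bijection with
polynomial inverse. -/
theorem IsSchwartz.opKernel {f : Phase 𝔤 → ℂ} (hf : IsSchwartz f) : IsSchwartz (opKernel μ f) :=
  (isSchwartz_partialFourier_dual μ hf).comp (g := fun p : 𝔤 × 𝔤 => (p.1, p.1 ● (-p.2)))
    (h := fun p => (p.1, (-p.2) ● p.1)) (by fun_prop) (by fun_prop)
    fun p => by simp [neg_bch, neg_bch_cancel_right]

theorem IsSchwartz.comp_neg_bch {k : 𝔤 × 𝔤 → ℂ} (hk : IsSchwartz k) :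
    IsSchwartz fun p : 𝔤 × 𝔤 => k (p.1, (-p.2) ● p.1) :=
  hk.comp (g := fun p : 𝔤 × 𝔤 => (p.1, (-p.2) ● p.1))
    (h := fun p => (p.1, p.1 ● (-p.2))) (by fun_prop) (by fun_prop)
    fun p => by simp [neg_bch, bch_neg_cancel_left]

theorem IsSchwartz.symbol {k : 𝔤 × 𝔤 → ℂ} (hk : IsSchwartz k) : IsSchwartz (symbol μ k) :=
  isSchwartz_partialFourier_neg μ hk.comp_neg_bch

theorem opKernel_symbol {k : 𝔤 × 𝔤 → ℂ} (hk : IsSchwartz k) : opKernel μ (symbol μ k) = k := by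
  ext ⟨X, Y⟩
  have := fourier_inversion μ (hk.comp_neg_bch.slice X) (X ● (-Y))
  simpa [opKernel, symbol, neg_bch, neg_bch_cancel_right] using this

theorem symbol_opKernel {f : Phase 𝔤 → ℂ} (hf : IsSchwartz f) :
    symbol μ (opKernel μ f) = f := by
  ext ⟨X, ξ⟩
  have := fourier_inversion_dual μ (hf.slice X) ξ
  simpa [opKernel, symbol, neg_bch, bch_neg_cancel_left] using this

/-- Plancherel in `ξ` for each `X`, then the substitution `Y ↦ X ● (-Y)`, which preserves the
measure. Symbols are thus paired like Hilbert-Schmidt kernels. -/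
theorem pairing_opKernel {f g : Phase 𝔤 → ℂ} (hf : IsSchwartz f) (hg : IsSchwartz g) :
    pairing (phaseMeasure μ) f g =
      ∫ X, ∫ Y, opKernel μ f (X, Y) * conj (opKernel μ g (X, Y)) ∂μ ∂μ := by
  rw [phaseMeasure, pairing_prod _ _ hf hg]
  congr 1
  ext X
  rw [plancherel_dual μ (hf.slice X) (hg.slice X), ← integral_bch_neg μ X]
  rfl

end Kernel

/-! ### The symbol algebra and phase-space shifts in terms of kernels -/

section SymbolAlgebra

variable {𝔤 : Type*} [NormedLieRing 𝔤] [NormedLieAlgebra 𝔤] [FiniteDimensional ℝ 𝔤]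
  [LieRing.IsNilpotent 𝔤] [MeasurableSpace 𝔤] [BorelSpace 𝔤] {μ : Measure 𝔤}
  [μ.IsAddHaarMeasure]

instance : (phaseMeasure μ).IsAddHaarMeasure :=
  inferInstanceAs (μ.prod (dualHaar μ)).IsAddHaarMeasure

theorem isSchwartz_kernelComp_integrand {k l : 𝔤 × 𝔤 → ℂ} (hk : IsSchwartz k)
    (hl : IsSchwartz l) :
    IsSchwartz fun p : (𝔤 × 𝔤) × 𝔤 => k (p.1.1, p.2) * l (p.2, p.1.2) :=
  (hk.chain hl).comp (g := fun p : (𝔤 × 𝔤) × 𝔤 => (p.1.1, p.2, p.1.2))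
    (h := fun q => ((q.1, q.2.2), q.2.1)) (by fun_prop) (by fun_prop) fun _ => rfl

theorem IsSchwartz.kernelComp {k l : 𝔤 × 𝔤 → ℂ} (hk : IsSchwartz k) (hl : IsSchwartz l) :
    IsSchwartz fun p : 𝔤 × 𝔤 => ∫ Z, k (p.1, Z) * l (Z, p.2) ∂μ :=
  (isSchwartz_kernelComp_integrand hk hl).integral_snd μ

theorem opKernel_sharp (f g : 𝓢(Phase 𝔤, ℂ)) : opKernel μ (sharp μ f g) =
    fun p => ∫ Z, opKernel μ f (p.1, Z) * opKernel μ g (Z, p.2) ∂μ := by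
  have h := (f.isSchwartz.opKernel (μ := μ)).kernelComp (μ := μ) (g.isSchwartz.opKernel (μ := μ))
  rw [sharp, sharpFun_eq, h.symbol.coe_toSchwartz, opKernel_symbol h]

theorem coe_adj (f : 𝓢(Phase 𝔤, ℂ)) :
    ⇑(adj μ f) = symbol μ fun p => conj (opKernel μ f (p.2, p.1)) := by
  rw [adj, adjFun_eq, (f.isSchwartz.opKernel.swap.conj).symbol.coe_toSchwartz]

theorem opKernel_adj (f : 𝓢(Phase 𝔤, ℂ)) :
    opKernel μ (adj μ f) = fun p => conj (opKernel μ f (p.2, p.1)) := by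
  rw [coe_adj, opKernel_symbol f.isSchwartz.opKernel.swap.conj]

theorem adj_adj (f : 𝓢(Phase 𝔤, ℂ)) : adj μ (adj μ f) = f := by
  refine DFunLike.coe_injective ?_
  rw [coe_adj, opKernel_adj]
  simp only [Complex.conj_conj]
  exact symbol_opKernel f.isSchwartz

/-- Formally `Op ε_𝒵` is the Weyl operator `weyl 𝒵`, whose kernel is concentrated on the graph `Y =
(-𝒵.1) ● X`; this is the weak form of that statement. -/
theorem pairing_expFun (𝒵 : Phase 𝔤) {q : Phase 𝔤 → ℂ} (hq : IsSchwartz q) :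
    pairing (phaseMeasure μ) (expFun 𝒵) q =
      ∫ X, cexpI (𝒵.2 X) * conj (opKernel μ q (X, (-𝒵.1) ● X)) ∂μ := by
  have hint : Integrable (fun p => expFun 𝒵 p * conj (q p)) (μ.prod (dualHaar μ)) := by
    refine (hq.conj.integrable _).bdd_mul (c := 1) ?_
      (Filter.Eventually.of_forall fun p => by simp [expFun, norm_cexpI])
    have := continuous_cexpI
    unfold expFun
    exact (by fun_prop : Continuous _).aestronglyMeasurable
  rw [pairing, phaseMeasure, integral_prod _ hint]
  congr 1
  ext X
  simp only [expFun, opKernel, mul_assoc, neg_bch, neg_neg, bch_neg_cancel_left]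
  rw [integral_const_mul, ← integral_conj]
  simp only [map_mul, conj_cexpI]

/-- The product `ε_𝒴^# # h`. -/
noncomputable def leftShift (μ : Measure 𝔤) (𝒴 : Phase 𝔤) (h : 𝓢(Phase 𝔤, ℂ)) :
    𝓢(Phase 𝔤, ℂ) :=
  toSchwartz (symbol μ fun p => cexpI (-(𝒴.2 (𝒴.1 ● p.1))) * opKernel μ h (𝒴.1 ● p.1, p.2))

/-- The product `h # ε_𝒵`. -/
noncomputable def rightShift (μ : Measure 𝔤) (𝒵 : Phase 𝔤) (h : 𝓢(Phase 𝔤, ℂ)) :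
    𝓢(Phase 𝔤, ℂ) :=
  toSchwartz (symbol μ fun p => cexpI (𝒵.2 (𝒵.1 ● p.2)) * opKernel μ h (p.1, 𝒵.1 ● p.2))

/-- This is the kernel of the adjoint Weyl operator followed after `Op h`; it is Schwartz because
translation in the first variable is invertible with temperate inverse. -/
theorem opKernel_leftShift (𝒴 : Phase 𝔤) (h : 𝓢(Phase 𝔤, ℂ)) :
    opKernel μ (leftShift μ 𝒴 h) =
      fun p => cexpI (-(𝒴.2 (𝒴.1 ● p.1))) * opKernel μ h (𝒴.1 ● p.1, p.2) := by
  have h1 : IsSchwartz fun p : 𝔤 × 𝔤 =>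
      cexpI (-(𝒴.2 (𝒴.1 ● p.1))) * opKernel μ h (𝒴.1 ● p.1, p.2) := by
    refine IsSchwartz.temperate_mul (hasTemperateGrowth_cexpI_comp
      (hasTemperateGrowth_clm_comp 𝒴.2 (by fun_prop)).neg) ?_
    exact h.isSchwartz.opKernel.comp (g := fun p : 𝔤 × 𝔤 => (𝒴.1 ● p.1, p.2))
      (h := fun p => ((-𝒴.1) ● p.1, p.2)) (by fun_prop) (by fun_prop)
      fun p => by simp [neg_bch_cancel_left]
  rw [leftShift, h1.symbol.coe_toSchwartz, opKernel_symbol h1]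

theorem opKernel_rightShift (𝒵 : Phase 𝔤) (h : 𝓢(Phase 𝔤, ℂ)) :
    opKernel μ (rightShift μ 𝒵 h) =
      fun p => cexpI (𝒵.2 (𝒵.1 ● p.2)) * opKernel μ h (p.1, 𝒵.1 ● p.2) := by
  have h1 : IsSchwartz fun p : 𝔤 × 𝔤 =>
      cexpI (𝒵.2 (𝒵.1 ● p.2)) * opKernel μ h (p.1, 𝒵.1 ● p.2) := by
    refine IsSchwartz.temperate_mul (hasTemperateGrowth_cexpI_comp
      (hasTemperateGrowth_clm_comp 𝒵.2 (by fun_prop))) ?_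
    exact h.isSchwartz.opKernel.comp (g := fun p : 𝔤 × 𝔤 => (p.1, 𝒵.1 ● p.2))
      (h := fun p => (p.1, (-𝒵.1) ● p.2)) (by fun_prop) (by fun_prop)
      fun p => by simp [neg_bch_cancel_left]
  rw [rightShift, h1.symbol.coe_toSchwartz, opKernel_symbol h1]

/-- The choice is harmless, as a Schwartz function is determined by its pairings. -/
theorem Dist.toSchwartz_ofFun (s : 𝓢(Phase 𝔤, ℂ)) : Dist.toSchwartz μ (ofFun μ s) = s := by
  have h : ∃ t : 𝓢(Phase 𝔤, ℂ), ofFun μ s = ofFun μ t := ⟨s, rfl⟩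
  rw [Dist.toSchwartz, dif_pos h]
  exact eq_of_forall_pairing_eq (phaseMeasure μ) fun k => (congrFun h.choose_spec k).symm

/-- Unfolding the duality leaves the pairing of `ε_𝒴` with a composed kernel. The translation `X ↦
𝒴.1 ● X` brings it to the form of a pairing with the shifted kernel. -/
theorem distSharp_expFun (𝒴 : Phase 𝔤) (h : 𝓢(Phase 𝔤, ℂ)) :
    distSharp μ (distAdj μ (ofFun μ (expFun 𝒴))) h = ofFun μ (leftShift μ 𝒴 h) := by
  ext g
  rw [distSharp, distAdj, ofFun, ofFun, pairing_expFun _ (SchwartzMap.isSchwartz _),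
    pairing_opKernel (SchwartzMap.isSchwartz _) (SchwartzMap.isSchwartz _), opKernel_leftShift,
    opKernel_adj, opKernel_sharp, opKernel_adj, ← integral_conj,
    ← integral_bch_left μ 𝒴.1]
  congr 1
  ext X
  simp only [map_mul, Complex.conj_conj, conj_cexpI, neg_bch_cancel_left]
  rw [← integral_conj, ← integral_const_mul]
  congr 1
  ext Z
  simp only [map_mul, Complex.conj_conj]
  ring

theorem sharpDist_expFun (𝒵 : Phase 𝔤) (h : 𝓢(Phase 𝔤, ℂ)) :
    sharpDist μ h (distAdj μ (distAdj μ (ofFun μ (expFun 𝒵)))) = ofFun μ (rightShift μ 𝒵 h) := by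
  ext g
  have hsw : IsSchwartz fun p : 𝔤 × 𝔤 =>
      opKernel μ (rightShift μ 𝒵 h) p * conj (opKernel μ g p) :=
    (rightShift μ 𝒵 h).isSchwartz.opKernel.mul g.isSchwartz.opKernel.conj
  rw [sharpDist, distAdj, distAdj, Complex.conj_conj, adj_adj, ofFun, ofFun,
    pairing_expFun _ (SchwartzMap.isSchwartz _),
    pairing_opKernel (SchwartzMap.isSchwartz _) (SchwartzMap.isSchwartz _),
    hsw.integral_swap μ μ, opKernel_rightShift, opKernel_sharp, opKernel_adj,
    ← integral_bch_left μ 𝒵.1]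
  congr 1
  ext X
  rw [← integral_conj, ← integral_const_mul]
  congr 1
  ext Z
  simp only [map_mul, Complex.conj_conj, neg_bch_cancel_left]
  ring

/-- Both shifts are moved to the window by duality, then back to the kernel of `f` by translating
the variables. -/
theorem symbolTransform_ofFun (h f : 𝓢(Phase 𝔤, ℂ)) (𝒴 𝒵 : Phase 𝔤) :
    symbolTransform μ h (ofFun μ f) (𝒴, 𝒵) =
      ∫ X, ∫ W, opKernel μ f ((-𝒴.1) ● X, (-𝒵.1) ● W) * cexpI (𝒴.2 X) * cexpI (-(𝒵.2 W)) *
        conj (opKernel μ h (X, W)) ∂μ ∂μ := by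
  rw [symbolTransform, phaseShift, distSharpMoyal, sharpDist_expFun, Dist.toSchwartz_ofFun,
    moyalSharpDist, distSharp_expFun, Dist.toSchwartz_ofFun, ofFun,
    pairing_opKernel (SchwartzMap.isSchwartz _) (SchwartzMap.isSchwartz _), opKernel_leftShift,
    opKernel_rightShift, ← integral_bch_left μ (-𝒴.1)]
  congr 1
  ext X
  rw [← integral_bch_left μ (-𝒵.1)]
  congr 1
  ext W
  simp only [map_mul, conj_cexpI, neg_neg, bch_neg_cancel_left]
  ring

end SymbolAlgebra

/-! ### Wigner transforms, orthogonality relations and the coorbit bound -/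

section CoorbitNorms

variable {𝔤 : Type*} [NormedLieRing 𝔤] [NormedLieAlgebra 𝔤] [FiniteDimensional ℝ 𝔤]
  [LieRing.IsNilpotent 𝔤] [MeasurableSpace 𝔤] [BorelSpace 𝔤] {μ : Measure 𝔤}
  [μ.IsAddHaarMeasure]

theorem isSchwartz_translate_mul_conj {u v : 𝔤 → ℂ} (hu : IsSchwartz u) (hv : IsSchwartz v) :
    IsSchwartz fun p : 𝔤 × 𝔤 => u ((-p.1) ● p.2) * conj (v p.2) :=
  (hu.prod hv.conj).comp (g := fun p : 𝔤 × 𝔤 => ((-p.1) ● p.2, p.2))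
    (h := fun q => (q.2 ● (-q.1), q.2)) (by fun_prop) (by fun_prop)
    fun p => by simp [neg_bch, bch_neg_cancel_left]

theorem conj_fourierWigner (u v : 𝔤 → ℂ) (𝒵 : Phase 𝔤) : conj (fourierWigner μ u v 𝒵) =
    ∫ X, cexpI (-(𝒵.2 X)) * conj (u ((-𝒵.1) ● X) * conj (v X)) ∂μ := by
  rw [fourierWigner, pairing, ← integral_conj]
  congr 1
  ext X
  simp only [weyl, map_mul, conj_cexpI, mul_assoc]

theorem isSchwartz_conj_fourierWigner {u v : 𝔤 → ℂ} (hu : IsSchwartz u) (hv : IsSchwartz v) :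
    IsSchwartz fun 𝒵 => conj (fourierWigner μ u v 𝒵) := by
  have h := isSchwartz_partialFourier_neg μ (isSchwartz_translate_mul_conj hu hv).conj
  simpa only [conj_fourierWigner] using h

theorem IsSchwartz.fourierWigner {u v : 𝔤 → ℂ} (hu : IsSchwartz u) (hv : IsSchwartz v) :
    IsSchwartz (fourierWigner μ u v) := by
  simpa only [Complex.conj_conj] using (isSchwartz_conj_fourierWigner (μ := μ) hu hv).conj

/-- The integral over `η` inverts the Fourier transform hidden in `ℰ_{u,v}`. What is left is the
symbol of the rank-one operator with kernel `v(X) ū(Y)`. -/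
theorem wigner_eq {u v : 𝔤 → ℂ} (hu : IsSchwartz u) (hv : IsSchwartz v) :
    wigner μ u v = symbol μ fun p => conj (u p.2) * v p.1 := by
  ext ⟨X, ξ⟩
  have hF := isSchwartz_conj_fourierWigner (μ := μ) hu hv
  have hint : Integrable (fun 𝒴 : Phase 𝔤 => cexpI (-(ξ 𝒴.1)) * cexpI (𝒴.2 X) *
      conj (fourierWigner μ u v 𝒴)) (μ.prod (dualHaar μ)) := by
    refine (hF.integrable _).bdd_mul (c := 1) ?_
      (Filter.Eventually.of_forall fun p => by simp [norm_cexpI])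
    have := continuous_cexpI
    exact (by fun_prop : Continuous _).aestronglyMeasurable
  rw [wigner, totalFourier, phaseMeasure, integral_prod _ hint, symbol]
  congr 1
  ext Y
  simp only [mul_assoc]
  rw [integral_const_mul]
  simp only [conj_fourierWigner]
  rw [fourier_inversion μ ((isSchwartz_translate_mul_conj hu hv).conj.slice Y) X]
  simp only [map_mul, Complex.conj_conj]

theorem isSchwartz_conj_mul {u v : 𝔤 → ℂ} (hu : IsSchwartz u) (hv : IsSchwartz v) :
    IsSchwartz fun p : 𝔤 × 𝔤 => conj (u p.2) * v p.1 := by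
  simpa only [mul_comm] using hv.prod hu.conj

theorem IsSchwartz.wigner {u v : 𝔤 → ℂ} (hu : IsSchwartz u) (hv : IsSchwartz v) :
    IsSchwartz (wigner μ u v) := by
  rw [wigner_eq hu hv]
  exact (isSchwartz_conj_mul hu hv).symbol

theorem opKernel_wigner {u v : 𝔤 → ℂ} (hu : IsSchwartz u) (hv : IsSchwartz v) :
    opKernel μ (wigner μ u v) = fun p => conj (u p.2) * v p.1 := by
  rw [wigner_eq hu hv, opKernel_symbol (isSchwartz_conj_mul hu hv)]

theorem pairing_Op {f : Phase 𝔤 → ℂ} {u v : 𝔤 → ℂ} (hf : IsSchwartz f) (hu : IsSchwartz u)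
    (hv : IsSchwartz v) :
    pairing μ (Op μ f u) v = pairing (phaseMeasure μ) f (wigner μ u v) := by
  rw [pairing_opKernel hf (hu.wigner hv), opKernel_wigner hu hv, pairing]
  congr 1
  ext X
  rw [Op_eq, ← integral_mul_const]
  congr 1
  ext Y
  simp only [map_mul, Complex.conj_conj]
  ring

theorem IsSchwartz.op {f : Phase 𝔤 → ℂ} {u : 𝔤 → ℂ} (hf : IsSchwartz f) (hu : IsSchwartz u) :
    IsSchwartz (Op μ f u) := by
  have h := (hf.opKernel (μ := μ)).temperate_mul (G := fun p : 𝔤 × 𝔤 => u p.2)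
    (hu.hasTemperateGrowth.comp (hasTemperateGrowth_snd (f := fun p : 𝔤 × 𝔤 => p) (by fun_prop)))
  convert h.integral_snd μ using 1
  ext X
  simp only [Op_eq, mul_comm (u _)]

/-- The orthogonality relations. -/
theorem pairing_fourierWigner {u v w : 𝔤 → ℂ} (hu : IsSchwartz u) (hv : IsSchwartz v)
    (hw : IsSchwartz w) :
    pairing (phaseMeasure μ) (fourierWigner μ u w) (fourierWigner μ v w) =
      pairing μ u v * pairing μ w w := by
  have hku := isSchwartz_translate_mul_conj hu hw
  have hkv := isSchwartz_translate_mul_conj hv hw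
  have hint := hku.mul hkv.conj
  calc pairing (phaseMeasure μ) (fourierWigner μ u w) (fourierWigner μ v w)
      = ∫ Z, ∫ X, (u ((-Z) ● X) * conj (w X)) * conj (v ((-Z) ● X) * conj (w X)) ∂μ ∂μ := by
        rw [phaseMeasure, pairing_prod _ _ (hu.fourierWigner hw) (hv.fourierWigner hw)]
        congr 1
        ext Z
        -- For fixed `Z`, Plancherel in the frequency variable undoes both Fourier transforms.
        have h := plancherel_dual μ ((isSchwartz_conj_fourierWigner (μ := μ) hv hw).slice Z)
          ((isSchwartz_conj_fourierWigner (μ := μ) hu hw).slice Z)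
        simp only [Complex.conj_conj] at h
        simp only [mul_comm (fourierWigner μ u w _)]
        rw [h]
        simp only [conj_fourierWigner]
        congr 1
        ext X
        rw [fourier_inversion μ (hku.conj.slice Z) X, fourier_inversion μ (hkv.conj.slice Z) X,
          Complex.conj_conj, mul_comm]
    _ = ∫ X, ∫ Z, (u ((-Z) ● X) * conj (w X)) * conj (v ((-Z) ● X) * conj (w X)) ∂μ ∂μ :=
        hint.integral_swap μ μ
    _ = ∫ X, pairing μ u v * (w X * conj (w X)) ∂μ := by
        congr 1
        ext X
        -- For fixed `X`, the substitution `Z ↦ (-Z) ● X` separates the variables.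
        rw [pairing, ← integral_neg_bch μ X (fun Y => u Y * conj (v Y)), ← integral_mul_const]
        congr 1
        ext Z
        simp only [map_mul, Complex.conj_conj]
        ring
    _ = _ := integral_const_mul _ _

theorem pairing_self_of_eLpNorm {w : 𝓢(𝔤, ℂ)} (hw : eLpNorm w 2 μ = 1) : pairing μ w w = 1 := by
  have h := (w.memLp 2 μ).eLpNorm_eq_integral_rpow_norm (by norm_num) (by norm_num)
  rw [hw, eq_comm, ENNReal.ofReal_eq_one] at h
  have h0 : 0 ≤ ∫ X, ‖w X‖ ^ (2 : ENNReal).toReal ∂μ :=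
    integral_nonneg fun X => by positivity
  rw [Real.rpow_inv_eq h0 zero_le_one (by norm_num), Real.one_rpow] at h
  have h1 : pairing μ w w = ((∫ X, ‖w X‖ ^ (2 : ENNReal).toReal ∂μ : ℝ) : ℂ) := by
    rw [pairing, ← integral_complex_ofReal]
    congr 1
    ext X
    rw [Complex.mul_conj']
    simp
  rw [h1, h, Complex.ofReal_one]

/-- The kernel of `Op f` in the Weyl-Heisenberg frames of two windows. -/
theorem symbolTransform_wigner (f : 𝓢(Phase 𝔤, ℂ)) (w₁ w₂ : 𝓢(𝔤, ℂ)) (𝒴 𝒵 : Phase 𝔤) :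
    symbolTransform μ (wignerS μ w₁ w₂) (ofFun μ f) (𝒴, 𝒵) =
      ∫ X, ∫ W, cexpI (𝒴.2 X - 𝒵.2 W) * (opKernel μ f ((-𝒴.1) ● X, (-𝒵.1) ● W) *
        (conj (w₂ X) * w₁ W)) ∂μ ∂μ := by
  rw [symbolTransform_ofFun, wignerS, (w₁.isSchwartz.wigner w₂.isSchwartz).coe_toSchwartz,
    opKernel_wigner w₁.isSchwartz w₂.isSchwartz]
  congr 1
  ext X
  congr 1
  ext W
  rw [sub_eq_add_neg, cexpI_add]
  simp only [map_mul, Complex.conj_conj]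
  ring

variable (𝔤) in
/-- The duality between `𝔤 × 𝔤` and `𝔤♯ × 𝔤♯` given by `⟨X|η⟩ - ⟨W|ζ⟩`. -/
noncomputable def pairForm : (𝔤 × 𝔤) →L[ℝ] (StrongDual ℝ 𝔤 × StrongDual ℝ 𝔤) →L[ℝ] ℝ :=
  (ContinuousLinearMap.apply ℝ ℝ : 𝔤 →L[ℝ] StrongDual ℝ 𝔤 →L[ℝ] ℝ).bilinearComp
      (ContinuousLinearMap.fst ℝ 𝔤 𝔤) (ContinuousLinearMap.fst ℝ _ _) -
    (ContinuousLinearMap.apply ℝ ℝ : 𝔤 →L[ℝ] StrongDual ℝ 𝔤 →L[ℝ] ℝ).bilinearComp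
      (ContinuousLinearMap.snd ℝ 𝔤 𝔤) (ContinuousLinearMap.snd ℝ _ _)

theorem pairForm_apply (p : 𝔤 × 𝔤) (q : StrongDual ℝ 𝔤 × StrongDual ℝ 𝔤) :
    pairForm 𝔤 p q = q.1 p.1 - q.2 p.2 := rfl

theorem exists_pairForm_eq (l : (StrongDual ℝ 𝔤 × StrongDual ℝ 𝔤) →L[ℝ] ℝ) :
    ∃ p, pairForm 𝔤 p = l := by
  obtain ⟨X, hX⟩ := exists_apply_eq (l.comp (ContinuousLinearMap.inl ℝ _ _))
  obtain ⟨W, hW⟩ := exists_apply_eq (-(l.comp (ContinuousLinearMap.inr ℝ _ _)))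
  refine ⟨(X, W), ContinuousLinearMap.ext fun q => ?_⟩
  rw [pairForm_apply, hX, hW]
  simp [← map_add]

theorem isSchwartz_translated_opKernel (f : 𝓢(Phase 𝔤, ℂ)) (w₁ w₂ : 𝓢(𝔤, ℂ)) :
    IsSchwartz fun p : (𝔤 × 𝔤) × (𝔤 × 𝔤) =>
      opKernel μ f ((-p.1.1) ● p.2.1, (-p.1.2) ● p.2.2) * (conj (w₂ p.2.1) * w₁ p.2.2) :=
  ((f.isSchwartz.opKernel (μ := μ)).prod (w₂.isSchwartz.conj.prod w₁.isSchwartz)).comp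
    (g := fun p : (𝔤 × 𝔤) × (𝔤 × 𝔤) => (((-p.1.1) ● p.2.1, (-p.1.2) ● p.2.2), p.2))
    (h := fun q => ((q.2.1 ● (-q.1.1), q.2.2 ● (-q.1.2)), q.2)) (by fun_prop) (by fun_prop)
    fun p => by simp [neg_bch, bch_neg_cancel_left]

theorem isSchwartz_symbolTransform_integrand (f : 𝓢(Phase 𝔤, ℂ)) (w₁ w₂ : 𝓢(𝔤, ℂ))
    (𝒴 𝒵 : Phase 𝔤) : IsSchwartz fun p : 𝔤 × 𝔤 => cexpI (𝒴.2 p.1 - 𝒵.2 p.2) *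
      (opKernel μ f ((-𝒴.1) ● p.1, (-𝒵.1) ● p.2) * (conj (w₂ p.1) * w₁ p.2)) :=
  ((isSchwartz_translated_opKernel f w₁ w₂).slice (𝒴.1, 𝒵.1)).temperate_mul
    (hasTemperateGrowth_cexpI_comp (hasTemperateGrowth_clm_comp
      ((pairForm 𝔤).flip (𝒴.2, 𝒵.2)) (f := fun p => p) (by fun_prop)))

/-- A partial Fourier transform in `(X, W)` of a function that is Schwartz jointly in `(X, W)` and
the translation parameters. -/
theorem isSchwartz_symbolTransform (f : 𝓢(Phase 𝔤, ℂ)) (w₁ w₂ : 𝓢(𝔤, ℂ)) :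
    IsSchwartz (symbolTransform μ (wignerS μ w₁ w₂) (ofFun μ f)) := by
  have h := ((isSchwartz_translated_opKernel (μ := μ) f w₁ w₂).partialFourier (μ.prod μ)
    (pairForm 𝔤) exists_pairForm_eq).comp
    (g := fun p : Phase 𝔤 × Phase 𝔤 => ((p.1.1, p.2.1), (p.1.2, p.2.2)))
    (h := fun q => ((q.1.1, q.2.1), (q.1.2, q.2.2))) (by fun_prop) (by fun_prop) fun _ => rfl
  convert h using 1
  ext ⟨𝒴, 𝒵⟩
  rw [symbolTransform_wigner, partialFourier]
  exact ((isSchwartz_symbolTransform_integrand (μ := μ) f w₁ w₂ 𝒴 𝒵).integral_prod μ μ).symm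

theorem fourierWigner_op (f : 𝓢(Phase 𝔤, ℂ)) (u w₁ w₂ : 𝓢(𝔤, ℂ)) (hw₁ : eLpNorm w₁ 2 μ = 1) :
    fourierWigner μ (Op μ f u) w₂ =
      intOp μ (symbolTransform μ (wignerS μ w₁ w₂) (ofFun μ f)) (fourierWigner μ u w₁) := by
  ext 𝒴
  have h1 : IsSchwartz fun p : 𝔤 × 𝔤 =>
      opKernel μ f ((-𝒴.1) ● p.2, p.1) * (cexpI (𝒴.2 p.2) * conj (w₂ p.2)) := by
    have hk : IsSchwartz fun p : 𝔤 × 𝔤 => opKernel μ f ((-𝒴.1) ● p.2, p.1) :=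
      (f.isSchwartz.opKernel (μ := μ)).comp (g := fun p : 𝔤 × 𝔤 => ((-𝒴.1) ● p.2, p.1))
        (h := fun q => (q.2, 𝒴.1 ● q.1)) (by fun_prop) (by fun_prop)
        fun p => by simp [bch_neg_cancel_left]
    have ht : (fun p : 𝔤 × 𝔤 => cexpI (𝒴.2 p.2) * conj (w₂ p.2)).HasTemperateGrowth :=
      (hasTemperateGrowth_cexpI_comp (hasTemperateGrowth_clm_comp 𝒴.2 (by fun_prop))).mul
        (w₂.isSchwartz.conj.hasTemperateGrowth.comp (hasTemperateGrowth_snd (by fun_prop)))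
    simpa only [mul_comm] using hk.temperate_mul ht
  -- The conjugate of `A` is `(E(𝒴) Op(f))^* w₂`.
  set A : 𝔤 → ℂ := fun W =>
    ∫ X, opKernel μ f ((-𝒴.1) ● X, W) * (cexpI (𝒴.2 X) * conj (w₂ X)) ∂μ with hA
  have hAs : IsSchwartz A := h1.integral_snd μ
  have hΨ : ∀ 𝒵, symbolTransform μ (wignerS μ w₁ w₂) (ofFun μ f) (𝒴, 𝒵) =
      conj (fourierWigner μ (fun W => conj (A W)) w₁ 𝒵) := by
    intro 𝒵
    rw [symbolTransform_wigner, (isSchwartz_symbolTransform_integrand (μ := μ) f w₁ w₂ 𝒴 𝒵).integral_swap μ μ,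
      conj_fourierWigner]
    congr 1
    ext W
    simp only [map_mul, Complex.conj_conj, hA]
    rw [← integral_mul_const, ← integral_const_mul]
    congr 1
    ext X
    rw [sub_eq_add_neg, cexpI_add]
    ring
  have hleft : fourierWigner μ (Op μ f u) w₂ 𝒴 = pairing μ u fun W => conj (A W) := by
    have h2 : IsSchwartz fun p : 𝔤 × 𝔤 => u p.1 *
        (opKernel μ f ((-𝒴.1) ● p.2, p.1) * (cexpI (𝒴.2 p.2) * conj (w₂ p.2))) :=
      h1.temperate_mul (u.hasTemperateGrowth.comp (hasTemperateGrowth_fst (by fun_prop)))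
    have h3 := h2.integral_swap μ μ
    simp only [integral_const_mul] at h3
    rw [fourierWigner, pairing, pairing]
    simp only [Complex.conj_conj]
    rw [h3]
    congr 1
    ext X
    rw [weyl, Op_eq, ← integral_const_mul, ← integral_mul_const]
    congr 1
    ext W
    ring
  rw [hleft, intOp]
  simp only [hΨ]
  -- The orthogonality relations with the normalised window `w₁` turn `⟨u, Ā⟩` into an integral over
  -- phase space.
  have h4 := pairing_fourierWigner (μ := μ) u.isSchwartz hAs.conj w₁.isSchwartz
  rw [pairing_self_of_eLpNorm hw₁, mul_one] at h4
  rw [← h4, pairing]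
  simp only [mul_comm]

theorem coNorm_op_le (w₁ w₂ : 𝓢(𝔤, ℂ)) (hw₁ : eLpNorm w₁ 2 μ = 1)
    (B₁ B₂ : Seminorm ℂ 𝓢(Phase 𝔤, ℂ)) (𝔅 : Seminorm ℂ 𝓢(Phase 𝔤 × Phase 𝔤, ℂ)) (C : ℝ)
    (hInt : ∀ Ψ : 𝓢(Phase 𝔤 × Phase 𝔤, ℂ), OpNormLE B₁ B₂ (intS μ Ψ) (C * 𝔅 Ψ))
    (f : 𝓢(Phase 𝔤, ℂ)) :
    OpNormLE (coNorm μ w₁ B₁) (coNorm μ w₂ B₂) (opS μ f)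
      (C * symbolCoNorm μ (wignerS μ w₁ w₂) 𝔅 f) := by
  intro u
  have h := hInt (toSchwartz (symbolTransform μ (wignerS μ w₁ w₂) (ofFun μ f)))
    (toSchwartz (fourierWigner μ u w₁))
  rw [intS, (isSchwartz_symbolTransform f w₁ w₂).coe_toSchwartz,
    (u.isSchwartz.fourierWigner w₁.isSchwartz).coe_toSchwartz,
    ← fourierWigner_op f u w₁ w₂ hw₁] at h
  rwa [coNorm, coNorm, symbolCoNorm, opS, (f.isSchwartz.op u.isSchwartz).coe_toSchwartz]

end CoorbitNorms

end Coorbit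

theorem theorem6p10 {𝔤 : Type*} [NormedLieRing 𝔤] [NormedLieAlgebra 𝔤] [FiniteDimensional ℝ 𝔤]
    [LieRing.IsNilpotent 𝔤] [MeasurableSpace 𝔤] [BorelSpace 𝔤]
    (μ : Measure 𝔤) [μ.IsAddHaarMeasure]
    (w₁ w₂ : 𝓢(𝔤, ℂ)) (hw₁ : eLpNorm w₁ 2 μ = 1) (hw₂ : eLpNorm w₂ 2 μ = 1)
    (B₁ B₂ : Seminorm ℂ 𝓢(Coorbit.Phase 𝔤, ℂ))
    (hB₁ : Coorbit.IsNorm B₁) (hB₂ : Coorbit.IsNorm B₂)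
    (𝔅 : Seminorm ℂ 𝓢(Coorbit.Phase 𝔤 × Coorbit.Phase 𝔤, ℂ)) (h𝔅 : Coorbit.IsNorm 𝔅)
    (C : ℝ) (hC : 0 < C)
    (hInt : ∀ Ψ : 𝓢(Coorbit.Phase 𝔤 × Coorbit.Phase 𝔤, ℂ),
      Coorbit.OpNormLE B₁ B₂ (Coorbit.intS μ Ψ) (C * 𝔅 Ψ)) :
    -- `𝒲_{w₁,w₂}` is in the Schwartz space and has its defining property
    Coorbit.IsSchwartz (Coorbit.wigner μ w₁ w₂) ∧
    (∀ f : 𝓢(Coorbit.Phase 𝔤, ℂ), Coorbit.pairing μ (Coorbit.Op μ f w₁) w₂ =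
      Coorbit.pairing (Coorbit.phaseMeasure μ) f (Coorbit.wigner μ w₁ w₂)) ∧
    -- the functions of which the coorbit norms are made are Schwartz functions
    (∀ u : 𝓢(𝔤, ℂ), Coorbit.IsSchwartz (Coorbit.fourierWigner μ u w₁) ∧
      Coorbit.IsSchwartz (Coorbit.fourierWigner μ u w₂)) ∧
    ∀ f : 𝓢(Coorbit.Phase 𝔤, ℂ),
      Coorbit.IsSchwartz
        (Coorbit.symbolTransform μ (Coorbit.wignerS μ w₁ w₂) (Coorbit.ofFun μ f)) ∧
      (∀ u : 𝓢(𝔤, ℂ), Coorbit.IsSchwartz (Coorbit.Op μ f u)) ∧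
      -- the bound
      Coorbit.OpNormLE (Coorbit.coNorm μ w₁ B₁) (Coorbit.coNorm μ w₂ B₂) (Coorbit.opS μ f)
        (C * Coorbit.symbolCoNorm μ (Coorbit.wignerS μ w₁ w₂) 𝔅 f) :=
  ⟨w₁.isSchwartz.wigner w₂.isSchwartz,
    fun f => Coorbit.pairing_Op f.isSchwartz w₁.isSchwartz w₂.isSchwartz,
    fun u => ⟨u.isSchwartz.fourierWigner w₁.isSchwartz, u.isSchwartz.fourierWigner w₂.isSchwartz⟩,
    fun f => ⟨Coorbit.isSchwartz_symbolTransform f w₁ w₂, fun u => f.isSchwartz.op u.isSchwartz,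
      Coorbit.coNorm_op_le w₁ w₂ hw₁ B₁ B₂ 𝔅 C hInt f⟩⟩
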